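/- Let $L$ be a finite relational language in which every relation symbol $E$ has arity at least $2$, and let $\overline\alpha : L \to (0,1]$ be a function such that, if all symbols of $L$ are binary, then it is not the case that $\overline\alpha(E)=1$ for all $E\in L$. Let $K_L$ be the class of finite $L$-structures (including the empty one) in which every relation is symmetric and irreflexive (if $E(\overline a)$ holds then $\overline a$ has no repetitions and $E$ holds of every permutation of $\overline a$). For $\mathfrak A\in K_L$ put $\delta(\mathfrak A)=|A|-\sum_{E\in L}\overline\alpha(E)N_E(\mathfrak A)$, where $N_E(\mathfrak A)$ is the number of subsets of $A$ on which $E$ holds, and let $K_{\overline\alpha}=\{\mathfrak A\in K_L:\delta(\mathfrak A')\ge 0\text{ for all }\mathfrak A'\subseteq\mathfrak A\}$. For $\mathfrak A\subseteq\mathfrak B$ in $K_L$ write $\mathfrak A\le\mathfrak B$ if $\delta(\mathfrak A)\le\delta(\mathfrak A')$ for all $\mathfrak A\subseteq\mathfrak A'\subseteq\mathfrak B$; call $(\mathfrak A,\mathfrak B)$ a minimal pair if $\mathfrak A\not\le\mathfrak B$ but $\mathfrak A\le\mathfrak C$ for all $\mathfrak A\subseteq\mathfrak C\subsetneq\mathfrak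 B$. A minimal chain over $\mathfrak A$ is a finite sequence $\mathfrak A=\mathfrak B_0\subseteq\mathfrak B_1\subseteq\dots\subseteq\mathfrak B_n$, $n\ge 0$, such that each $(\mathfrak B_i,\mathfrak B_{i+1})$ is a minimal pair; its union is $\mathfrak B_n$. For $\mathfrak A\subseteq\mathfrak B$ in $K_{\overline\alpha}$, with enumerations without repetition of $A$ and of $B\setminus A$, let $\Delta_{\mathfrak A}(\overline x)$ and $\Delta_{\mathfrak A,\mathfrak B}(\overline x,\overline y)$ be the atomic diagrams of $\mathfrak A$ and $\mathfrak B$. The extension formula of $(\mathfrak A,\mathfrak B)$ is $\Psi_{\mathfrak A,\mathfrak B}(\overline x)=\Delta_{\mathfrak A}(\overline x)\wedge\exists\overline y\,\Delta_{\mathfrak A,\mathfrak B}(\overline x,\overline y)$; it is called chain-minimal if $\mathfrak B$ is the union of a minimal chain over $\mathfrak A$. Let $S_{\overline\alpha}$ be the theory whose axioms say of a structure $\mathfrak M$ that (1) every finite substructure of $\mathfrak M$ is in $K_{\overline\alpha}$, that is, $\forall\overline x\,\neg\Delta_{\mathfrak A}(\overline x)$ for every finite $L$-structure $\mathfrak A\notin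 K_{\overline\alpha}$; and (2) for all $\mathfrak A\le\mathfrak B$ in $K_{\overline\alpha}$, every embedding of $\mathfrak A$ into $\mathfrak M$ extends to an embedding of $\mathfrak B$ into $\mathfrak M$, that is, $\forall\overline x\,(\Delta_{\mathfrak A}(\overline x)\to\exists\overline y\,\Delta_{\mathfrak A,\mathfrak B}(\overline x,\overline y))$. Then every axiom of $S_{\overline\alpha}$ is logically equivalent to a $\forall\exists$-sentence, and every $L$-formula is equivalent modulo $S_{\overline\alpha}$ to a boolean combination of chain-minimal extension formulas in (subtuples of) the same free variables. -/

import Mathlib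

open FirstOrder FirstOrder.Language

namespace BaldwinShi

universe u v w

/-- The relation symbols of `L`; the first component of a symbol is its arity. -/
abbrev Symb (L : FirstOrder.Language.{u, v}) : Type v := Σ n, L.Relations n

section Rank

variable {L : FirstOrder.Language.{u, v}} {M : Type w} [L.Structure M]

/-- `N_E(X)`: the number of subsets of `X` on which the relation `E` holds. -/
noncomputable def edgeCount (E : Symb L) (X : Finset M) : ℕ :=
  {S : Finset M | S ⊆ X ∧ ∃ x : Fin E.1 → M, Structure.RelMap E.2 x ∧ (S : Set M) = Set.range x}.ncard

/-- The rank `δ(X) = |X| - ∑_E α(E) N_E(X)` of a finite subset `X` of `M`.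
As the language is relational, `X` is the universe of a (unique) substructure of `M`. -/
noncomputable def rank [Fintype (Symb L)] (α : Symb L → ℝ) (X : Finset M) : ℝ :=
  (X.card : ℝ) - ∑ E : Symb L, α E * (edgeCount E X : ℝ)

/-- `A ≤ B` for finite substructures of `M`. -/
def Strong [Fintype (Symb L)] (α : Symb L → ℝ) (A B : Finset M) : Prop :=
  A ⊆ B ∧ ∀ C : Finset M, A ⊆ C → C ⊆ B → rank α A ≤ rank α C

/-- `(A, B)` is a minimal pair. -/
def MinimalPair [Fintype (Symb L)] (α : Symb L → ℝ) (A B : Finset M) : Prop :=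
  A ⊆ B ∧ (∀ C : Finset M, A ⊆ C → C ⊂ B → Strong α A C) ∧ ¬ Strong α A B

/-- `B` is the union of a minimal chain over `A`: there is a finite sequence
`A = B₀ ⊆ B₁ ⊆ ⋯ ⊆ Bₙ = B`, `n ≥ 0`, in which every `(Bᵢ, Bᵢ₊₁)` is a minimal pair. -/
def MinimalChain [Fintype (Symb L)] (α : Symb L → ℝ) (A B : Finset M) : Prop :=
  Relation.ReflTransGen (MinimalPair α) A B

end Rank

section Classes

variable (L : FirstOrder.Language.{u, v}) (M : Type w) [L.Structure M]

/-- Every relation symbol is interpreted irreflexively and symmetrically in `M`. -/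
def IsHypergraph : Prop :=
  ∀ (E : Symb L) (x : Fin E.1 → M), Structure.RelMap E.2 x →
    Function.Injective x ∧ ∀ π : Equiv.Perm (Fin E.1), Structure.RelMap E.2 (x ∘ π)

/-- For finite `M`, membership of `M` in the class `K_α`. -/
def InK [Fintype (Symb L)] (α : Symb L → ℝ) : Prop :=
  IsHypergraph L M ∧ ∀ X : Finset M, 0 ≤ rank (L := L) α X

end Classes

section Formulas

variable {L : FirstOrder.Language.{u, v}}

open Classical in
/-- The atomic diagram of the substructure of `M` with universe `range e`, in the enumeration `e`:
the conjunction of all equalities, relations, and negations thereof that hold among the `e i`. -/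
noncomputable def atomicDiagram [Fintype (Symb L)] {M ι : Type} [L.Structure M] [Finite ι]
    (e : ι → M) : L.Formula ι :=
  (Formula.iInf fun p : ι × ι =>
    if e p.1 = e p.2 then Term.equal (Term.var p.1) (Term.var p.2)
    else (Term.equal (Term.var p.1) (Term.var p.2)).not) ⊓
  (Formula.iInf fun p : (E : Symb L) × (Fin E.1 → ι) =>
    if Structure.RelMap p.1.2 (e ∘ p.2) then p.1.2.formula fun i => Term.var (p.2 i)
    else (p.1.2.formula fun i => Term.var (p.2 i)).not)

/-- The universe of the substructure `A` inside a structure `B` on `Fin m ⊕ Fin k`: finite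
structures `A ⊆ B` with enumerations of `A` and `B \ A` are represented, up to isomorphism, by
structures on `Fin m ⊕ Fin k`, where `A` is the left summand. -/
def base (m k : ℕ) : Finset (Fin m ⊕ Fin k) := Finset.univ.map Function.Embedding.inl

/-- `∃ y, Δ_{A,B}(x, y)`. -/
noncomputable def existsExt [Fintype (Symb L)] (m k : ℕ) [L.Structure (Fin m ⊕ Fin k)] :
    L.Formula (Fin m) :=
  Formula.iExs (Fin k) (atomicDiagram (id : Fin m ⊕ Fin k → Fin m ⊕ Fin k))

/-- The extension formula `Ψ_{A,B}(x) = Δ_A(x) ∧ ∃ y, Δ_{A,B}(x, y)`. -/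
noncomputable def extensionFormula [Fintype (Symb L)] (m k : ℕ) [L.Structure (Fin m ⊕ Fin k)] :
    L.Formula (Fin m) :=
  atomicDiagram (Sum.inl : Fin m → Fin m ⊕ Fin k) ⊓ existsExt m k

/-- The chain-minimal extension formulas `Ψ_{A,B}(x)`, where `A ⊆ B` are in `K_α` and `B` is the
union of a minimal chain over `A`, in distinct variables `x` from `V`. -/
def chainMinimalFormulas [Fintype (Symb L)] (α : Symb L → ℝ) (V : Type w) : Set (L.Formula V) :=
  {ψ | ∃ (m k : ℕ) (_ : L.Structure (Fin m ⊕ Fin k)) (x : Fin m ↪ V),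
    InK L (Fin m ⊕ Fin k) α ∧ MinimalChain (L := L) α (base m k) Finset.univ ∧
    ψ = (extensionFormula m k).relabel x}

/-- Boolean combinations of formulas in `S`. -/
inductive IsBoolComb {V : Type w} (S : Set (L.Formula V)) : L.Formula V → Prop
  | of (φ : L.Formula V) : φ ∈ S → IsBoolComb S φ
  | not (φ : L.Formula V) : IsBoolComb S φ → IsBoolComb S φ.not
  | and (φ ψ : L.Formula V) : IsBoolComb S φ → IsBoolComb S ψ → IsBoolComb S (φ ⊓ ψ)
  | or (φ ψ : L.Formula V) : IsBoolComb S φ → IsBoolComb S ψ → IsBoolComb S (φ ⊔ ψ)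

/-- The sentence `∀ x, φ(x)`. -/
noncomputable def forallClosure {m : ℕ} (φ : L.Formula (Fin m)) : L.Sentence :=
  Formula.iAlls (Fin m) (φ.relabel (Sum.inr : Fin m → Empty ⊕ Fin m))

/-- Axioms saying that every finite substructure is in `K_α`:
`∀ x, ¬ Δ_A(x)` for every finite structure `A` that is not in `K_α`. -/
def substructureAxioms [Fintype (Symb L)] (α : Symb L → ℝ) : L.Theory :=
  {σ | ∃ (m : ℕ) (_ : L.Structure (Fin m)), ¬ InK L (Fin m) α ∧
    σ = forallClosure (atomicDiagram (id : Fin m → Fin m)).not}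

/-- Axioms saying that, for all `A ≤ B` in `K_α`, every embedding of `A` extends to an embedding
of `B`: `∀ x, (Δ_A(x) → ∃ y, Δ_{A,B}(x, y))`. -/
def extensionAxioms [Fintype (Symb L)] (α : Symb L → ℝ) : L.Theory :=
  {σ | ∃ (m k : ℕ) (_ : L.Structure (Fin m ⊕ Fin k)),
    InK L (Fin m ⊕ Fin k) α ∧ Strong (L := L) α (base m k) Finset.univ ∧
    σ = forallClosure ((atomicDiagram (Sum.inl : Fin m → Fin m ⊕ Fin k)).imp (existsExt m k))}

/-- The theory `S_α`. -/
def theoryS [Fintype (Symb L)] (α : Symb L → ℝ) : L.Theory :=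
  substructureAxioms α ∪ extensionAxioms α

/-- `σ` is, up to logical equivalence, a sentence `∀ x, ∃ y, φ(x, y)` with `φ` quantifier-free. -/
def IsForallExists (σ : L.Sentence) : Prop :=
  ∃ (m k : ℕ) (φ : L.Formula (Fin m ⊕ Fin k)), φ.IsQF ∧
    σ ⇔[(∅ : L.Theory)] forallClosure (Formula.iExs (Fin k) φ)

end Formulas

end BaldwinShi

open BaldwinShi

/-!
The axioms of `S_α` are visibly `∀∃`, because atomic diagrams are quantifier-free and models are
nonempty. The elimination of quantifiers down to chain-minimal extension formulas is a
back-and-forth argument between two models `M` and `N`.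

A finite set is `n`-closed if no extension by at most `n` points has smaller rank. As the rank is
submodular, nonnegative, and drops by amounts bounded away from `0`, every set has an `n`-closure;
it is reached by a minimal chain, its size is bounded, and every minimal chain with steps of at
most `n` points stays inside the closed sets that contain its start (`exists_closure_bound`,
`Closed.subset_of_shortChain`). Hence chain-minimal extension formulas with few quantified
variables describe the isomorphism type of the closure of a tuple, and conversely an isomorphism
between closed sets that contain two tuples makes them satisfy the same of these formulas
(`Sim.exists_isEmb`, `realize_extensionFormula_of_closed`).

In the back-and-forth step (`exists_sim_step`) there are tuples `a`, `b` that agree on many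
chain-minimal formulas, and a new point `c` of `M`. Let `B` be the `n`-closure of `a c`, and let
`A ≤ B` be the part of `B` reached by minimal chains over `a`. Then `A` has a copy over `b` which is
`n`-closed in `N`, and this copy has to be extended to an `n`-closed copy of `B`. That this is
possible is the heart of the proof (`exists_closed_extension`). The axioms yield copies of `B`, but
not closed ones, so one constructs a larger extension of a large closed set `A'`: to a point of
`B \ A` in the free amalgam of `A'` and `B` one attaches a long path, joined to points of `A'` by
further edges, which has negative rank over the amalgam, as close to the negative of the rank `ρ`
of `B` over `A` as desired. Then the extension is still strong, so the axioms realise it, but its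
rank over `A'` is too small to leave room for a small extension of `B` of smaller rank.

The path must not have negative rank on sets that contain few of its points or miss the point of
`B \ A` (`exists_attached_path`). Its edges carry the symbol of largest weight below `1`, or, if all
weights are `1`, a symbol of arity at least `3`; the hypothesis on the weights provides one. The
numbers of edges of each kind come from Dirichlet's approximation theorem (`exists_path_weights`).
The additional edges are distributed evenly along the path, so that the load of each set of its
vertices is bounded by means of a potential (`exists_blocks`, `load_le_of_potential`), and they are
joined in turn to a fixed number of hubs, one of which is the point of `B \ A`; dropping the edges
to this point lightens long intervals enough (`exists_potential`).

Finally, since the truth of a formula is preserved between tuples that agree on finitely many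
chain-minimal formulas (`exists_sim_realize`), it is equivalent to a boolean combination of these
(`exists_isBoolComb`).
-/

namespace BaldwinShi

/-! ### Weighted hypergraphs -/

section Hypergraph

open Classical in
/-- The number of edges of kind `F` inside `X`, for a family `𝓔` of sets of edges. -/
noncomputable def ecard {ι T : Type*} (𝓔 : ι → Set (Finset T)) (F : ι) (X : Finset T) : ℕ :=
  (X.powerset.filter (· ∈ 𝓔 F)).card

/-- The rank `|X| - ∑_F α(F) e_F(X)` of a finite set of vertices of a weighted hypergraph. -/
noncomputable def hrank {ι T : Type*} [Fintype ι] (α : ι → ℝ) (𝓔 : ι → Set (Finset T))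
    (X : Finset T) : ℝ :=
  (X.card : ℝ) - ∑ F, α F * (ecard 𝓔 F X : ℝ)

/-- `f` restricts to an isomorphism from the sub-hypergraph on `D` to its image. -/
def IsEmb {ι T T' : Type*} (𝓔 : ι → Set (Finset T)) (𝓔' : ι → Set (Finset T')) (f : T → T')
    (D : Finset T) : Prop :=
  Set.InjOn f D ∧ ∀ F, ∀ S ⊆ D, ∀ S' : Finset T', (S' : Set T') = f '' S → (S ∈ 𝓔 F ↔ S' ∈ 𝓔' F)

variable {ι T T' T'' : Type*} {𝓔 : ι → Set (Finset T)} {𝓔' : ι → Set (Finset T')}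
  {𝓔'' : ι → Set (Finset T'')}

lemma ecard_mono (F : ι) {X Y : Finset T} (h : X ⊆ Y) : ecard 𝓔 F X ≤ ecard 𝓔 F Y := by
  classical
  exact Finset.card_le_card (Finset.filter_subset_filter _ (Finset.powerset_mono.2 h))

lemma ecard_add_le [DecidableEq T] (F : ι) (X Y : Finset T) :
    ecard 𝓔 F X + ecard 𝓔 F Y ≤ ecard 𝓔 F (X ∪ Y) + ecard 𝓔 F (X ∩ Y) := by
  classical
  unfold ecard
  rw [← Finset.card_union_add_card_inter]
  refine Nat.add_le_add (Finset.card_le_card ?_) (Finset.card_le_card ?_)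
  · intro S
    simp only [Finset.mem_union, Finset.mem_filter, Finset.mem_powerset]
    rintro (⟨h, h'⟩ | ⟨h, h'⟩)
    · exact ⟨h.trans Finset.subset_union_left, h'⟩
    · exact ⟨h.trans Finset.subset_union_right, h'⟩
  · intro S
    simp only [Finset.mem_inter, Finset.mem_filter, Finset.mem_powerset]
    rintro ⟨⟨h, h'⟩, ⟨h'', -⟩⟩
    exact ⟨Finset.subset_inter h h'', h'⟩

lemma IsEmb.mono {f : T → T'} {D D' : Finset T} (h : IsEmb 𝓔 𝓔' f D) (hD : D' ⊆ D) :
    IsEmb 𝓔 𝓔' f D' :=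
  ⟨h.1.mono (by exact_mod_cast hD), fun F S hS => h.2 F S (hS.trans hD)⟩

lemma IsEmb.mem_iff [DecidableEq T'] {f : T → T'} {D S : Finset T} (h : IsEmb 𝓔 𝓔' f D)
    (hS : S ⊆ D) (F : ι) : S ∈ 𝓔 F ↔ S.image f ∈ 𝓔' F :=
  h.2 F S hS _ (Finset.coe_image ..)

lemma IsEmb.comp [DecidableEq T'] {f : T → T'} {g : T' → T''} {D : Finset T}
    (hf : IsEmb 𝓔 𝓔' f D) (hg : IsEmb 𝓔' 𝓔'' g (D.image f)) : IsEmb 𝓔 𝓔'' (g ∘ f) D := by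
  refine ⟨hg.1.comp hf.1 fun x hx => ?_, fun F S hS S' hS' => ?_⟩
  · simpa using ⟨x, hx, rfl⟩
  · rw [hf.mem_iff hS]
    refine hg.2 F _ (Finset.image_subset_image hS) _ ?_
    rw [hS', Set.image_comp, Finset.coe_image]

lemma IsEmb.inv [DecidableEq T'] {f : T → T'} {g : T' → T} {D : Finset T}
    (hf : IsEmb 𝓔 𝓔' f D) (h : ∀ x ∈ D, g (f x) = x) : IsEmb 𝓔' 𝓔 g (D.image f) := by
  classical
  refine ⟨?_, fun F S hS S' hS' => ?_⟩
  · intro x hx y hy hxy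
    simp only [Finset.coe_image, Set.mem_image, Finset.mem_coe] at hx hy
    obtain ⟨x, hx, rfl⟩ := hx
    obtain ⟨y, hy, rfl⟩ := hy
    rw [h x hx, h y hy] at hxy
    rw [hxy]
  · obtain ⟨R, hR, rfl⟩ := Finset.subset_image_iff.1 hS
    have : S' = R := by
      apply Finset.coe_injective
      rw [hS', Finset.coe_image, Set.image_image]
      ext x
      constructor
      · rintro ⟨y, hy, rfl⟩
        simp only [h y (hR hy)]
        exact hy
      · intro hx
        exact ⟨x, hx, h x (hR hx)⟩
    rw [this, ← hf.mem_iff hR]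

/-- If `e` and `v` are embeddings of the same finite hypergraph, then `v ∘ e⁻¹` is an embedding; it
is extended by `f` to a total map. -/
lemma IsEmb.extend [DecidableEq T] [Fintype T''] {e : T'' → T} {v : T'' → T'}
    (he : IsEmb 𝓔'' 𝓔 e Finset.univ) (hv : IsEmb 𝓔'' 𝓔' v Finset.univ) (f : T → T') :
    IsEmb 𝓔 𝓔' (Function.extend e v f) (Finset.univ.image e) := by
  have hei : Function.Injective e := fun i j h => he.1 (by simp) (by simp) h
  refine ⟨?_, fun F S hS S' hS' => ?_⟩
  · intro x hx x' hx' hxx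
    obtain ⟨i, -, rfl⟩ := Finset.mem_image.1 (Finset.mem_coe.1 hx)
    obtain ⟨j, -, rfl⟩ := Finset.mem_image.1 (Finset.mem_coe.1 hx')
    rw [hei.extend_apply, hei.extend_apply] at hxx
    rw [hv.1 (by simp) (by simp) hxx]
  · obtain ⟨R, -, rfl⟩ := Finset.subset_image_iff.1 hS
    rw [← he.mem_iff (Finset.subset_univ R)]
    refine hv.2 F R (Finset.subset_univ R) S' ?_
    rw [hS', Finset.coe_image, Set.image_image]
    exact Set.image_congr fun i _ => hei.extend_apply v f i

lemma IsEmb.ecard_image [DecidableEq T'] {f : T → T'} {D X : Finset T}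
    (h : IsEmb 𝓔 𝓔' f D) (hX : X ⊆ D) (F : ι) : ecard 𝓔' F (X.image f) = ecard 𝓔 F X := by
  classical
  unfold ecard
  symm
  refine Finset.card_bij (fun S _ => S.image f) ?_ ?_ ?_
  · intro S hS
    simp only [Finset.mem_filter, Finset.mem_powerset] at hS ⊢
    exact ⟨Finset.image_subset_image hS.1, (h.mem_iff (hS.1.trans hX) F).1 hS.2⟩
  · intro S hS R hR hSR
    simp only [Finset.mem_filter, Finset.mem_powerset] at hS hR
    have hS' := hS.1.trans hX
    have hR' := hR.1.trans hX
    have : (f '' S) = f '' R := by rw [← Finset.coe_image, ← Finset.coe_image, hSR]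
    exact Finset.coe_injective
      ((h.1.image_eq_image_iff (by exact_mod_cast hS') (by exact_mod_cast hR')).1 this)
  · intro S hS
    simp only [Finset.mem_filter, Finset.mem_powerset] at hS
    obtain ⟨R, hR, rfl⟩ := Finset.subset_image_iff.1 hS.1
    exact ⟨R, by simpa [hR] using (h.mem_iff (hR.trans hX) F).2 hS.2, rfl⟩

lemma IsEmb.card_image [DecidableEq T'] {f : T → T'} {D X : Finset T}
    (h : IsEmb 𝓔 𝓔' f D) (hX : X ⊆ D) : (X.image f).card = X.card :=
  Finset.card_image_of_injOn (h.1.mono (by exact_mod_cast hX))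

variable [Fintype ι] {α : ι → ℝ}

lemma IsEmb.hrank_image [DecidableEq T'] {f : T → T'} {D X : Finset T}
    (h : IsEmb 𝓔 𝓔' f D) (hX : X ⊆ D) : hrank α 𝓔' (X.image f) = hrank α 𝓔 X := by
  simp only [hrank, h.ecard_image hX, h.card_image hX]

/-- The rank is submodular. -/
lemma hrank_union_add_inter_le [DecidableEq T] (hα : ∀ F, 0 < α F) (X Y : Finset T) :
    hrank α 𝓔 (X ∪ Y) + hrank α 𝓔 (X ∩ Y) ≤ hrank α 𝓔 X + hrank α 𝓔 Y := by
  have h1 : ((X ∪ Y).card : ℝ) + (X ∩ Y).card = X.card + Y.card := by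
    exact_mod_cast Finset.card_union_add_card_inter X Y
  have h2 : ∑ F, α F * (ecard 𝓔 F X : ℝ) + ∑ F, α F * (ecard 𝓔 F Y : ℝ) ≤
      ∑ F, α F * (ecard 𝓔 F (X ∪ Y) : ℝ) + ∑ F, α F * (ecard 𝓔 F (X ∩ Y) : ℝ) := by
    rw [← Finset.sum_add_distrib, ← Finset.sum_add_distrib]
    refine Finset.sum_le_sum fun F _ => ?_
    rw [← mul_add, ← mul_add]
    refine mul_le_mul_of_nonneg_left ?_ (hα F).le
    exact_mod_cast ecard_add_le F X Y
  unfold hrank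
  linarith

lemma hrank_le_card (hα : ∀ F, 0 < α F) (X : Finset T) : hrank α 𝓔 X ≤ X.card := by
  have : 0 ≤ ∑ F, α F * (ecard 𝓔 F X : ℝ) :=
    Finset.sum_nonneg fun F _ => mul_nonneg (hα F).le (Nat.cast_nonneg _)
  unfold hrank
  linarith

/-- The relative rank of `X ⊆ Y` is `|Y \ X|` minus a nonnegative integral combination of the
weights. -/
lemma exists_hrank_sub_eq [DecidableEq T] (α : ι → ℝ) (𝓔 : ι → Set (Finset T)) {X Y : Finset T}
    (h : X ⊆ Y) :
    ∃ y : ι → ℕ, hrank α 𝓔 Y - hrank α 𝓔 X = ((Y \ X).card : ℝ) - ∑ F, α F * (y F : ℝ) := by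
  refine ⟨fun F => ecard 𝓔 F Y - ecard 𝓔 F X, ?_⟩
  have h1 : ((Y \ X).card : ℝ) = Y.card - X.card := by
    rw [Finset.card_sdiff_of_subset h, Nat.cast_sub (Finset.card_le_card h)]
  have h2 : ∀ F, ((ecard 𝓔 F Y - ecard 𝓔 F X : ℕ) : ℝ) = ecard 𝓔 F Y - ecard 𝓔 F X :=
    fun F => Nat.cast_sub (ecard_mono F h)
  simp only [h1, h2, mul_sub, Finset.sum_sub_distrib, hrank]
  ring

/-- Negative values of `x - ∑_F α(F) y(F)` with `x ≤ n` are bounded away from `0`. -/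
lemma exists_gap (hα : ∀ F, 0 < α F) (n : ℕ) :
    ∃ η : ℝ, 0 < η ∧ ∀ x ≤ n, ∀ y : ι → ℕ, (x : ℝ) - ∑ F, α F * (y F : ℝ) < 0 →
      (x : ℝ) - ∑ F, α F * (y F : ℝ) ≤ -η := by
  classical
  -- the values in `[-1, 0)` are attained for `y` in a finite box
  let box : Finset (ℕ × (ι → ℕ)) :=
    Finset.range (n + 1) ×ˢ Fintype.piFinset fun F => Finset.range (⌈((n : ℝ) + 1) / α F⌉₊ + 1)
  let val : ℕ × (ι → ℕ) → ℝ := fun p => (p.1 : ℝ) - ∑ F, α F * (p.2 F : ℝ)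
  let vals : Finset ℝ := insert 1 ((box.filter fun p => val p < 0).image fun p => -val p)
  have hne : vals.Nonempty := ⟨1, Finset.mem_insert_self _ _⟩
  have hpos : ∀ z ∈ vals, 0 < z := by
    intro z hz
    simp only [vals, Finset.mem_insert, Finset.mem_image, Finset.mem_filter] at hz
    rcases hz with rfl | ⟨p, ⟨-, hp⟩, rfl⟩
    · exact one_pos
    · linarith
  refine ⟨vals.min' hne, hpos _ (vals.min'_mem hne), fun x hx y hxy => ?_⟩
  by_cases hbox : (x, y) ∈ box
  · have : -val (x, y) ∈ vals := Finset.mem_insert_of_mem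
      (Finset.mem_image_of_mem (fun p => -val p) (Finset.mem_filter.2 ⟨hbox, hxy⟩))
    have := vals.min'_le _ this
    simp only [val] at this
    linarith
  · have h1 := vals.min'_le 1 (Finset.mem_insert_self _ _)
    have hF : ∃ F, ⌈((n : ℝ) + 1) / α F⌉₊ + 1 ≤ y F := by
      by_contra! hcon
      exact hbox (by simpa [box] using ⟨by omega, fun F => by have := hcon F; omega⟩)
    obtain ⟨F, hF⟩ := hF
    have h2 : (n : ℝ) + 1 ≤ α F * y F := by
      have h3 : ((n : ℝ) + 1) / α F ≤ y F :=
        (Nat.le_ceil _).trans (by exact_mod_cast (Nat.le_succ _).trans hF)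
      rwa [div_le_iff₀' (hα F)] at h3
    have h4 : α F * (y F : ℝ) ≤ ∑ F, α F * (y F : ℝ) :=
      Finset.single_le_sum (f := fun F => α F * (y F : ℝ))
        (fun F _ => mul_nonneg (hα F).le (Nat.cast_nonneg _)) (Finset.mem_univ F)
    have h5 : (x : ℝ) ≤ n := by exact_mod_cast hx
    linarith

end Hypergraph

/-! ### Closed sets and minimal chains -/

section Closure

variable {L : FirstOrder.Language} {M N : Type*} [L.Structure M] [L.Structure N]

variable (L M) in
/-- The edges of a structure: the sets on which a relation symbol holds. -/
def edges : Symb L → Set (Finset M) := fun E =>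
  {S | ∃ x : Fin E.1 → M, Structure.RelMap E.2 x ∧ (S : Set M) = Set.range x}

variable [Fintype (Symb L)] {α : Symb L → ℝ}

lemma rank_eq_hrank (α : Symb L → ℝ) (X : Finset M) : rank α X = hrank α (edges L M) X := by
  classical
  unfold rank hrank
  congr 1
  refine Finset.sum_congr rfl fun E _ => ?_
  congr 2
  unfold edgeCount ecard
  rw [← Set.ncard_coe_finset]
  congr 1
  ext S
  rw [Finset.mem_coe, Finset.mem_filter, Finset.mem_powerset]
  rfl

/-- `A` is `n`-closed: no extension of `A` by at most `n` points has smaller rank. -/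
def Closed (α : Symb L → ℝ) (n : ℕ) (A : Finset M) : Prop :=
  ∀ C, A ⊆ C → C.card ≤ A.card + n → rank α A ≤ rank α C

/-- There is a minimal chain from `A` to `B` each step of which adds at most `n` points. -/
def ShortChain (α : Symb L → ℝ) (n : ℕ) : Finset M → Finset M → Prop :=
  Relation.ReflTransGen fun A B => MinimalPair α A B ∧ B.card ≤ A.card + n

lemma ShortChain.minimalChain {n : ℕ} {A B : Finset M} (h : ShortChain α n A B) :
    MinimalChain α A B := by
  induction h with
  | refl => exact Relation.ReflTransGen.refl
  | tail _ h ih => exact Relation.ReflTransGen.tail ih h.1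

lemma MinimalChain.subset {A B : Finset M} (h : MinimalChain α A B) : A ⊆ B := by
  induction h with
  | refl => exact Finset.Subset.refl _
  | tail _ h ih => exact ih.trans h.1

lemma MinimalChain.shortChain {n : ℕ} {A B : Finset M} (h : MinimalChain α A B)
    (hn : B.card ≤ A.card + n) : ShortChain α n A B := by
  induction h with
  | refl => exact Relation.ReflTransGen.refl
  | @tail B C hB h ih =>
    have h1 := Finset.card_le_card h.1
    have h2 := Finset.card_le_card (MinimalChain.subset hB)
    exact Relation.ReflTransGen.tail (ih (h1.trans hn)) ⟨h, by omega⟩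

lemma MinimalPair.rank_lt {A B : Finset M} (h : MinimalPair α A B) : rank α B < rank α A := by
  by_contra! hle
  refine h.2.2 ⟨h.1, fun C hAC hCB => ?_⟩
  rcases eq_or_ne C B with rfl | hne
  · exact hle
  · exact (h.2.1 C hAC (hCB.ssubset_of_ne hne)).2 C hAC subset_rfl

lemma MinimalPair.rank_le {A B C : Finset M} (h : MinimalPair α A B) (hAC : A ⊆ C)
    (hCB : C ⊂ B) : rank α A ≤ rank α C :=
  (h.2.1 C hAC hCB).2 C hAC subset_rfl

/-- A superset of smaller rank contains a minimal pair. -/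
lemma exists_minimalPair_of_rank_lt {A C : Finset M} (hAC : A ⊆ C) (h : rank α C < rank α A) :
    ∃ B ⊆ C, MinimalPair α A B := by
  classical
  obtain ⟨B, hB, hmin⟩ := Finset.exists_min_image
    (C.powerset.filter fun B => A ⊆ B ∧ rank α B < rank α A) Finset.card
    ⟨C, by simp [hAC, h]⟩
  simp only [Finset.mem_filter, Finset.mem_powerset] at hB hmin
  refine ⟨B, hB.1, hB.2.1, fun D hAD hDB => ⟨hAD, fun D' hAD' hDD' => ?_⟩, fun hS => ?_⟩
  · by_contra! hlt
    have h1 := hmin D' ⟨hDD'.trans (hDB.1.trans hB.1), hAD', hlt⟩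
    have h2 := Finset.card_lt_card (hDD'.trans_ssubset hDB)
    omega
  · exact absurd (hS.2 B hB.2.1 subset_rfl) (not_le.2 hB.2.2)

lemma exists_minimalPair_of_not_closed {n : ℕ} {A : Finset M} (h : ¬ Closed α n A) :
    ∃ B, MinimalPair α A B ∧ B.card ≤ A.card + n := by
  unfold Closed at h
  push Not at h
  obtain ⟨C, hAC, hc, hlt⟩ := h
  obtain ⟨B, hBC, hB⟩ := exists_minimalPair_of_rank_lt hAC hlt
  exact ⟨B, hB, (Finset.card_le_card hBC).trans hc⟩

lemma rank_submodular [DecidableEq M] (hα : ∀ F, 0 < α F) (X Y : Finset M) :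
    rank α (X ∪ Y) + rank α (X ∩ Y) ≤ rank α X + rank α Y := by
  simpa only [rank_eq_hrank] using hrank_union_add_inter_le hα X Y

lemma card_union_le_of_inter [DecidableEq M] {A C B : Finset M} (hAC : A ⊆ C) (hAB : A ⊆ B)
    {n : ℕ} (hn : C.card ≤ A.card + n) : (C ∪ B).card ≤ B.card + n := by
  have h1 := Finset.card_union_add_card_inter C B
  have h2 := Finset.card_le_card (Finset.subset_inter hAC hAB)
  omega

/-- Minimal chains with small steps do not leave closed sets. -/
lemma Closed.subset_of_shortChain (hα : ∀ F, 0 < α F) {n : ℕ} {Z A B : Finset M}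
    (hZ : Closed α n Z) (hA : A ⊆ Z) (h : ShortChain α n A B) : B ⊆ Z := by
  classical
  induction h with
  | refl => exact hA
  | @tail B C _ h ih =>
    by_contra hCZ
    have h1 : rank α B ≤ rank α (C ∩ Z) := h.1.rank_le (Finset.subset_inter h.1.1 ih)
      (Finset.inter_subset_left.ssubset_of_ne fun h => hCZ (Finset.inter_eq_left.1 h))
    have h2 := h.1.rank_lt
    have h3 := rank_submodular (α := α) hα C Z
    have h4 := hZ (C ∪ Z) Finset.subset_union_right (card_union_le_of_inter h.1.1 ih h.2)
    linarith

/-- A strong subset of a closed set is closed. -/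
lemma Closed.of_strong (hα : ∀ F, 0 < α F) {n : ℕ} {A B : Finset M} (hB : Closed α n B)
    (h : Strong α A B) : Closed α n A := by
  classical
  intro C hAC hc
  have h1 := h.2 (C ∩ B) (Finset.subset_inter hAC h.1) Finset.inter_subset_right
  have h2 := rank_submodular (α := α) hα C B
  have h3 := hB (C ∪ B) Finset.subset_union_right (card_union_le_of_inter hAC h.1 hc)
  linarith

/-- Between `A` and `B` there is a largest set reached by minimal chains over `A`; it is strong in
`B`. -/
lemma exists_minimalChain_strong {A B : Finset M} (hAB : A ⊆ B) :
    ∃ C, MinimalChain α A C ∧ Strong α C B := by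
  classical
  obtain ⟨C, hC, hmax⟩ := Finset.exists_max_image
    (B.powerset.filter fun C => MinimalChain α A C) Finset.card
    ⟨A, Finset.mem_filter.2 ⟨Finset.mem_powerset.2 hAB, Relation.ReflTransGen.refl⟩⟩
  simp only [Finset.mem_filter, Finset.mem_powerset] at hC hmax
  refine ⟨C, hC.2, hC.1, fun D hCD hDB => ?_⟩
  by_contra! hlt
  obtain ⟨E, hED, hE⟩ := exists_minimalPair_of_rank_lt hCD hlt
  have h1 := hmax E ⟨hED.trans hDB, Relation.ReflTransGen.tail hC.2 hE⟩
  have h2 : C = E := Finset.eq_of_subset_of_card_le hE.1 h1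
  exact absurd hE.rank_lt (by rw [h2]; exact lt_irrefl _)

/-- The decrease of the rank under extensions by at most `n` points is bounded away from `0`,
uniformly in all structures. -/
lemma exists_rank_gap (hα : ∀ F, 0 < α F) (n : ℕ) :
    ∃ η : ℝ, 0 < η ∧ ∀ {M : Type*} [L.Structure M] {A B : Finset M}, A ⊆ B →
      B.card ≤ A.card + n → rank α B < rank α A → rank α B ≤ rank α A - η := by
  classical
  obtain ⟨η, hη, h⟩ := exists_gap hα n
  refine ⟨η, hη, fun {M} _ {A B} hAB hn hlt => ?_⟩
  obtain ⟨y, hy⟩ := exists_hrank_sub_eq α (edges L M) hAB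
  rw [rank_eq_hrank, rank_eq_hrank] at hlt ⊢
  have := h (B \ A).card (by rw [Finset.card_sdiff_of_subset hAB]; omega) y (by linarith)
  linarith

/-- The `n`-closure of a set of at most `p` points exists, is reached by a minimal chain with steps
of size at most `n`, and adds a number of points that is bounded in terms of `n` and `p`. -/
lemma exists_closure_bound (hα : ∀ F, 0 < α F) (n p : ℕ) :
    ∃ s : ℕ, ∀ {M : Type*} [L.Structure M], (∀ X : Finset M, 0 ≤ rank α X) → ∀ A : Finset M,
      A.card ≤ p → ∃ C, ShortChain α n A C ∧ Closed α n C ∧ C.card ≤ A.card + s := by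
  obtain ⟨η, hη, hgap⟩ := exists_rank_gap (L := L) hα n
  obtain ⟨j, hj⟩ := exists_nat_gt ((p : ℝ) / η)
  rw [div_lt_iff₀ hη] at hj
  refine ⟨n * j, fun {M} _ hK A hA => ?_⟩
  -- as long as the set is not closed, the rank drops by at least `η` in each step; this cannot go
  -- on for more than `p / η` steps because the rank is nonnegative
  have key : ∀ j : ℕ, (∃ C, ShortChain α n A C ∧ Closed α n C ∧ C.card ≤ A.card + n * j) ∨
      ∃ C, ShortChain α n A C ∧ rank α C ≤ rank α A - j * η ∧ C.card ≤ A.card + n * j := by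
    intro j
    induction j with
    | zero => exact Or.inr ⟨A, Relation.ReflTransGen.refl, by simp, by simp⟩
    | succ j ih =>
      rcases ih with ⟨C, h1, h2, h3⟩ | ⟨C, h1, h2, h3⟩
      · exact Or.inl ⟨C, h1, h2, by rw [mul_add]; omega⟩
      · by_cases hC : Closed α n C
        · exact Or.inl ⟨C, h1, hC, by rw [mul_add]; omega⟩
        · obtain ⟨B, hB, hc⟩ := exists_minimalPair_of_not_closed hC
          have := hgap hB.1 hc hB.rank_lt
          refine Or.inr ⟨B, Relation.ReflTransGen.tail h1 ⟨hB, hc⟩, ?_, by rw [mul_add]; omega⟩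
          push_cast
          linarith
  rcases key j with h | ⟨C, -, h2, -⟩
  · exact h
  · have h3 : rank α A ≤ A.card := by
      rw [rank_eq_hrank]
      exact hrank_le_card hα A
    have h4 : (A.card : ℝ) ≤ p := by exact_mod_cast hA
    linarith [hK C]

lemma IsEmb.rank_image [DecidableEq N] {f : M → N} {D X : Finset M}
    (h : IsEmb (edges L M) (edges L N) f D) (hX : X ⊆ D) : rank α (X.image f) = rank α X := by
  rw [rank_eq_hrank, rank_eq_hrank, h.hrank_image hX]

lemma IsEmb.strong_image [DecidableEq N] {f : M → N} {D X Y : Finset M}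
    (h : IsEmb (edges L M) (edges L N) f D) (hY : Y ⊆ D) (hX : X ⊆ D) :
    Strong α (X.image f) (Y.image f) ↔ Strong α X Y := by
  classical
  have hsub : ∀ {X Y : Finset M}, X ⊆ D → Y ⊆ D → (X.image f ⊆ Y.image f ↔ X ⊆ Y) := by
    intro X Y hX hY
    refine ⟨fun hXY x hx => ?_, Finset.image_subset_image⟩
    obtain ⟨y, hy, hxy⟩ := Finset.mem_image.1 (hXY (Finset.mem_image_of_mem f hx))
    rwa [← h.1 (hY hy) (hX hx) hxy]
  unfold Strong
  rw [hsub hX hY]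
  refine and_congr_right fun _ => ⟨fun hS C hXC hCY => ?_, fun hS C hXC hCY => ?_⟩
  · have := hS (C.image f) (Finset.image_subset_image hXC) (Finset.image_subset_image hCY)
    rwa [h.rank_image hX, h.rank_image (hCY.trans hY)] at this
  · obtain ⟨R, hR, rfl⟩ := Finset.subset_image_iff.1 hCY
    rw [h.rank_image hX, h.rank_image ((show R ⊆ Y from hR).trans hY)]
    exact hS R ((hsub hX (hR.trans hY)).1 hXC) hR

lemma IsEmb.minimalPair_image [DecidableEq N] {f : M → N} {X Y : Finset M}
    (h : IsEmb (edges L M) (edges L N) f Y) (hXY : MinimalPair α X Y) :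
    MinimalPair α (X.image f) (Y.image f) := by
  refine ⟨Finset.image_subset_image hXY.1, fun C hXC hCY => ?_, ?_⟩
  · obtain ⟨R, hR, rfl⟩ := Finset.subset_image_iff.1 hCY.1
    have hR : R ⊆ Y := hR
    rw [h.strong_image hR hXY.1]
    refine hXY.2.1 R (fun x hx => ?_) (hR.ssubset_of_ne ?_)
    · obtain ⟨y, hy, hxy⟩ := Finset.mem_image.1 (hXC (Finset.mem_image_of_mem f hx))
      rwa [← h.1 (hR hy) (hXY.1 hx) hxy]
    · rintro rfl
      exact hCY.2 subset_rfl
  · rw [h.strong_image subset_rfl hXY.1]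
    exact hXY.2.2

lemma IsEmb.shortChain_image [DecidableEq N] {n : ℕ} {f : M → N} {X Y : Finset M}
    (h : IsEmb (edges L M) (edges L N) f Y) (hXY : ShortChain α n X Y) :
    ShortChain α n (X.image f) (Y.image f) := by
  induction hXY with
  | refl => exact Relation.ReflTransGen.refl
  | @tail B C _ hBC ih =>
    refine Relation.ReflTransGen.tail (ih (h.mono hBC.1.1)) ⟨h.minimalPair_image hBC.1, ?_⟩
    rw [h.card_image hBC.1.1, h.card_image subset_rfl]
    exact hBC.2

lemma IsEmb.minimalChain_image [DecidableEq N] {f : M → N} {X Y : Finset M}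
    (h : IsEmb (edges L M) (edges L N) f Y) (hXY : MinimalChain α X Y) :
    MinimalChain α (X.image f) (Y.image f) := by
  have h' : ShortChain α Y.card X Y := hXY.shortChain (Nat.le_add_left _ _)
  exact (h.shortChain_image h').minimalChain

end Closure

/-! ### Approximation of ranks by integral combinations of the weights -/

section Approximation

/-- Multiples of a real number can be approximated from above by integers. -/
lemma exists_int_sub_mul_mem_Ico (β : ℝ) {ε : ℝ} (hε : 0 < ε) (Q : ℕ) :
    ∃ (q : ℕ) (z : ℤ), Q ≤ q ∧ 0 ≤ z - q * β ∧ z - q * β < ε := by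
  obtain ⟨n, hn⟩ := exists_nat_gt (1 / ε)
  have hn0 : 0 < n := by
    have : (0 : ℝ) < n := (one_div_pos.2 hε).trans hn
    exact_mod_cast this
  -- Dirichlet's theorem for a multiple of `β`, so that the denominators obtained are large
  obtain ⟨j, k, hk, hkn, hjk⟩ := Real.exists_int_int_abs_mul_sub_le ((Q + 1 : ℕ) * β) hn0
  have hsmall : (1 : ℝ) / (n + 1) < ε := by
    rw [div_lt_iff₀ (by positivity)]
    rw [div_lt_iff₀ hε] at hn
    nlinarith
  lift k to ℕ using hk.le
  have hk0 : 0 < k := by exact_mod_cast hk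
  set x : ℝ := j - k * ((Q + 1 : ℕ) * β) with hx
  have habs : |x| < ε := by
    rw [hx, abs_sub_comm]
    exact (by simpa using hjk : _ ≤ _).trans_lt hsmall
  rcases le_or_gt 0 x with h0 | h0
  · refine ⟨k * (Q + 1), j, by nlinarith, ?_, ?_⟩
    · push_cast at hx ⊢
      linarith
    · rw [abs_of_nonneg h0] at habs
      push_cast at hx ⊢
      linarith
  · -- walk down from `1` in steps of length `|x|`
    rw [abs_of_neg h0] at habs
    have hpos : 0 < -x := by linarith
    set i := ⌊1 / (-x)⌋₊ with hi
    have h1 : (i : ℝ) * (-x) ≤ 1 := by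
      have := Nat.floor_le (one_div_pos.2 hpos).le
      rwa [← hi, le_div_iff₀ hpos] at this
    have h2 : 1 < ((i : ℝ) + 1) * (-x) := by
      have := Nat.lt_floor_add_one (1 / (-x))
      rwa [← hi, div_lt_iff₀ hpos] at this
    rcases Nat.eq_zero_or_pos i with h3 | h3
    · rw [h3] at h2
      refine ⟨Q, ⌈(Q : ℝ) * β⌉, le_rfl, by linarith [Int.le_ceil ((Q : ℝ) * β)], ?_⟩
      have := Int.ceil_lt_add_one ((Q : ℝ) * β)
      norm_num at h2
      linarith
    · refine ⟨i * (k * (Q + 1)), 1 + i * j, ?_, ?_, ?_⟩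
      · calc Q ≤ 1 * (1 * (Q + 1)) := by omega
          _ ≤ i * (k * (Q + 1)) := by gcongr <;> omega
      · push_cast at hx ⊢
        have : (1 : ℝ) + i * j - i * (k * (Q + 1)) * β = 1 - i * (-x) := by rw [hx]; ring
        linarith
      · push_cast at hx ⊢
        have : (1 : ℝ) + i * j - i * (k * (Q + 1)) * β = 1 - i * (-x) := by rw [hx]; ring
        linarith

variable {ι : Type*} [Fintype ι] {α : ι → ℝ}

/-- `E` is suitable as the symbol of the edges of long paths: either it has the largest weight below
`1`, or all weights are `1` and it has arity at least `3`. -/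
def IsPathSymbol (α : ι → ℝ) (ar : ι → ℕ) (E : ι) : Prop :=
  (α E < 1 ∧ ∀ F, α F ≤ α E ∨ α F = 1) ∨ (3 ≤ ar E ∧ ∀ F, α F = 1)

lemma exists_isPathSymbol {ar : ι → ℕ} (h2 : ∀ F, 2 ≤ ar F) (hα : ∀ F, 0 < α F ∧ α F ≤ 1)
    (hα' : (∀ F, ar F = 2) → ¬ ∀ F, α F = 1) : ∃ E, IsPathSymbol α ar E := by
  classical
  by_cases h : ∀ F, α F = 1
  · obtain ⟨E, hE⟩ : ∃ E, ar E ≠ 2 := by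
      by_contra! hcon
      exact hα' hcon h
    exact ⟨E, Or.inr ⟨by have := h2 E; omega, h⟩⟩
  · push Not at h
    obtain ⟨F, hF⟩ := h
    obtain ⟨E, hE, hmax⟩ := Finset.exists_max_image (Finset.univ.filter fun F => α F ≠ 1) α
      ⟨F, by simpa using hF⟩
    simp only [Finset.mem_filter, Finset.mem_univ, true_and] at hE hmax
    exact ⟨E, Or.inl ⟨lt_of_le_of_ne (hα E).2 hE, fun F => or_iff_not_imp_right.2 (hmax F)⟩⟩

/-- The multiset that contains `F` with multiplicity `e F`, as a list. -/
lemma exists_list_sum_eq (e : ι → ℕ) :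
    ∃ l : List ι, (∀ F ∈ l, e F ≠ 0) ∧ (l.map α).sum = ∑ F, (e F : ℝ) * α F := by
  classical
  refine ⟨(∑ F, Multiset.replicate (e F) F).toList, fun F hF => ?_, ?_⟩
  · rw [Multiset.mem_toList, Multiset.mem_sum] at hF
    obtain ⟨G, -, hG⟩ := hF
    obtain ⟨h1, rfl⟩ := Multiset.mem_replicate.1 hG
    exact h1
  · rw [← Multiset.sum_coe, ← Multiset.map_coe, Multiset.coe_toList]
    rw [show Multiset.map α (∑ F, Multiset.replicate (e F) F) =
      ∑ F, Multiset.map α (Multiset.replicate (e F) F) from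
        map_sum (Multiset.mapAddMonoidHom α) _ _]
    rw [Multiset.sum_sum]
    simp

/-- A long path with `N` vertices and `N - 1` edges `E`, together with a list `l` of further edges,
can have relative rank arbitrarily close to, and not below, any given value `-ρ` which is, up to
sign, a relative rank in `(0, 1]`. -/
lemma exists_path_weights {ar : ι → ℕ} (hα : ∀ F, 0 < α F ∧ α F ≤ 1) {E : ι}
    (hE : IsPathSymbol α ar E) {ρ : ℝ} (hρ0 : 0 < ρ) (hρ1 : ρ ≤ 1) {p : ℕ} {c : ι → ℕ}
    (hρ : ρ = p - ∑ F, α F * (c F : ℝ)) {ε : ℝ} (hε : 0 < ε) (N₀ : ℕ) :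
    ∃ (N : ℕ) (l : List ι), N₀ ≤ N ∧ (∀ F ∈ l, α F ≤ α E) ∧
      -ρ ≤ N - α E * (N - 1) - (l.map α).sum ∧ N - α E * (N - 1) - (l.map α).sum < -ρ + ε := by
  classical
  rcases hE with ⟨hE1, hE⟩ | ⟨-, h1⟩
  swap
  -- if all weights are `1`, then `ρ = 1`, and two edges besides those of the path give the
  -- value `-1`
  · have h2 : ρ = ((p : ℤ) - ∑ F, (c F : ℤ) : ℤ) := by
      rw [hρ]
      simp [h1]
    have h3 : ρ = 1 := by
      rw [h2] at hρ0 hρ1 ⊢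
      have h4 : (0 : ℤ) < (p : ℤ) - ∑ F, (c F : ℤ) := by exact_mod_cast hρ0
      have h5 : (p : ℤ) - ∑ F, (c F : ℤ) ≤ 1 := by exact_mod_cast hρ1
      have : (p : ℤ) - ∑ F, (c F : ℤ) = 1 := by omega
      rw [this]
      simp
    have h4 : (N₀ : ℝ) - α E * (N₀ - 1) - ([E, E].map α).sum = -ρ := by
      simp only [h1, h3, List.map_cons, List.map_nil, List.sum_cons, List.sum_nil]
      ring
    exact ⟨N₀, [E, E], le_rfl, by simp, h4.ge, by rw [h4]; linarith⟩
  -- the symbols with weight at most `α E`; the others have weight `1`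
  let U : Finset ι := Finset.univ.filter fun F => α F ≤ α E
  have hEU : E ∈ U := by simp [U]
  -- The edges consist of the `N - 1` edges of the path and the list `l`. Together they should be
  -- `q` copies of the combination `β` of the weights, which contains `α E` with the large
  -- coefficient `R`, minus the combination `c`; then the value is `z - q β - ρ` for an integer `z`.
  -- The choice of `R` ensures that `q R` exceeds the number of edges of the path.
  obtain ⟨R, hR⟩ := exists_nat_gt ((∑ F ∈ U.erase E, α F + 1) / (1 - α E))
  have hpos : 0 < 1 - α E := by linarith
  rw [div_lt_iff₀ hpos] at hR
  have hβ'0 : 0 ≤ ∑ F ∈ U.erase E, α F := Finset.sum_nonneg fun F _ => (hα F).1.le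
  set β' := ∑ F ∈ U.erase E, α F with hβ'
  set β := β' + R * α E with hβ
  have hR0 : 0 < (R : ℝ) := by
    by_contra! h
    nlinarith
  have hβ0 : 0 < β := by
    have := mul_pos hR0 (hα E).1
    linarith
  -- symbols of weight `1` only change the integral part of `ρ`
  set p' : ℤ := p - ∑ F ∈ Uᶜ, (c F : ℤ) with hp'
  have hρ' : ρ = p' - ∑ F ∈ U.erase E, α F * (c F : ℝ) - α E * c E := by
    have h2 : ∑ F ∈ Uᶜ, α F * (c F : ℝ) = ∑ F ∈ Uᶜ, (c F : ℝ) := by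
      refine Finset.sum_congr rfl fun F hF => ?_
      rcases hE F with h | h
      · simp [U] at hF
        linarith
      · rw [h, one_mul]
    rw [hρ, ← Finset.sum_add_sum_compl U, h2, ← Finset.add_sum_erase U _ hEU, hp']
    push_cast
    ring
  obtain ⟨Q₁, hQ₁⟩ := exists_nat_gt (((N₀ : ℝ) + |(p' : ℝ)|) / β)
  rw [div_lt_iff₀ hβ0] at hQ₁
  obtain ⟨Q₂, hQ₂⟩ := exists_nat_gt ((c E : ℝ) + 1 + |(p' : ℝ)|)
  obtain ⟨q, z, hq, hz0, hz1⟩ := exists_int_sub_mul_mem_Ico β (lt_min hε one_pos)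
    (max (∑ F, c F) (max Q₁ Q₂))
  have hz2 := hz1.trans_le (min_le_left _ _)
  have hz3 := hz1.trans_le (min_le_right _ _)
  have hqc : ∀ F, c F ≤ q := fun F =>
    (Finset.single_le_sum (fun _ _ => Nat.zero_le _) (Finset.mem_univ F)).trans
      ((le_max_left _ _).trans hq)
  have hq1 : (Q₁ : ℝ) ≤ q := by
    exact_mod_cast (le_max_left _ _).trans ((le_max_right _ _).trans hq)
  have hq2 : (Q₂ : ℝ) ≤ q := by
    exact_mod_cast (le_max_right _ _).trans ((le_max_right _ _).trans hq)
  have hN : (N₀ : ℤ) ≤ z - p' := by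
    have h1 := le_abs_self (p' : ℝ)
    have h2 := mul_le_mul_of_nonneg_right hq1 hβ0.le
    have : (N₀ : ℝ) ≤ ((z - p' : ℤ) : ℝ) := by push_cast; linarith
    exact_mod_cast this
  obtain ⟨N, hN'⟩ := Int.eq_ofNat_of_zero_le ((Int.natCast_nonneg N₀).trans hN)
  have hNr : (N : ℝ) = z - p' := by
    have : ((N : ℤ) : ℝ) = ((z - p' : ℤ) : ℝ) := by exact_mod_cast hN'.symm
    push_cast at this
    exact this
  -- the number of additional edges of symbol `E`
  have heE : (0 : ℤ) ≤ R * q - c E - (z - p') + 1 := by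
    have h1 := neg_abs_le (p' : ℝ)
    have h2 : (q : ℝ) * (R * (1 - α E)) ≥ q * (β' + 1) :=
      mul_le_mul_of_nonneg_left hR.le (Nat.cast_nonneg _)
    have h3 : (q : ℝ) * β = q * β' + q * (R * α E) := by rw [hβ]; ring
    have : (0 : ℝ) ≤ ((R * q - c E - (z - p') + 1 : ℤ) : ℝ) := by
      push_cast
      linarith
    exact_mod_cast this
  obtain ⟨e, he⟩ := Int.eq_ofNat_of_zero_le heE
  have her : (e : ℝ) = R * q - c E - N + 1 := by
    have : ((e : ℤ) : ℝ) = ((R * q - c E - (z - p') + 1 : ℤ) : ℝ) := by exact_mod_cast he.symm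
    push_cast at this
    rw [this, hNr]
  obtain ⟨l, hl, hsum⟩ := exists_list_sum_eq (α := α)
    (fun F => if F = E then e else if F ∈ U then q - c F else 0)
  have hval : (N : ℝ) - α E * (N - 1) - (l.map α).sum = (z - q * β) - ρ := by
    have h1 : ∑ F, ((if F = E then e else if F ∈ U then q - c F else 0 : ℕ) : ℝ) * α F =
        e * α E + ∑ F ∈ U.erase E, ((q : ℝ) - c F) * α F := by
      rw [← Finset.sum_add_sum_compl U, ← Finset.add_sum_erase U _ hEU]
      have h2 : ∑ F ∈ Uᶜ, ((if F = E then e else if F ∈ U then q - c F else 0 : ℕ) : ℝ) * α F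
          = 0 := by
        refine Finset.sum_eq_zero fun F hF => ?_
        have hF := Finset.mem_compl.1 hF
        have hFE : F ≠ E := by rintro rfl; exact hF hEU
        simp [hF, hFE]
      rw [h2, add_zero]
      congr 1
      · simp
      · refine Finset.sum_congr rfl fun F hF => ?_
        have := Finset.mem_erase.1 hF
        rw [if_neg this.1, if_pos this.2, Nat.cast_sub (hqc F)]
    have h3 : ∑ F ∈ U.erase E, ((q : ℝ) - c F) * α F =
        q * β' - ∑ F ∈ U.erase E, α F * (c F : ℝ) := by
      rw [hβ', Finset.mul_sum, ← Finset.sum_sub_distrib]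
      exact Finset.sum_congr rfl fun F _ => by ring
    rw [hsum, h1, h3, her, hρ', hβ, hNr]
    ring
  refine ⟨N, l, by omega, fun F hF => ?_, by rw [hval]; linarith, by rw [hval]; linarith⟩
  have := hl F hF
  by_cases h1 : F = E
  · rw [h1]
  · by_cases h2 : F ∈ U
    · simpa [U] using h2
    · simp [h1, h2] at this

end Approximation

/-! ### Distribution of edges along a path -/

section Distribution

/-- If the loads `s` at the vertices of a path exceed `θ` by the increments of a potential with
values in `[0, a]`, then every set `I` of vertices, each pair of neighbours in which carries an
additional load `a`, has total load at most `(θ + a) |I|`. -/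
lemma load_le_of_potential {N : ℕ} {s u : ℕ → ℝ} {θ a : ℝ}
    (hu : ∀ j ≤ N, 0 ≤ u j ∧ u j ≤ a) (hs : ∀ i < N, s i ≤ θ + u (i + 1) - u i)
    {I : Finset ℕ} (hI : I ⊆ Finset.range N) :
    a * ((I.filter fun i => i + 1 ∈ I).card : ℝ) + ∑ i ∈ I, s i ≤ (θ + a) * I.card := by
  have hlt : ∀ i ∈ I, i < N := fun i hi => Finset.mem_range.1 (hI hi)
  have h1 : ∑ i ∈ I, s i ≤ θ * I.card + (∑ i ∈ I, u (i + 1) - ∑ i ∈ I, u i) := by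
    rw [← Finset.sum_sub_distrib, mul_comm, ← nsmul_eq_mul, ← Finset.sum_const,
      ← Finset.sum_add_distrib]
    exact Finset.sum_le_sum fun i hi => by linarith [hs i (hlt i hi)]
  -- the terms of the telescoping sum cancel except at the ends of runs
  have h2 : ∑ i ∈ I, u (i + 1) - ∑ i ∈ I, u i ≤
      a * ((I.filter fun i => i + 1 ∉ I).card : ℝ) := by
    have h3 : ∑ i ∈ I.filter (fun i => i + 1 ∈ I), u (i + 1) ≤ ∑ i ∈ I, u i := by
      rw [← Finset.sum_image (f := u) (s := I.filter fun i => i + 1 ∈ I) (g := fun i => i + 1)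
        (fun x _ y _ h => by simpa using h)]
      refine Finset.sum_le_sum_of_subset_of_nonneg ?_ fun i hi _ => (hu i (hlt i hi).le).1
      intro j hj
      obtain ⟨i, hi, rfl⟩ := Finset.mem_image.1 hj
      exact (Finset.mem_filter.1 hi).2
    have h4 : ∑ i ∈ I.filter (fun i => i + 1 ∉ I), u (i + 1) ≤
        a * ((I.filter fun i => i + 1 ∉ I).card : ℝ) := by
      rw [mul_comm, ← nsmul_eq_mul]
      exact Finset.sum_le_card_nsmul _ _ _ fun i hi =>
        (hu (i + 1) (hlt i (Finset.mem_filter.1 hi).1)).2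
    rw [← Finset.sum_filter_add_sum_filter_not I (fun i => i + 1 ∈ I)]
    linarith
  have h5 : ((I.filter fun i => i + 1 ∈ I).card : ℝ) + (I.filter fun i => i + 1 ∉ I).card =
      I.card := by
    exact_mod_cast Finset.card_filter_add_card_filter_not (s := I) (fun i => i + 1 ∈ I)
  calc _ ≤ a * ((I.filter fun i => i + 1 ∈ I).card : ℝ) + (θ * I.card +
        a * ((I.filter fun i => i + 1 ∉ I).card : ℝ)) := by linarith
    _ = θ * I.card + a * (((I.filter fun i => i + 1 ∈ I).card : ℝ) +
        (I.filter fun i => i + 1 ∉ I).card) := by ring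
    _ = _ := by rw [h5]; ring

/-- If the load of every interval is at most `θ` times its length plus `a`, then there is a
potential: the length of a queue with arrivals `s` and service rate `θ`. -/
lemma exists_potential {N : ℕ} {s : ℕ → ℝ} {θ a : ℝ}
    (hs : ∀ i j, i ≤ j → j ≤ N → ∑ l ∈ Finset.Ico i j, s l ≤ θ * (j - i) + a) :
    ∃ u : ℕ → ℝ, (∀ j ≤ N, 0 ≤ u j ∧ u j ≤ a) ∧ ∀ i < N, s i ≤ θ + u (i + 1) - u i := by
  let u : ℕ → ℝ := fun j => Nat.rec 0 (fun i x => max 0 (x + s i - θ)) j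
  have hu : ∀ j, u (j + 1) = max 0 (u j + s j - θ) := fun j => rfl
  have key : ∀ j, 0 ≤ u j ∧ ∃ i ≤ j, u j = ∑ l ∈ Finset.Ico i j, s l - θ * (j - i) := by
    intro j
    induction j with
    | zero => exact ⟨le_rfl, 0, le_rfl, by simp [u]⟩
    | succ j ih =>
      obtain ⟨-, i, hij, hi⟩ := ih
      refine ⟨by rw [hu]; exact le_max_left _ _, ?_⟩
      rcases le_total (u j + s j - θ) 0 with h | h
      · exact ⟨j + 1, le_rfl, by rw [hu, max_eq_left h]; simp⟩
      · refine ⟨i, hij.trans (Nat.le_succ _), ?_⟩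
        rw [hu, max_eq_right h, hi, Finset.sum_Ico_succ_top hij]
        push_cast
        ring
  refine ⟨u, fun j hj => ⟨(key j).1, ?_⟩, fun i _ => ?_⟩
  · obtain ⟨i, hij, hi⟩ := (key j).2
    rw [hi]
    linarith [hs i j hij hj]
  · rw [hu]
    linarith [le_max_right 0 (u i + s i - θ)]

lemma sum_blocks (f : ℕ → ℝ) {μ : ℕ → ℕ} (hμ : Monotone μ) {i j : ℕ} (hij : i ≤ j) :
    ∑ l ∈ Finset.Ico i j, ∑ m ∈ Finset.Ico (μ l) (μ (l + 1)), f m =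
      ∑ m ∈ Finset.Ico (μ i) (μ j), f m := by
  induction j, hij using Nat.le_induction with
  | base => simp
  | succ j hij ih =>
    rw [Finset.sum_Ico_succ_top hij, ih,
      Finset.sum_Ico_consecutive _ (hμ hij) (hμ (Nat.le_succ j))]

/-- A sequence of `T` weights, each at most `a`, of total weight `θ N + a`, is cut into `N`
consecutive blocks such that the weight of the first `j` blocks is between `θ j` and `θ j + a`. -/
lemma exists_blocks {w : ℕ → ℝ} {T N : ℕ} {θ a : ℝ} (hN : 0 < N) (hθ : 0 ≤ θ) (ha : 0 ≤ a)
    (hw : ∀ m < T, w m ≤ a) (hsum : ∑ m ∈ Finset.range T, w m = θ * N + a) :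
    ∃ μ : ℕ → ℕ, Monotone μ ∧ μ 0 = 0 ∧ μ N = T ∧ (∀ j, μ j ≤ T) ∧ ∃ u : ℕ → ℝ,
      ∀ j ≤ N, (0 ≤ u j ∧ u j ≤ a) ∧ ∑ m ∈ Finset.range (μ j), w m = θ * j + u j := by
  classical
  let W : ℕ → ℝ := fun m => ∑ l ∈ Finset.range m, w l
  let μ : ℕ → ℕ := fun j => if j = 0 then 0 else Nat.findGreatest (fun m => W m ≤ θ * j + a) T
  have hμ0 : μ 0 = 0 := if_pos rfl
  have hμ : ∀ j, j ≠ 0 → μ j = Nat.findGreatest (fun m => W m ≤ θ * j + a) T :=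
    fun j hj => if_neg hj
  refine ⟨μ, ?_, hμ0, ?_, ?_, fun j => W (μ j) - θ * j, fun j hj => ⟨?_, by simp [W]⟩⟩
  · intro i j hij
    rcases eq_or_ne i 0 with rfl | hi
    · rw [hμ0]
      exact Nat.zero_le _
    · rw [hμ i hi, hμ j (by omega)]
      refine Nat.findGreatest_mono_left (fun m hm => ?_) T
      have : (i : ℝ) ≤ j := by exact_mod_cast hij
      have := mul_le_mul_of_nonneg_left this hθ
      show W m ≤ _
      linarith
  · rw [hμ N hN.ne']
    have h1 : W T ≤ θ * N + a := hsum.le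
    exact le_antisymm (Nat.findGreatest_le T) (Nat.le_findGreatest le_rfl h1)
  · intro j
    rcases eq_or_ne j 0 with rfl | hj
    · rw [hμ0]
      exact Nat.zero_le _
    · rw [hμ j hj]
      exact Nat.findGreatest_le T
  · rcases eq_or_ne j 0 with rfl | hj0
    · simp [hμ0, W, ha]
    have h0 : W 0 ≤ θ * j + a := by
      simp only [W, Finset.range_zero, Finset.sum_empty]
      positivity
    have h1 : W (μ j) ≤ θ * j + a := by
      rw [hμ j hj0]
      exact Nat.findGreatest_spec (P := fun m => W m ≤ θ * j + a) (Nat.zero_le T) h0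
    refine ⟨?_, by linarith⟩
    rcases eq_or_lt_of_le (Nat.findGreatest_le (P := fun m => W m ≤ θ * j + a) T) with h2 | h2
    · have h3 : W (μ j) = θ * N + a := by
        rw [hμ j hj0, h2]
        exact hsum
      have : (j : ℝ) ≤ N := by exact_mod_cast hj
      have := mul_le_mul_of_nonneg_left this hθ
      linarith
    · rw [← hμ j hj0] at h2
      have h3 : ¬ W (μ j + 1) ≤ θ * j + a := by
        refine Nat.findGreatest_is_greatest (P := fun m => W m ≤ θ * j + a) (n := T) ?_ h2
        rw [← hμ j hj0]
        exact Nat.lt_succ_self _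
      have h4 : W (μ j + 1) = W (μ j) + w (μ j) := Finset.sum_range_succ _ _
      have := hw _ h2
      linarith

/-- A long block of consecutive numbers contains many multiples of `k`. -/
lemma le_card_filter_mod_eq_zero {k x y : ℕ} (hk : 0 < k) (r : ℕ) (h : x + k * r < y) :
    r ≤ ((Finset.Ico x y).filter fun m => m % k = 0).card := by
  have : (Finset.range r).card ≤ ((Finset.Ico x y).filter fun m => m % k = 0).card := by
    refine Finset.card_le_card_of_injOn (fun t => k * (x / k + 1 + t)) (fun t ht => ?_) ?_
    · have ht : t + 1 ≤ r := Finset.mem_range.1 (by simpa using ht)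
      have h1 := Nat.div_add_mod x k
      have h2 := Nat.mod_lt x hk
      have h3 := Nat.mul_le_mul_left k ht
      simp only [Finset.coe_filter, Set.mem_ofPred_eq, Finset.mem_Ico, Nat.mul_mod_right, and_true]
      rw [mul_add] at h3
      constructor <;> (rw [mul_add, mul_add]; omega)
    · intro t _ t' _ htt
      have := Nat.eq_of_mul_eq_mul_left hk htt
      omega
  simpa using this

variable {ι : Type*} [Fintype ι]

lemma exists_sum_eq_comb (α : ι → ℝ) {J : Type*} (s : Finset J) (f : J → ι) :
    ∃ y : ι → ℕ, ∑ j ∈ s, α (f j) = ∑ F, α F * (y F : ℝ) := by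
  classical
  refine ⟨fun F => (s.filter fun j => f j = F).card, ?_⟩
  rw [← Finset.sum_fiberwise s f]
  refine Finset.sum_congr rfl fun F _ => ?_
  rw [Finset.sum_congr rfl fun j hj => by rw [(Finset.mem_filter.1 hj).2], Finset.sum_const,
    nsmul_eq_mul, mul_comm]

end Distribution

/-! ### Attaching a path to a hypergraph -/

section Attach

variable {ι T : Type*}

/-- The hypergraph on `T ⊕ ℕ` that consists of a hypergraph on `T` and of the finitely many
edges in `G`; an edge is given together with its kind. -/
def attach (𝓔 : ι → Set (Finset T)) (G : Finset (ι × Finset (T ⊕ ℕ))) :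
    ι → Set (Finset (T ⊕ ℕ)) :=
  fun F => {S | (∃ R ∈ 𝓔 F, S = R.map Function.Embedding.inl) ∨ (F, S) ∈ G}

lemma map_inl_subset_iff {R : Finset T} {X : Finset (T ⊕ ℕ)} :
    R.map Function.Embedding.inl ⊆ X ↔ R ⊆ X.toLeft := by
  constructor
  · intro h x hx
    rw [Finset.mem_toLeft]
    exact h (Finset.mem_map_of_mem Function.Embedding.inl hx)
  · intro h x hx
    obtain ⟨y, hy, rfl⟩ := Finset.mem_map.1 hx
    exact Finset.mem_toLeft.1 (h hy)

lemma hrank_attach [Fintype ι] [DecidableEq T] (α : ι → ℝ) (𝓔 : ι → Set (Finset T))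
    {G : Finset (ι × Finset (T ⊕ ℕ))} (hG : ∀ q ∈ G, ∃ i, Sum.inr i ∈ q.2)
    (X : Finset (T ⊕ ℕ)) :
    hrank α (attach 𝓔 G) X =
      hrank α 𝓔 X.toLeft + X.toRight.card - ∑ q ∈ G with q.2 ⊆ X, α q.1 := by
  classical
  have h1 : ∀ F, ecard (attach 𝓔 G) F X =
      ecard 𝓔 F X.toLeft + ((G.filter fun q => q.2 ⊆ X).filter fun q => q.1 = F).card := by
    intro F
    have h2 : X.powerset.filter (· ∈ attach 𝓔 G F) =
        (X.toLeft.powerset.filter (· ∈ 𝓔 F)).map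
          ⟨fun R => R.map Function.Embedding.inl, Finset.map_injective _⟩ ∪
        ((G.filter fun q => q.2 ⊆ X).filter fun q => q.1 = F).image Prod.snd := by
      ext S
      have hSG : S ∈ attach 𝓔 G F ↔
          (∃ R ∈ 𝓔 F, S = R.map Function.Embedding.inl) ∨ (F, S) ∈ G := Iff.rfl
      simp only [Finset.mem_filter, Finset.mem_powerset, hSG,
        Finset.mem_union, Finset.mem_map, Function.Embedding.coeFn_mk, Finset.mem_image]
      constructor
      · rintro ⟨hSX, ⟨R, hR, rfl⟩ | hS⟩
        · exact Or.inl ⟨R, ⟨map_inl_subset_iff.1 hSX, hR⟩, rfl⟩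
        · exact Or.inr ⟨(F, S), ⟨⟨hS, hSX⟩, rfl⟩, rfl⟩
      · rintro (⟨R, ⟨hRX, hR⟩, rfl⟩ | ⟨⟨F', S'⟩, ⟨⟨hS, hSX⟩, rfl⟩, rfl⟩)
        · exact ⟨map_inl_subset_iff.2 hRX, Or.inl ⟨R, hR, rfl⟩⟩
        · exact ⟨hSX, Or.inr hS⟩
    unfold ecard
    rw [h2, Finset.card_union_of_disjoint, Finset.card_map, Finset.card_image_of_injOn]
    · rintro ⟨F₁, S₁⟩ hq₁ ⟨F₂, S₂⟩ hq₂ h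
      have hq₁ := (Finset.mem_filter.1 hq₁).2
      have hq₂ := (Finset.mem_filter.1 hq₂).2
      simp only at hq₁ hq₂ h
      rw [hq₁, hq₂, h]
    · rw [Finset.disjoint_left]
      intro S hS hS'
      obtain ⟨R, -, rfl⟩ := Finset.mem_map.1 hS
      obtain ⟨q, hq, hqS⟩ := Finset.mem_image.1 hS'
      obtain ⟨i, hi⟩ := hG q (Finset.mem_filter.1 (Finset.mem_filter.1 hq).1).1
      rw [hqS] at hi
      simp at hi
  have h3 : ∑ q ∈ G with q.2 ⊆ X, α q.1 =
      ∑ F, α F * (((G.filter fun q => q.2 ⊆ X).filter fun q => q.1 = F).card : ℝ) := by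
    rw [← Finset.sum_fiberwise _ Prod.fst]
    refine Finset.sum_congr rfl fun F _ => ?_
    rw [Finset.sum_congr rfl fun q hq => by rw [(Finset.mem_filter.1 hq).2], Finset.sum_const,
      nsmul_eq_mul, mul_comm]
  have h4 : (X.card : ℝ) = X.toLeft.card + X.toRight.card := by
    exact_mod_cast (Finset.card_toLeft_add_card_toRight (u := X)).symm
  unfold hrank
  simp only [h1, h3, h4, Nat.cast_add, mul_add, Finset.sum_add_distrib]
  ring

end Attach

/-! ### Paths with edges to a set of hubs -/

section Gadget

variable {ι T : Type*} [DecidableEq T]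

/-- The `r`-element edge that joins the `i`-th and the next vertex of a path, filled up with
hubs. -/
def pathEdge (hub : ℕ → T) (r i : ℕ) : Finset (T ⊕ ℕ) :=
  ((Finset.range (r - 2)).image hub).disjSum {i, i + 1}

/-- The `r`-element edge that joins the `i`-th vertex of a path to the hub with number `m % k`,
filled up with hubs with numbers `≥ k`. -/
def spoke (hub : ℕ → T) (k r m i : ℕ) : Finset (T ⊕ ℕ) :=
  ((insert (m % k) (Finset.Ico k (k + (r - 2)))).image hub).disjSum {i}

/-- Labels for the edges of the path with `N` vertices: `inl i` stands for the path edge at the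
`i`-th vertex, `inr ⟨i, m⟩` for the `m`-th spoke, which is attached to the `i`-th vertex. -/
def pathLabels (μ : ℕ → ℕ) (N : ℕ) : Finset (ℕ ⊕ Σ _ : ℕ, ℕ) :=
  (Finset.range (N - 1)).disjSum
    ((Finset.range N).sigma fun i => Finset.Ico (μ i) (μ (i + 1)))

/-- The edge with a given label, together with its kind: `E` for the edges of the path, and `sym m`
for the `m`-th spoke. -/
def labelledEdge (ar : ι → ℕ) (E : ι) (sym : ℕ → ι) (hub : ℕ → T) (k : ℕ) :
    ℕ ⊕ (Σ _ : ℕ, ℕ) → ι × Finset (T ⊕ ℕ) :=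
  Sum.elim (fun i => (E, pathEdge hub (ar E) i))
    fun q => (sym q.2, spoke hub k (ar (sym q.2)) q.2 q.1)

open Classical in
/-- The set of all edges of the path. -/
noncomputable def pathEdges (ar : ι → ℕ) (E : ι) (sym : ℕ → ι) (hub : ℕ → T) (k : ℕ) (μ : ℕ → ℕ)
    (N : ℕ) : Finset (ι × Finset (T ⊕ ℕ)) :=
  (pathLabels μ N).image (labelledEdge ar E sym hub k)

variable {ar : ι → ℕ} {E : ι} {sym : ℕ → ι} {hub : ℕ → T} {k R : ℕ} {μ : ℕ → ℕ} {N : ℕ}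

lemma exists_inr_mem_of_mem_pathEdges {q : ι × Finset (T ⊕ ℕ)}
    (hq : q ∈ pathEdges ar E sym hub k μ N) : ∃ i, Sum.inr i ∈ q.2 := by
  classical
  obtain ⟨(i | ⟨i, m⟩), -, rfl⟩ := Finset.mem_image.1 hq
  · exact ⟨i, by simp [labelledEdge, pathEdge]⟩
  · exact ⟨i, by simp [labelledEdge, spoke]⟩

lemma card_of_mem_pathEdges (h2 : ∀ F, 2 ≤ ar F) (hk : 0 < k) (hR : ∀ F, ar F ≤ R)
    (hub_inj : Set.InjOn hub (Set.Iio (k + R))) {q : ι × Finset (T ⊕ ℕ)}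
    (hq : q ∈ pathEdges ar E sym hub k μ N) : q.2.card = ar q.1 := by
  classical
  obtain ⟨(i | ⟨i, m⟩), -, rfl⟩ := Finset.mem_image.1 hq
  · have := h2 E
    have := hR E
    simp only [labelledEdge, Sum.elim_inl, pathEdge, Finset.card_disjSum]
    rw [Finset.card_image_of_injOn, Finset.card_range, Finset.card_pair (by omega)]
    · omega
    · exact hub_inj.mono fun x hx => by
        have : x < ar E - 2 := by simpa using hx
        exact Set.mem_Iio.2 (by omega)
  · have := h2 (sym m)
    have := hR (sym m)
    have hm := Nat.mod_lt m hk
    simp only [labelledEdge, Sum.elim_inr, spoke, Finset.card_disjSum]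
    rw [Finset.card_image_of_injOn, Finset.card_insert_of_notMem, Nat.card_Ico,
      Finset.card_singleton]
    · omega
    · simp only [Finset.mem_Ico]
      omega
    · exact hub_inj.mono fun x hx => by
        have : x = m % k ∨ k ≤ x ∧ x < k + (ar (sym m) - 2) := by simpa using hx
        exact Set.mem_Iio.2 (by omega)

lemma labelledEdge_injOn (hk : 0 < k) (hR : ∀ F, ar F ≤ R)
    (hub_inj : Set.InjOn hub (Set.Iio (k + R))) (hμ : ∀ i < N, μ (i + 1) ≤ μ i + k) :
    Set.InjOn (labelledEdge ar E sym hub k) (pathLabels μ N) := by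
  have hr : ∀ {S S' : Finset T} {I I' : Finset ℕ}, S.disjSum I = S'.disjSum I' →
      S = S' ∧ I = I' := fun {S S' I I'} h =>
    ⟨by simpa using congrArg Finset.toLeft h, by simpa using congrArg Finset.toRight h⟩
  rintro (i | ⟨i, m⟩) hi (i' | ⟨i', m'⟩) hi' h
  · have h1 := (hr (Prod.ext_iff.1 h).2).2
    have h2 : i ∈ ({i', i' + 1} : Finset ℕ) := h1 ▸ by simp
    have h3 : i' ∈ ({i, i + 1} : Finset ℕ) := h1.symm ▸ by simp
    simp only [Finset.mem_insert, Finset.mem_singleton] at h2 h3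
    congr 1
    omega
  · have h1 := congrArg Finset.card (hr (Prod.ext_iff.1 h).2).2
    rw [Finset.card_pair (by omega), Finset.card_singleton] at h1
    omega
  · have h1 := congrArg Finset.card (hr (Prod.ext_iff.1 h).2).2
    rw [Finset.card_pair (by omega), Finset.card_singleton] at h1
    omega
  · obtain ⟨h1, h2⟩ := hr (Prod.ext_iff.1 h).2
    obtain rfl : i = i' := by simpa using h2
    have hi : i < N ∧ μ i ≤ m ∧ m < μ (i + 1) := by
      simpa [pathLabels] using Finset.mem_coe.1 hi
    have hi' : i < N ∧ μ i ≤ m' ∧ m' < μ (i + 1) := by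
      simpa [pathLabels] using Finset.mem_coe.1 hi'
    have hμi := hμ i hi.1
    have hm := Nat.mod_lt m hk
    have hm' := Nat.mod_lt m' hk
    have h3 : hub (m % k) ∈ (insert (m' % k) (Finset.Ico k (k + (ar (sym m') - 2)))).image hub := by
      rw [← h1]
      exact Finset.mem_image_of_mem _ (Finset.mem_insert_self _ _)
    obtain ⟨x, hx, hxm⟩ := Finset.mem_image.1 h3
    have hRm := hR (sym m')
    have hx' : x = m' % k ∨ k ≤ x ∧ x < k + (ar (sym m') - 2) := by simpa using hx
    have h4 : x = m % k :=
      hub_inj (Set.mem_Iio.2 (by omega)) (Set.mem_Iio.2 (by omega)) hxm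
    have h5 : m % k = m' % k := by omega
    have h6 : m = m' := by
      rcases le_total m m' with hle | hle
      · have := (Nat.modEq_iff_dvd' hle).1 h5
        have := Nat.eq_zero_of_dvd_of_lt this (by omega)
        omega
      · have := (Nat.modEq_iff_dvd' hle).1 h5.symm
        have := Nat.eq_zero_of_dvd_of_lt this (by omega)
        omega
    rw [h6]

/-- The total weight of the edges of the path that lie in `X`. -/
lemma sum_pathEdges_subset (α : ι → ℝ)
    (hinj : Set.InjOn (labelledEdge ar E sym hub k) (pathLabels μ N)) (X : Finset (T ⊕ ℕ)) :
    ∑ q ∈ pathEdges ar E sym hub k μ N with q.2 ⊆ X, α q.1 =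
      (∑ i ∈ Finset.range (N - 1), if pathEdge hub (ar E) i ⊆ X then α E else 0) +
      ∑ i ∈ Finset.range N, ∑ m ∈ Finset.Ico (μ i) (μ (i + 1)),
        if spoke hub k (ar (sym m)) m i ⊆ X then α (sym m) else 0 := by
  classical
  rw [Finset.sum_filter, pathEdges, Finset.sum_image hinj, pathLabels, Finset.sum_disjSum,
    Finset.sum_sigma]
  rfl

lemma subset_of_pathEdge_subset {r i : ℕ} {X : Finset (T ⊕ ℕ)} (h : pathEdge hub r i ⊆ X) :
    i ∈ X.toRight ∧ i + 1 ∈ X.toRight ∧ (3 ≤ r → hub 0 ∈ X.toLeft) := by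
  refine ⟨?_, ?_, fun hr => ?_⟩
  · exact Finset.mem_toRight.2 (h (by simp [pathEdge]))
  · exact Finset.mem_toRight.2 (h (by simp [pathEdge]))
  · refine Finset.mem_toLeft.2 (h ?_)
    simp only [pathEdge, Finset.inl_mem_disjSum, Finset.mem_image, Finset.mem_range]
    exact ⟨0, by omega, rfl⟩

lemma subset_of_spoke_subset {r m i : ℕ} {X : Finset (T ⊕ ℕ)} (h : spoke hub k r m i ⊆ X) :
    i ∈ X.toRight ∧ (m % k = 0 → hub 0 ∈ X.toLeft) := by
  refine ⟨Finset.mem_toRight.2 (h (by simp [spoke])), fun hm => ?_⟩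
  refine Finset.mem_toLeft.2 (h ?_)
  simp only [spoke, Finset.inl_mem_disjSum, Finset.mem_image]
  exact ⟨0, by simp [hm], rfl⟩

variable {α : ι → ℝ}

lemma sum_spokes_le {X : Finset (T ⊕ ℕ)} (hX : X.toRight ⊆ Finset.range N)
    {w : ℕ → ℝ} (hw : ∀ m, 0 ≤ w m) (hX' : ∀ m i, spoke hub k (ar (sym m)) m i ⊆ X →
      α (sym m) ≤ w m) :
    (∑ i ∈ Finset.range N, ∑ m ∈ Finset.Ico (μ i) (μ (i + 1)),
        if spoke hub k (ar (sym m)) m i ⊆ X then α (sym m) else 0) ≤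
      ∑ i ∈ X.toRight, ∑ m ∈ Finset.Ico (μ i) (μ (i + 1)), w m := by
  rw [← Finset.sum_sdiff hX]
  have h1 : ∀ i ∈ Finset.range N \ X.toRight, ∑ m ∈ Finset.Ico (μ i) (μ (i + 1)),
      (if spoke hub k (ar (sym m)) m i ⊆ X then α (sym m) else 0) ≤ 0 := by
    refine fun i hi => Finset.sum_nonpos fun m _ => ?_
    rw [if_neg fun h => (Finset.mem_sdiff.1 hi).2 (subset_of_spoke_subset h).1]
  refine add_le_of_nonpos_of_le (Finset.sum_nonpos h1)
    (Finset.sum_le_sum fun i _ => Finset.sum_le_sum fun m _ => ?_)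
  · split_ifs with h
    · exact hX' m i h
    · exact hw m

lemma sum_pathEdge_le (hα : ∀ F, 0 < α F) (X : Finset (T ⊕ ℕ)) :
    (∑ i ∈ Finset.range (N - 1), if pathEdge hub (ar E) i ⊆ X then α E else 0) ≤
      α E * ((X.toRight.filter fun i => i + 1 ∈ X.toRight).card : ℝ) := by
  classical
  rw [← Finset.sum_filter, Finset.sum_const, nsmul_eq_mul, mul_comm]
  refine mul_le_mul_of_nonneg_left ?_ (hα E).le
  norm_cast
  refine Finset.card_le_card fun i hi => ?_
  have := subset_of_pathEdge_subset (Finset.mem_filter.1 hi).2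
  exact Finset.mem_filter.2 ⟨this.1, this.2.1⟩

end Gadget

/-! ### Paths of small negative relative rank -/

section PathRank

variable {ι : Type*} [Fintype ι] {α : ι → ℝ} {ar : ι → ℕ} {E : ι}

lemma sum_range_getD {ι : Type*} (α : ι → ℝ) (E : ι) (l : List ι) :
    ∑ m ∈ Finset.range l.length, α (l.getD m E) = (l.map α).sum := by
  induction l with
  | nil => simp
  | cons F l ih =>
    rw [List.length_cons, Finset.sum_range_succ', List.map_cons, List.sum_cons, ← ih]
    simp [add_comm]

/-- There is an injective enumeration of `K` points of `D` that starts with `b`. -/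
lemma exists_hub {T : Type*} {A D : Finset T} {b : T} (hAD : A ⊆ D) (hb : b ∈ D) (hbA : b ∉ A)
    {K : ℕ} (hK : K ≤ A.card) :
    ∃ hub : ℕ → T, hub 0 = b ∧ (∀ t, hub t ∈ D) ∧ Set.InjOn hub (Set.Iio K) := by
  let hub : ℕ → T := fun t => match t with
    | 0 => b
    | t + 1 => if h : t < A.card then (A.equivFin.symm ⟨t, h⟩ : T) else b
  have hsucc : ∀ t (h : t < A.card), hub (t + 1) = (A.equivFin.symm ⟨t, h⟩ : T) :=
    fun t h => dif_pos h
  refine ⟨hub, rfl, fun t => ?_, ?_⟩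
  · rcases t with _ | t
    · exact hb
    · by_cases h : t < A.card
      · rw [hsucc t h]
        exact hAD (A.equivFin.symm ⟨t, h⟩).2
      · have : hub (t + 1) = b := dif_neg h
        rw [this]
        exact hb
  · have hne : ∀ t, t < A.card → hub (t + 1) ≠ b := by
      intro t h heq
      rw [hsucc t h] at heq
      exact hbA (heq ▸ (A.equivFin.symm ⟨t, h⟩).2)
    rintro (_ | t) ht (_ | t') ht' h
    · rfl
    · exact absurd h.symm (hne t' (by have := Set.mem_Iio.1 ht'; omega))
    · exact absurd h (hne t (by have := Set.mem_Iio.1 ht; omega))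
    · have h1 : t < A.card := by have := Set.mem_Iio.1 ht; omega
      have h2 : t' < A.card := by have := Set.mem_Iio.1 ht'; omega
      rw [hsucc t h1, hsucc t' h2] at h
      have := A.equivFin.symm.injective (Subtype.ext h)
      simpa using this

/-- Let `b ∈ D \ A`. If `A` is large enough, then one can attach a path to `A ∪ {b}` whose
rank over `D` is as close to `-ρ` as desired, although it is nonnegative for sets which
do not contain `b` or contain only few points of the path, and never below `-ρ`. -/
lemma exists_attached_path (h2 : ∀ F, 2 ≤ ar F) (hα : ∀ F, 0 < α F ∧ α F ≤ 1)
    (hE : IsPathSymbol α ar E) {ρ : ℝ} (hρ0 : 0 < ρ) (hρ1 : ρ ≤ 1) {p : ℕ} {c : ι → ℕ}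
    (hρ : ρ = p - ∑ F, α F * (c F : ℝ)) {ε : ℝ} (hε : 0 < ε) (n : ℕ) :
    ∃ N K : ℕ, ∀ {T : Type*} (𝓔 : ι → Set (Finset T)) (A D : Finset T) (b : T), A ⊆ D → b ∈ D →
      b ∉ A → K ≤ A.card → ∃ 𝓔' : ι → Set (Finset (T ⊕ ℕ)),
        ((∀ F, ∀ S ∈ 𝓔 F, S.card = ar F) → ∀ F, ∀ S ∈ 𝓔' F, S.card = ar F) ∧
        (∀ F S, S ∈ 𝓔 F ↔ S.map Function.Embedding.inl ∈ 𝓔' F) ∧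
        (∀ X ⊆ D.disjSum (Finset.range N), hrank α 𝓔 X.toLeft - ρ ≤ hrank α 𝓔' X ∧
          (Sum.inl b ∉ X ∨ X.toRight.card ≤ n → hrank α 𝓔 X.toLeft ≤ hrank α 𝓔' X)) ∧
        hrank α 𝓔' (D.disjSum (Finset.range N)) < hrank α 𝓔 D - ρ + ε := by
  classical
  have hα0 : ∀ F, 0 < α F := fun F => (hα F).1
  obtain ⟨F₀, -, hω⟩ := Finset.exists_min_image Finset.univ α ⟨E, Finset.mem_univ E⟩
  replace hω : ∀ F, α F₀ ≤ α F := fun F => hω F (Finset.mem_univ F)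
  set ω := α F₀
  have hω0 : 0 < ω := hα0 F₀
  -- the spokes go to `k` hubs in turn; this number exceeds the number of spokes at each vertex
  obtain ⟨k, hk⟩ := exists_nat_gt (2 / ω)
  rw [div_lt_iff₀ hω0] at hk
  have hk0 : 0 < k := by
    rcases Nat.eq_zero_or_pos k with rfl | h
    · norm_num at hk
    · exact h
  set R := ∑ F, ar F
  have hR : ∀ F, ar F ≤ R := fun F =>
    Finset.single_le_sum (fun _ _ => Nat.zero_le _) (Finset.mem_univ F)
  set a := α E with ha
  have ha0 : 0 < a := hα0 E
  have ha1 : a ≤ 1 := (hα E).2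
  -- if `a < 1`, intervals of more than `n₀` vertices carry at least `k` spokes to the first hub
  obtain ⟨n₀, hn₀⟩ := exists_nat_gt (((k : ℝ) * k + 2) / (1 - a))
  -- for a long path, the relative rank of sets of at most `n₁` vertices cannot lie in the gap
  -- `(-η, 0)`
  set n₁ := max n (max n₀ 1)
  obtain ⟨η, hη, hgap⟩ := exists_gap hα0 n₁
  obtain ⟨N₀, hN₀⟩ := exists_nat_gt ((n₁ : ℝ) / η)
  obtain ⟨N, l, hN, hl, hv1, hv2⟩ :=
    exists_path_weights hα hE hρ0 hρ1 hρ (lt_min hε hρ0) (N₀ + 1)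
  have hN0 : 0 < N := by omega
  have hNr : (0 : ℝ) < N := by exact_mod_cast hN0
  obtain ⟨ρ', hρ'⟩ : ∃ ρ' : ℝ, -ρ' = N - a * (N - 1) - (l.map α).sum := ⟨_, neg_neg _⟩
  rw [← ha, ← hρ'] at hv1 hv2
  have hv3 := min_le_left ε ρ
  have hv4 := min_le_right ε ρ
  have hρ'0 : 0 < ρ' := by linarith
  have hρ'1 : ρ' ≤ 1 := by linarith
  -- the value `-ρ'` is spread evenly over the path: each vertex carries the load `1 - a + κ`, up to
  -- the increments of a potential `u` with values in `[0, a]`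
  obtain ⟨κ, hκ⟩ : ∃ κ : ℝ, κ = ρ' / N := ⟨_, rfl⟩
  have hκN : κ * N = ρ' := by rw [hκ, div_mul_cancel₀ _ hNr.ne']
  have hκ0 : 0 < κ := by rw [hκ]; positivity
  have hκn : ∀ x : ℕ, x ≤ n₁ → κ * x < η := by
    intro x hx
    have h1 : (x : ℝ) ≤ n₁ := by exact_mod_cast hx
    have h2 : (N₀ : ℝ) ≤ N := by exact_mod_cast (Nat.le_succ _).trans hN
    rw [div_lt_iff₀ hη] at hN₀
    have h3 : κ * x ≤ κ * n₁ := mul_le_mul_of_nonneg_left h1 hκ0.le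
    have h4 : κ * n₁ < κ * (N * η) :=
      mul_lt_mul_of_pos_left (hN₀.trans_le (mul_le_mul_of_nonneg_right h2 hη.le)) hκ0
    have h5 : κ * (N * η) = ρ' * η := by rw [← mul_assoc, hκN]
    have h6 : ρ' * η ≤ 1 * η := mul_le_mul_of_nonneg_right hρ'1 hη.le
    linarith
  have hκx : ∀ x : ℕ, x ≤ N → κ * x ≤ ρ' := by
    intro x hx
    rw [← hκN]
    exact mul_le_mul_of_nonneg_left (by exact_mod_cast hx) hκ0.le
  set sym : ℕ → ι := fun m => l.getD m E
  have hsymE : ∀ m, α (sym m) ≤ a := by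
    intro m
    rcases lt_or_ge m l.length with h | h
    · have : sym m = l[m] := List.getD_eq_getElem _ _ h
      rw [this]
      exact hl _ (List.getElem_mem h)
    · have : sym m = E := List.getD_eq_default _ _ h
      rw [this]
  set w : ℕ → ℝ := fun m => α (sym m)
  have hw0 : ∀ m, 0 ≤ w m := fun m => (hα0 _).le
  have hsum : ∑ m ∈ Finset.range l.length, w m = (1 - a + κ) * N + a := by
    have h1 : ∑ m ∈ Finset.range l.length, w m = (l.map α).sum := sum_range_getD α E l
    rw [h1]
    linarith
  obtain ⟨μ, hμ, hμ0, hμN, -, u, hu⟩ := exists_blocks hN0 (by linarith) ha0.le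
    (fun m _ => hsymE m) hsum
  have hblock : ∀ i j, i ≤ j → j ≤ N → ∑ m ∈ Finset.Ico (μ i) (μ j), w m =
      (1 - a + κ) * (j - i) + u j - u i := by
    intro i j hij hj
    rw [Finset.sum_Ico_eq_sub _ (hμ hij), (hu j hj).2, (hu i (hij.trans hj)).2]
    ring
  have hstep : ∀ i < N, ∑ m ∈ Finset.Ico (μ i) (μ (i + 1)), w m =
      (1 - a + κ) + u (i + 1) - u i := by
    intro i hi
    rw [hblock i (i + 1) (Nat.le_succ i) hi]
    push_cast
    ring
  -- short intervals have nonnegative relative rank because of the gap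
  have hshort : ∀ i j, i < j → j ≤ N → j - i ≤ n₁ →
      ∑ m ∈ Finset.Ico (μ i) (μ j), w m ≤ (1 - a) * (j - i) + a := by
    intro i j hij hj hn
    obtain ⟨y, hy⟩ := exists_sum_eq_comb α (Finset.Ico (μ i) (μ j)) sym
    obtain ⟨y', hy'⟩ := exists_sum_eq_comb α (Finset.range (j - i - 1)) (fun _ => E)
    have hcast : ((j - i : ℕ) : ℝ) = j - i := Nat.cast_sub hij.le
    have hcast' : ((j - i - 1 : ℕ) : ℝ) = j - i - 1 := by
      rw [Nat.cast_sub (by omega), hcast, Nat.cast_one]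
    rw [Finset.sum_const, Finset.card_range, nsmul_eq_mul, hcast'] at hy'
    have hval : ((j - i : ℕ) : ℝ) - ∑ F, α F * ((y F + y' F : ℕ) : ℝ) =
        (j - i) - (∑ m ∈ Finset.Ico (μ i) (μ j), w m + (j - i - 1) * a) := by
      rw [hcast, hy, hy', ← Finset.sum_add_distrib]
      congr 1
      exact Finset.sum_congr rfl fun F _ => by push_cast; ring
    have h1 := hgap (j - i) hn (fun F => y F + y' F)
    have h3 := hκn (j - i) hn
    rw [hval] at h1
    rw [hcast] at h3
    have h4 := hblock i j hij.le hj
    have h5 := (hu j hj).1.2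
    have h6 := (hu i (hij.le.trans hj)).1.1
    by_contra! hlt
    have h7 := h1 (by linarith)
    linarith
  have hμk : ∀ i < N, μ (i + 1) ≤ μ i + k := by
    intro i hi
    have h1 : ((Finset.Ico (μ i) (μ (i + 1))).card : ℝ) * ω ≤
        ∑ m ∈ Finset.Ico (μ i) (μ (i + 1)), w m := by
      rw [← nsmul_eq_mul]
      exact Finset.card_nsmul_le_sum _ _ _ fun m _ => hω _
    rw [hstep i hi, Nat.card_Ico] at h1
    have h3 := (hu (i + 1) hi).1.2
    have h4 := (hu i hi.le).1.1
    have h5 := hκx 1 hN0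
    rw [Nat.cast_one, mul_one] at h5
    have h6 : ((μ (i + 1) - μ i : ℕ) : ℝ) < k := by
      by_contra! hcon
      have := mul_le_mul_of_nonneg_right hcon hω0.le
      linarith
    have h7 : μ (i + 1) - μ i < k := by exact_mod_cast h6
    omega
  refine ⟨N, k + R, fun {T} 𝓔 A D b hAD hb hbA hK => ?_⟩
  obtain ⟨hub, rfl, hubD, hub_inj⟩ := exists_hub hAD hb hbA hK
  have hinj : Set.InjOn (labelledEdge ar E sym hub k) (pathLabels μ N) :=
    labelledEdge_injOn hk0 hR hub_inj hμk
  have hG : ∀ q ∈ pathEdges ar E sym hub k μ N, ∃ i, Sum.inr i ∈ q.2 :=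
    fun q hq => exists_inr_mem_of_mem_pathEdges hq
  refine ⟨attach 𝓔 (pathEdges ar E sym hub k μ N), ?_, ?_, fun X hX => ?_, ?_⟩
  · rintro hcard F S (⟨R, hR, rfl⟩ | hS)
    · rw [Finset.card_map]
      exact hcard F R hR
    · exact card_of_mem_pathEdges h2 hk0 hR hub_inj hS
  · refine fun F S => ⟨fun hS => Or.inl ⟨S, hS, rfl⟩, ?_⟩
    rintro (⟨R, hR, h⟩ | hS)
    · rwa [Finset.map_injective _ h]
    · obtain ⟨i, hi⟩ := hG _ hS
      simp at hi
  · have hI : X.toRight ⊆ Finset.range N := fun i hi =>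
      Finset.inr_mem_disjSum.1 (hX (Finset.mem_toRight.1 hi))
    rw [hrank_attach α 𝓔 hG]
    have hIN : X.toRight.card ≤ N := by simpa using Finset.card_le_card hI
    have hle : ∑ q ∈ pathEdges ar E sym hub k μ N with q.2 ⊆ X, α q.1 ≤
        (1 - a + κ + a) * X.toRight.card := by
      rw [sum_pathEdges_subset α hinj X]
      exact (add_le_add (sum_pathEdge_le hα0 X) (sum_spokes_le hI hw0 fun _ _ _ => le_rfl)).trans
        (load_le_of_potential (fun j hj => (hu j hj).1) (fun i hi => (hstep i hi).le) hI)
    refine ⟨by linarith [hκx _ hIN], ?_⟩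
    rintro (hbX | hn)
    swap
    -- a negative relative rank of a set of few vertices would lie in the gap
    · obtain ⟨y, hy⟩ := exists_sum_eq_comb α
        ((pathEdges ar E sym hub k μ N).filter fun q => q.2 ⊆ X) Prod.fst
      have hn1 : X.toRight.card ≤ n₁ := hn.trans (le_max_left _ _)
      have h1 := hgap X.toRight.card hn1 y
      have h3 := hκn X.toRight.card hn1
      rw [← hy] at h1
      by_contra! hlt
      have h4 := h1 (by linarith)
      linarith
    -- without the first hub, the edges that contain it do not count
    suffices h : ∑ q ∈ pathEdges ar E sym hub k μ N with q.2 ⊆ X, α q.1 ≤ X.toRight.card by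
      linarith
    have hbX' : hub 0 ∉ X.toLeft := fun h => hbX (Finset.mem_toLeft.1 h)
    rw [sum_pathEdges_subset α hinj X]
    rcases Nat.lt_or_ge 2 (ar E) with hE3 | hE2
    · -- every path edge contains the first hub
      have h1 : (∑ i ∈ Finset.range (N - 1), if pathEdge hub (ar E) i ⊆ X then α E else 0) = 0 :=
        Finset.sum_eq_zero fun i _ =>
          if_neg fun h => hbX' ((subset_of_pathEdge_subset h).2.2 hE3)
      have h3 := sum_spokes_le (ar := ar) (α := α) (sym := sym) (μ := μ) (hub := hub) (k := k)
        hI hw0 fun _ _ _ => le_rfl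
      have h4 : ∑ i ∈ X.toRight, ∑ m ∈ Finset.Ico (μ i) (μ (i + 1)), w m ≤
          X.toRight.card • (1 : ℝ) := by
        refine Finset.sum_le_card_nsmul _ _ _ fun i hi => ?_
        have := hshort i (i + 1) (Nat.lt_succ_self i) (Finset.mem_range.1 (hI hi))
          (by have := le_max_right n (max n₀ 1); have := le_max_right n₀ 1; omega)
        push_cast at this
        linarith
      rw [nsmul_eq_mul, mul_one] at h4
      linarith
    · have ha1' : a < 1 := by
        rcases hE with h | h
        · exact h.1
        · omega
      have hpos : 0 < 1 - a := by linarith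
      rw [div_lt_iff₀ hpos] at hn₀
      -- the weights without the spokes to the first hub, whose load on intervals is so much smaller
      -- that there is a potential for the smaller rate `1 - a`
      let w' : ℕ → ℝ := fun m => if m % k = 0 then 0 else w m
      have hw' : ∀ m, w' m ≤ w m := fun m => by
        simp only [w']
        split_ifs
        · exact hw0 m
        · exact le_rfl
      have hsplit : ∀ s : Finset ℕ, ∑ m ∈ s, w m =
          ∑ m ∈ s, w' m + ∑ m ∈ s with m % k = 0, w m := by
        intro s
        rw [Finset.sum_filter, ← Finset.sum_add_distrib]
        refine Finset.sum_congr rfl fun m _ => ?_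
        simp only [w']
        split_ifs <;> simp
      have hint : ∀ i j, i ≤ j → j ≤ N →
          ∑ l ∈ Finset.Ico i j, ∑ m ∈ Finset.Ico (μ l) (μ (l + 1)), w' m ≤
            (1 - a) * (j - i) + a := by
        intro i j hij hj
        rw [sum_blocks w' hμ hij]
        rcases hij.eq_or_lt with rfl | hlt
        · simp [ha0.le]
        rcases le_or_gt (j - i) n₀ with hle | hgt
        · exact (Finset.sum_le_sum fun m _ => hw' m).trans (hshort i j hlt hj
            (hle.trans ((le_max_left _ _).trans (le_max_right _ _))))
        · have h1 := hblock i j hij hj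
          have h3 := (hu j hj).1
          have h4 := (hu i (hij.trans hj)).1
          have h5 : ((n₀ : ℝ)) < j - i := by
            rw [← Nat.cast_sub hij]
            exact_mod_cast hgt
          have h6 : ∑ m ∈ Finset.Ico (μ i) (μ j), w m ≤
              (Finset.Ico (μ i) (μ j)).card • (1 : ℝ) :=
            Finset.sum_le_card_nsmul _ _ _ fun m _ => (hα _).2
          rw [Nat.card_Ico, nsmul_eq_mul, mul_one] at h6
          have h7 : ((k * k : ℕ) : ℝ) < ((μ j - μ i : ℕ) : ℝ) := by
            have h8 := mul_lt_mul_of_pos_right h5 hpos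
            have h9 : 0 ≤ κ * ((j : ℝ) - i) :=
              mul_nonneg hκ0.le (by linarith [Nat.cast_nonneg (α := ℝ) n₀])
            push_cast
            linarith
          have h8 : k * k < μ j - μ i := by exact_mod_cast h7
          have h9 := le_card_filter_mod_eq_zero (x := μ i) (y := μ j) hk0 k (by omega)
          have h10 : (((Finset.Ico (μ i) (μ j)).filter fun m => m % k = 0).card : ℝ) * ω ≤
              ∑ m ∈ Finset.Ico (μ i) (μ j) with m % k = 0, w m := by
            rw [← nsmul_eq_mul]
            exact Finset.card_nsmul_le_sum _ _ _ fun m _ => hω _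
          have h11 : (k : ℝ) * ω ≤
              (((Finset.Ico (μ i) (μ j)).filter fun m => m % k = 0).card : ℝ) * ω :=
            mul_le_mul_of_nonneg_right (by exact_mod_cast h9) hω0.le
          have h12 := hκx (j - i) (by omega)
          rw [Nat.cast_sub hij] at h12
          have h13 := hsplit (Finset.Ico (μ i) (μ j))
          linarith
      obtain ⟨u', hu', hs'⟩ := exists_potential hint
      have h1 := load_le_of_potential hu' hs' hI
      have h3 := sum_spokes_le (ar := ar) (α := α) (sym := sym) (μ := μ) (hub := hub) (k := k)
        (w := w') hI (fun m => by simp only [w']; split_ifs; exacts [le_rfl, hw0 m])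
        fun m i h => by
          simp only [w']
          rw [if_neg fun hm => hbX' ((subset_of_spoke_subset h).2 hm)]
      have h4 := sum_pathEdge_le (E := E) (ar := ar) (N := N) (hub := hub) hα0 X
      rw [← ha] at h4
      linarith
  · rw [hrank_attach α 𝓔 hG, sum_pathEdges_subset α hinj, Finset.toLeft_disjSum,
      Finset.toRight_disjSum, Finset.card_range]
    have h1 : (∑ i ∈ Finset.range (N - 1),
        if pathEdge hub (ar E) i ⊆ D.disjSum (Finset.range N) then α E else 0) =
        (N - 1) * a := by
      rw [Finset.sum_congr rfl fun i hi => if_pos ?_, Finset.sum_const, Finset.card_range,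
        nsmul_eq_mul, Nat.cast_sub hN0, Nat.cast_one]
      refine Finset.disjSum_mono (fun x hx => ?_) (fun x hx => ?_)
      · obtain ⟨t, -, rfl⟩ := Finset.mem_image.1 hx
        exact hubD t
      · have := Finset.mem_range.1 hi
        simp only [Finset.mem_insert, Finset.mem_singleton] at hx
        exact Finset.mem_range.2 (by omega)
    have h3 : (∑ i ∈ Finset.range N, ∑ m ∈ Finset.Ico (μ i) (μ (i + 1)),
        if spoke hub k (ar (sym m)) m i ⊆ D.disjSum (Finset.range N) then α (sym m) else 0) =
        (1 - a + κ) * N + a := by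
      have h4 := sum_blocks w hμ (Nat.zero_le N)
      rw [hμ0, hμN, ← Finset.range_eq_Ico, ← Finset.range_eq_Ico, hsum] at h4
      rw [← h4]
      refine Finset.sum_congr rfl fun i hi => Finset.sum_congr rfl fun m _ => if_pos ?_
      refine Finset.disjSum_mono (fun x hx => ?_) (fun x hx => ?_)
      · obtain ⟨t, -, rfl⟩ := Finset.mem_image.1 hx
        exact hubD t
      · rw [Finset.mem_singleton.1 hx]
        exact hi
    rw [h1, h3]
    linarith

end PathRank

/-! ### Semantics of the axioms and the extension formulas -/

section Semantics

variable {L : FirstOrder.Language} {M N : Type*} [L.Structure M] [L.Structure N]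

lemma IsHypergraph.card_of_mem_edges (hM : IsHypergraph L M) {E : Symb L} {S : Finset M}
    (hS : S ∈ edges L M E) : S.card = E.1 := by
  classical
  obtain ⟨x, hx, hSx⟩ := hS
  have : S = Finset.univ.image x := Finset.coe_injective (by rw [hSx]; simp)
  rw [this, Finset.card_image_of_injective _ (hM E x hx).1, Finset.card_univ, Fintype.card_fin]

/-- In a hypergraph, a relation symbol holds of all enumerations of its edges. -/
lemma IsHypergraph.relMap_iff (hM : IsHypergraph L M) (E : Symb L) (x : Fin E.1 → M) :
    Structure.RelMap E.2 x ↔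
      Function.Injective x ∧ ∃ S ∈ edges L M E, (S : Set M) = Set.range x := by
  classical
  constructor
  · intro hx
    refine ⟨(hM E x hx).1, Finset.univ.image x, ⟨x, hx, by simp⟩, by simp⟩
  · rintro ⟨hxi, S, ⟨y, hy, hSy⟩, hSx⟩
    have hyi := (hM E y hy).1
    have hr : Set.range x = Set.range y := by rw [← hSx, hSy]
    -- the permutation that turns the enumeration `y` into `x`
    let π : Equiv.Perm (Fin E.1) :=
      (Equiv.ofInjective x hxi).trans ((Equiv.setCongr hr).trans (Equiv.ofInjective y hyi).symm)
    have hπ : y ∘ π = x := by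
      funext i
      simp only [π, Function.comp_apply, Equiv.trans_apply]
      rw [Equiv.apply_ofInjective_symm hyi]
      rfl
    rw [← hπ]
    exact (hM E y hy).2 π

lemma IsEmb.relMap_iff (hM : IsHypergraph L M) (hN : IsHypergraph L N) {f : M → N} {D : Finset M}
    (hf : IsEmb (edges L M) (edges L N) f D) (E : Symb L) {x : Fin E.1 → M} (hx : ∀ i, x i ∈ D) :
    Structure.RelMap E.2 x ↔ Structure.RelMap E.2 (f ∘ x) := by
  classical
  rw [hM.relMap_iff, hN.relMap_iff]
  have h1 : Function.Injective x ↔ Function.Injective (f ∘ x) :=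
    ⟨fun h i j hij => h (hf.1 (hx i) (hx j) hij), fun h => h.of_comp⟩
  rw [← h1]
  refine and_congr_right fun _ => ?_
  have h2 : ∀ S : Finset M, (S : Set M) = Set.range x ↔ S = Finset.univ.image x := fun S => by
    rw [← Finset.coe_inj]
    simp
  have h3 : ∀ S : Finset N, (S : Set N) = Set.range (f ∘ x) ↔ S = Finset.univ.image (f ∘ x) :=
    fun S => by
      rw [← Finset.coe_inj]
      simp [Function.comp_def]
  have hD : Finset.univ.image x ⊆ D := fun y hy => by
    obtain ⟨i, -, rfl⟩ := Finset.mem_image.1 hy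
    exact hx i
  simp only [h2, h3, exists_eq_right]
  rw [hf.mem_iff hD, Finset.image_image]

/-- The structure on `X` induced along a map `e : X → M`. -/
abbrev inducedStructure [L.IsRelational] {X : Type*} (e : X → M) : L.Structure X where
  funMap f := isEmptyElim f
  RelMap R x := Structure.RelMap R (e ∘ x)

/-- The structure given by a family of edges. -/
abbrev hypergraphStructure [L.IsRelational] {T : Type*} (𝓔 : Symb L → Set (Finset T)) :
    L.Structure T where
  funMap f := isEmptyElim f
  RelMap {n} R x := Function.Injective x ∧ ∃ S ∈ 𝓔 ⟨n, R⟩, (S : Set T) = Set.range x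

lemma isHypergraph_hypergraphStructure [L.IsRelational] {T : Type*}
    (𝓔 : Symb L → Set (Finset T)) : @IsHypergraph L T (hypergraphStructure 𝓔) := by
  let _ := hypergraphStructure 𝓔
  rintro E x ⟨hx, S, hS, hSx⟩
  refine ⟨hx, fun π => ⟨hx.comp π.injective, S, hS, ?_⟩⟩
  rw [hSx, π.surjective.range_comp]

lemma edges_hypergraphStructure [L.IsRelational] {T : Type*} {𝓔 : Symb L → Set (Finset T)}
    (h𝓔 : ∀ F, ∀ S ∈ 𝓔 F, S.card = F.1) : @edges L T (hypergraphStructure 𝓔) = 𝓔 := by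
  let _ := hypergraphStructure 𝓔
  funext F
  ext S
  constructor
  · rintro ⟨x, ⟨-, R, hR, hRx⟩, hSx⟩
    rwa [Finset.coe_injective (hSx.trans hRx.symm)]
  · intro hS
    let e := S.equivFinOfCardEq (h𝓔 F S hS)
    have he : (S : Set T) = Set.range fun i => (e.symm i : T) := by
      ext y
      constructor
      · exact fun hy => ⟨e ⟨y, hy⟩, by simp⟩
      · rintro ⟨i, rfl⟩
        exact (e.symm i).2
    exact ⟨fun i => e.symm i, ⟨Subtype.val_injective.comp e.symm.injective, S, hS, he⟩, he⟩

lemma isEmb_of_relMap_iff {e : M → N} (he : Function.Injective e)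
    (h : ∀ (E : Symb L) (x : Fin E.1 → M), Structure.RelMap E.2 x ↔ Structure.RelMap E.2 (e ∘ x))
    (D : Finset M) : IsEmb (edges L M) (edges L N) e D := by
  refine ⟨he.injOn, fun E S _ S' hS' => ⟨?_, ?_⟩⟩
  · rintro ⟨x, hx, hSx⟩
    exact ⟨e ∘ x, (h E x).1 hx, by rw [hS', hSx, Set.range_comp]⟩
  · rintro ⟨y, hy, hSy⟩
    have h1 : ∀ i, ∃ z ∈ S, e z = y i := fun i => by
      have : y i ∈ (S' : Set N) := hSy ▸ Set.mem_range_self i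
      rw [hS'] at this
      exact this
    choose x hxS hx using h1
    obtain rfl : e ∘ x = y := funext hx
    refine ⟨x, (h E x).2 hy, he.image_injective ?_⟩
    rw [← hS', hSy, Set.range_comp]

lemma isHypergraph_of_relMap_iff {e : M → N} (h : ∀ (E : Symb L) (x : Fin E.1 → M),
    Structure.RelMap E.2 x ↔ Structure.RelMap E.2 (e ∘ x)) (hN : IsHypergraph L N) :
    IsHypergraph L M := fun E x hx =>
  ⟨(hN E _ ((h E x).1 hx)).1.of_comp, fun π => (h E _).2 ((hN E _ ((h E x).1 hx)).2 π)⟩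

lemma exists_enumeration {T : Type*} [DecidableEq T] {A D : Finset T} (hAD : A ⊆ D) {m : ℕ}
    {v : Fin m → T} (hv : Function.Injective v) (hvA : Finset.univ.image v = A) :
    ∃ y : Fin (D \ A).card → T, Function.Injective (Sum.elim v y) ∧
      (base m (D \ A).card).image (Sum.elim v y) = A ∧
      Finset.univ.image (Sum.elim v y) = D := by
  have hA : ∀ x, x ∈ A ↔ ∃ i, v i = x := fun x => by rw [← hvA]; simp
  have hD : ∀ x, x ∈ D \ A ↔ ∃ i, ((D \ A).equivFin.symm i : T) = x := fun x =>
    ⟨fun h => ⟨(D \ A).equivFin ⟨x, h⟩, by simp⟩, by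
      rintro ⟨i, rfl⟩; exact ((D \ A).equivFin.symm i).2⟩
  refine ⟨fun i => (D \ A).equivFin.symm i, ?_, ?_, ?_⟩
  · refine Function.Injective.sumElim hv
      (Subtype.val_injective.comp (D \ A).equivFin.symm.injective) fun i j h => ?_
    have h2 := ((D \ A).equivFin.symm j).2
    rw [Finset.mem_sdiff] at h2
    exact h2.2 (h ▸ (hA _).2 ⟨i, rfl⟩)
  · ext x
    simp [base, hA]
  · ext x
    have h1 : x ∈ D ↔ x ∈ A ∨ x ∈ D \ A := by
      rw [← Finset.mem_union, Finset.union_sdiff_of_subset hAD]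
    rw [h1, hA, hD]
    simp

section Formulas

lemma realize_forallClosure {m : ℕ} (φ : L.Formula (Fin m)) :
    N ⊨ forallClosure φ ↔ ∀ v : Fin m → N, φ.Realize v := by
  rw [forallClosure, Sentence.Realize, Formula.realize_iAlls]
  simp only [Formula.realize_relabel]
  rfl

variable [Fintype (Symb L)]

lemma realize_atomicDiagram {X ι : Type} [L.Structure X] [Finite ι] (e : ι → X) (v : ι → N) :
    (atomicDiagram (L := L) e).Realize v ↔ (∀ i j, e i = e j ↔ v i = v j) ∧
      ∀ (E : Symb L) (x : Fin E.1 → ι),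
        Structure.RelMap E.2 (e ∘ x) ↔ Structure.RelMap E.2 (v ∘ x) := by
  classical
  rw [atomicDiagram, Formula.realize_inf, Formula.realize_iInf, Formula.realize_iInf]
  refine and_congr ⟨fun h i j => ?_, fun h p => ?_⟩ ⟨fun h E x => ?_, fun h p => ?_⟩
  · have := h (i, j)
    split_ifs at this with h1
    · simp only [Formula.realize_equal, Term.realize_var] at this
      exact iff_of_true h1 this
    · simp only [Formula.realize_not, Formula.realize_equal, Term.realize_var] at this
      exact iff_of_false h1 this
  · split_ifs with h1
    · simpa only [Formula.realize_equal, Term.realize_var] using (h _ _).1 h1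
    · simpa only [Formula.realize_not, Formula.realize_equal, Term.realize_var] using
        fun h2 => h1 ((h _ _).2 h2)
  · have := h ⟨E, x⟩
    split_ifs at this with h1
    · rw [Formula.realize_rel] at this
      exact iff_of_true h1 this
    · rw [Formula.realize_not, Formula.realize_rel] at this
      exact iff_of_false h1 this
  · split_ifs with h1
    · rw [Formula.realize_rel]
      exact (h _ _).1 h1
    · rw [Formula.realize_not, Formula.realize_rel]
      exact fun h2 => h1 ((h _ _).2 h2)

lemma realize_existsExt {m k : ℕ} [L.Structure (Fin m ⊕ Fin k)] (v : Fin m → N) :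
    (existsExt (L := L) m k).Realize v ↔ ∃ y : Fin k → N, Function.Injective (Sum.elim v y) ∧
      ∀ (E : Symb L) (x : Fin E.1 → Fin m ⊕ Fin k),
        Structure.RelMap E.2 x ↔ Structure.RelMap E.2 (Sum.elim v y ∘ x) := by
  rw [existsExt, Formula.realize_iExs]
  refine exists_congr fun y => ?_
  rw [realize_atomicDiagram]
  refine and_congr ⟨fun h i j hij => (h i j).2 hij, fun h i j => h.eq_iff.symm⟩ Iff.rfl

lemma realize_extensionFormula {m k : ℕ} [L.Structure (Fin m ⊕ Fin k)] (v : Fin m → N) :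
    (extensionFormula (L := L) m k).Realize v ↔
      ∃ y : Fin k → N, Function.Injective (Sum.elim v y) ∧
        ∀ (E : Symb L) (x : Fin E.1 → Fin m ⊕ Fin k),
          Structure.RelMap E.2 x ↔ Structure.RelMap E.2 (Sum.elim v y ∘ x) := by
  rw [extensionFormula, Formula.realize_inf, realize_existsExt, and_iff_right_iff_imp]
  rintro ⟨y, hy, h⟩
  rw [realize_atomicDiagram]
  refine ⟨fun i j => ?_, fun E x => h E (Sum.inl ∘ x)⟩
  have := (hy.eq_iff (a := Sum.inl i) (b := Sum.inl j)).symm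
  simpa using this

end Formulas

section Models

variable [L.IsRelational] [Fintype (Symb L)] {α : Symb L → ℝ}

/-- Finite substructures of models of `S_α` are in `K_α`. -/
lemma inK_inducedStructure (hN : N ⊨ theoryS α) {m : ℕ} {e : Fin m → N}
    (he : Function.Injective e) : @InK L (Fin m) (inducedStructure e) _ α := by
  let _ := inducedStructure (L := L) e
  by_contra hK
  have h1 : N ⊨ forallClosure (atomicDiagram (L := L) (id : Fin m → Fin m)).not :=
    hN.realize_of_mem _ (Or.inl ⟨m, inferInstance, hK, rfl⟩)
  rw [realize_forallClosure] at h1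
  refine h1 e ((realize_atomicDiagram _ _).2 ⟨fun i j => he.eq_iff.symm, fun E x => Iff.rfl⟩)

lemma isHypergraph_of_model (hN : N ⊨ theoryS α) : IsHypergraph L N := by
  classical
  intro E x hx
  let X := Finset.univ.image x
  let e : Fin X.card → N := fun i => X.equivFin.symm i
  have he : Function.Injective e := Subtype.val_injective.comp X.equivFin.symm.injective
  let _ := inducedStructure (L := L) e
  have hK := inK_inducedStructure hN he
  let y : Fin E.1 → Fin X.card := fun i => X.equivFin ⟨x i, by simp [X]⟩
  have hy : e ∘ y = x := funext fun i => by simp [e, y]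
  have h1 := hK.1 E y (by show Structure.RelMap E.2 (e ∘ y); rwa [hy])
  rw [← hy]
  exact ⟨he.comp h1.1, fun π => h1.2 π⟩

lemma rank_nonneg_of_model (hN : N ⊨ theoryS α) (X : Finset N) : 0 ≤ rank (L := L) α X := by
  classical
  let e : Fin X.card → N := fun i => X.equivFin.symm i
  have he : Function.Injective e := Subtype.val_injective.comp X.equivFin.symm.injective
  let _ := inducedStructure (L := L) e
  have hK := inK_inducedStructure hN he
  have h1 : IsEmb (edges L _) (edges L N) e Finset.univ :=
    isEmb_of_relMap_iff he (fun E x => Iff.rfl) _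
  have h2 : Finset.univ.image e = X := by
    ext z
    simp only [Finset.mem_image, Finset.mem_univ, true_and]
    exact ⟨by rintro ⟨i, rfl⟩; exact (X.equivFin.symm i).2,
      fun hz => ⟨X.equivFin ⟨z, hz⟩, by simp [e]⟩⟩
  rw [← h2, h1.rank_image subset_rfl]
  exact hK.2 _

lemma exists_extension_of_model (hN : N ⊨ theoryS α) (hM : IsHypergraph L M) {A D : Finset M}
    (hS : Strong α A D) (hD : ∀ X ⊆ D, 0 ≤ rank (L := L) α X) {f : M → N}
    (hf : IsEmb (edges L M) (edges L N) f A) :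
    ∃ g : M → N, IsEmb (edges L M) (edges L N) g D ∧ ∀ x ∈ A, g x = f x := by
  classical
  obtain ⟨e, he, heA, heD⟩ : ∃ e : Fin A.card ⊕ Fin (D \ A).card → M, Function.Injective e ∧
      (base A.card (D \ A).card).image e = A ∧ Finset.univ.image e = D := by
    obtain ⟨y, h⟩ := exists_enumeration hS.1 (v := fun i => (A.equivFin.symm i : M))
      (Subtype.val_injective.comp A.equivFin.symm.injective) (by
        ext x
        simp only [Finset.mem_image, Finset.mem_univ, true_and]
        exact ⟨by rintro ⟨i, rfl⟩; exact (A.equivFin.symm i).2,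
          fun hx => ⟨A.equivFin ⟨x, hx⟩, by simp⟩⟩)
    exact ⟨_, h⟩
  let _ := inducedStructure (L := L) e
  have hemb : ∀ X, IsEmb (edges L _) (edges L M) e X :=
    fun X => isEmb_of_relMap_iff he (fun E x => Iff.rfl) X
  have heD' : ∀ i, e i ∈ D := fun i => by
    have := Finset.mem_image_of_mem e (Finset.mem_univ i)
    rwa [heD] at this
  have heA' : ∀ i, e (Sum.inl i) ∈ A := fun i => by
    have := Finset.mem_image_of_mem e (show Sum.inl i ∈ base A.card (D \ A).card by simp [base])
    rwa [heA] at this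
  have hK : InK L (Fin A.card ⊕ Fin (D \ A).card) α := by
    refine ⟨isHypergraph_of_relMap_iff (e := e) (fun E x => Iff.rfl) hM, fun X => ?_⟩
    rw [← (hemb X).rank_image subset_rfl]
    refine hD _ fun x hx => ?_
    obtain ⟨i, -, rfl⟩ := Finset.mem_image.1 hx
    exact heD' i
  have hS' : Strong (L := L) α (base A.card (D \ A).card) Finset.univ := by
    rw [← (hemb Finset.univ).strong_image subset_rfl (Finset.subset_univ _), heA, heD]
    exact hS
  have h1 : N ⊨ forallClosure ((atomicDiagram (L := L)
      (Sum.inl : Fin A.card → Fin A.card ⊕ Fin (D \ A).card)).imp (existsExt _ _)) :=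
    hN.realize_of_mem _ (Or.inr ⟨_, _, inferInstance, hK, hS', rfl⟩)
  rw [realize_forallClosure] at h1
  have hNh := isHypergraph_of_model hN
  have h2 := (Formula.realize_imp.1 (h1 fun i => f (e (Sum.inl i))))
    ((realize_atomicDiagram _ _).2 ⟨fun i j => ?_, fun E x => ?_⟩)
  · obtain ⟨y, hy, hyE⟩ := (realize_existsExt _).1 h2
    let v : Fin A.card ⊕ Fin (D \ A).card → N := Sum.elim (fun i => f (e (Sum.inl i))) y
    have hv : IsEmb (edges L _) (edges L N) v Finset.univ := isEmb_of_relMap_iff hy hyE _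
    have hext := (hemb Finset.univ).extend hv f
    rw [heD] at hext
    refine ⟨Function.extend e v f, hext, fun x hx => ?_⟩
    rw [← heA] at hx
    obtain ⟨i, hi, rfl⟩ := Finset.mem_image.1 hx
    obtain ⟨j, -, rfl⟩ := Finset.mem_map.1 hi
    exact he.extend_apply v f (Sum.inl j)
  · rw [Sum.inl_injective.eq_iff]
    constructor
    · rintro rfl
      rfl
    · intro h
      simpa using he (hf.1 (heA' i) (heA' j) h)
  · exact hf.relMap_iff hM hNh E (x := fun i => e (Sum.inl (x i))) fun i => heA' _

end Models

end Semantics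

/-! ### Free amalgamation -/

section Amalgam

variable {ι M N : Type*} [DecidableEq M] {𝓔 : ι → Set (Finset M)}
  {𝓔' : ι → Set (Finset N)} {f : M → N} {A B : Finset M}

/-- The inclusion of `B` into the free amalgam of `N` and `B` over `A`, where `A` is embedded
into `N` by `f`. The universe of the amalgam is contained in `N ⊕ M`. -/
def amalgamMap (f : M → N) (A : Finset M) (x : M) : N ⊕ M :=
  if x ∈ A then Sum.inl (f x) else Sum.inr x

lemma amalgamMap_of_mem {x : M} (hx : x ∈ A) : amalgamMap f A x = Sum.inl (f x) := if_pos hx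

lemma amalgamMap_of_notMem {x : M} (hx : x ∉ A) : amalgamMap f A x = Sum.inr x := if_neg hx

lemma amalgamMap_injOn (hf : Set.InjOn f A) : Function.Injective (amalgamMap f A) := by
  intro x y hxy
  by_cases hx : x ∈ A <;> by_cases hy : y ∈ A <;> simp only [amalgamMap, hx, hy, if_true,
    if_false, reduceCtorEq, Sum.inl.injEq, Sum.inr.injEq] at hxy
  · exact hf hx hy hxy
  · exact hxy

variable [DecidableEq N]

/-- The edges of the free amalgam of `N` and `B` over `A`. -/
def amalgam (𝓔 : ι → Set (Finset M)) (𝓔' : ι → Set (Finset N)) (f : M → N) (A B : Finset M) :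
    ι → Set (Finset (N ⊕ M)) :=
  fun F => {S | (∃ R ∈ 𝓔' F, S = R.map Function.Embedding.inl) ∨
    ∃ R ∈ 𝓔 F, R ⊆ B ∧ ¬ R ⊆ A ∧ S = R.image (amalgamMap f A)}

lemma subset_of_image_amalgamMap_eq_map {R : Finset M} {S : Finset N}
    (h : R.image (amalgamMap f A) = S.map Function.Embedding.inl) : R ⊆ A := by
  intro x hx
  by_contra hxA
  have h1 : amalgamMap f A x ∈ S.map Function.Embedding.inl :=
    h ▸ Finset.mem_image_of_mem _ hx
  rw [amalgamMap_of_notMem hxA] at h1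
  simp at h1

lemma isEmb_inl_amalgam (D : Finset N) : IsEmb 𝓔' (amalgam 𝓔 𝓔' f A B) Sum.inl D := by
  refine ⟨Sum.inl_injective.injOn, fun F S _ S' hS' => ?_⟩
  obtain rfl : S' = S.map Function.Embedding.inl := Finset.coe_injective (by rw [hS']; simp)
  refine ⟨fun hS => Or.inl ⟨S, hS, rfl⟩, ?_⟩
  rintro (⟨R, hR, h⟩ | ⟨R, -, -, hRA, h⟩)
  · rwa [Finset.map_injective _ h]
  · exact absurd (subset_of_image_amalgamMap_eq_map h.symm) hRA

lemma isEmb_amalgamMap (hf : IsEmb 𝓔 𝓔' f A) :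
    IsEmb 𝓔 (amalgam 𝓔 𝓔' f A B) (amalgamMap f A) B := by
  have hinj := amalgamMap_injOn hf.1
  refine ⟨hinj.injOn, fun F S hSB S' hS' => ?_⟩
  obtain rfl : S' = S.image (amalgamMap f A) := Finset.coe_injective (by rw [hS']; simp)
  have himg : S ⊆ A → S.image (amalgamMap f A) = (S.image f).map Function.Embedding.inl := by
    intro hSA
    rw [Finset.map_eq_image, Finset.image_image]
    exact Finset.image_congr fun x hx => amalgamMap_of_mem (hSA hx)
  constructor
  · intro hS
    by_cases hSA : S ⊆ A
    · exact Or.inl ⟨S.image f, (hf.mem_iff hSA F).1 hS, himg hSA⟩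
    · exact Or.inr ⟨S, hS, hSB, hSA, rfl⟩
  · rintro (⟨R, hR, h⟩ | ⟨R, hR, -, -, h⟩)
    · have hSA := subset_of_image_amalgamMap_eq_map h
      rw [himg hSA] at h
      rw [hf.mem_iff hSA, Finset.map_injective _ h]
      exact hR
    · rwa [Finset.image_injective hinj h]

lemma card_of_mem_amalgam {ar : ι → ℕ} (h : ∀ F, ∀ S ∈ 𝓔 F, S.card = ar F)
    (h' : ∀ F, ∀ S ∈ 𝓔' F, S.card = ar F) (hf : Set.InjOn f A) (F : ι) :
    ∀ S ∈ amalgam 𝓔 𝓔' f A B F, S.card = ar F := by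
  rintro S (⟨R, hR, rfl⟩ | ⟨R, hR, -, -, rfl⟩)
  · rw [Finset.card_map]
    exact h' F R hR
  · rw [Finset.card_image_of_injective _ (amalgamMap_injOn hf)]
    exact h F R hR

/-- The relative rank over `N` in the free amalgam is the relative rank over `A` in `B`. -/
lemma hrank_amalgam [Fintype ι] (α : ι → ℝ) (hf : Set.InjOn f A)
    {X : Finset (N ⊕ M)} (hX : X.toRight ⊆ B \ A) :
    hrank α (amalgam 𝓔 𝓔' f A B) X +
        hrank α 𝓔 ((B.filter fun x => amalgamMap f A x ∈ X) ∩ A) =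
      hrank α 𝓔' X.toLeft + hrank α 𝓔 (B.filter fun x => amalgamMap f A x ∈ X) := by
  classical
  have hinj := amalgamMap_injOn hf
  set Y := B.filter fun x => amalgamMap f A x ∈ X with hY
  have hYR : Y \ A = X.toRight := by
    ext x
    simp only [hY, Finset.mem_sdiff, Finset.mem_filter, Finset.mem_toRight]
    constructor
    · rintro ⟨⟨-, h⟩, hxA⟩
      rwa [amalgamMap_of_notMem hxA] at h
    · intro h
      have := Finset.mem_sdiff.1 (hX (Finset.mem_toRight.2 h))
      exact ⟨⟨this.1, by rwa [amalgamMap_of_notMem this.2]⟩, this.2⟩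
  have h1 : ∀ F, ecard (amalgam 𝓔 𝓔' f A B) F X + ecard 𝓔 F (Y ∩ A) =
      ecard 𝓔' F X.toLeft + ecard 𝓔 F Y := by
    intro F
    have h2 : X.powerset.filter (· ∈ amalgam 𝓔 𝓔' f A B F) =
        (X.toLeft.powerset.filter (· ∈ 𝓔' F)).map
          ⟨fun R => R.map Function.Embedding.inl, Finset.map_injective _⟩ ∪
        ((Y.powerset.filter (· ∈ 𝓔 F)) \ ((Y ∩ A).powerset.filter (· ∈ 𝓔 F))).map
          ⟨fun R => R.image (amalgamMap f A), Finset.image_injective hinj⟩ := by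
      ext S
      have hSG : S ∈ amalgam 𝓔 𝓔' f A B F ↔ (∃ R ∈ 𝓔' F, S = R.map Function.Embedding.inl) ∨
        ∃ R ∈ 𝓔 F, R ⊆ B ∧ ¬ R ⊆ A ∧ S = R.image (amalgamMap f A) := Iff.rfl
      simp only [Finset.mem_filter, Finset.mem_powerset, hSG, Finset.mem_union, Finset.mem_map,
        Function.Embedding.coeFn_mk, Finset.mem_sdiff]
      constructor
      · rintro ⟨hSX, ⟨R, hR, rfl⟩ | ⟨R, hR, hRB, hRA, rfl⟩⟩
        · refine Or.inl ⟨R, ⟨fun x hx => ?_, hR⟩, rfl⟩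
          exact Finset.mem_toLeft.2 (hSX (Finset.mem_map_of_mem Function.Embedding.inl hx))
        · refine Or.inr ⟨R, ⟨⟨fun x hx => ?_, hR⟩, fun h => ?_⟩, rfl⟩
          · exact Finset.mem_filter.2 ⟨hRB hx, hSX (Finset.mem_image_of_mem _ hx)⟩
          · exact hRA (h.1.trans Finset.inter_subset_right)
      · rintro (⟨R, ⟨hRX, hR⟩, rfl⟩ | ⟨R, ⟨⟨hRY, hR⟩, hRA⟩, rfl⟩)
        · refine ⟨fun x hx => ?_, Or.inl ⟨R, hR, rfl⟩⟩
          obtain ⟨y, hy, rfl⟩ := Finset.mem_map.1 hx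
          exact Finset.mem_toLeft.1 (hRX hy)
        · refine ⟨fun x hx => ?_, Or.inr ⟨R, hR, hRY.trans (Finset.filter_subset _ _), ?_, rfl⟩⟩
          · obtain ⟨y, hy, rfl⟩ := Finset.mem_image.1 hx
            exact (Finset.mem_filter.1 (hRY hy)).2
          · exact fun h => hRA ⟨Finset.subset_inter hRY h, hR⟩
    have h3 : (Y ∩ A).powerset.filter (· ∈ 𝓔 F) ⊆ Y.powerset.filter (· ∈ 𝓔 F) :=
      Finset.filter_subset_filter _ (Finset.powerset_mono.2 Finset.inter_subset_left)
    unfold ecard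
    rw [h2, Finset.card_union_of_disjoint, Finset.card_map, Finset.card_map, add_assoc,
      Finset.card_sdiff_add_card_eq_card h3]
    rw [Finset.disjoint_left]
    intro S hS hS'
    obtain ⟨R, -, rfl⟩ := Finset.mem_map.1 hS
    obtain ⟨R', hR', h⟩ := Finset.mem_map.1 hS'
    have h4 := subset_of_image_amalgamMap_eq_map h
    simp only [Finset.mem_sdiff, Finset.mem_filter, Finset.mem_powerset] at hR'
    exact hR'.2 ⟨Finset.subset_inter hR'.1.1 h4, hR'.1.2⟩
  have h2 : (X.card : ℝ) + (Y ∩ A).card = X.toLeft.card + Y.card := by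
    have h3 := Finset.card_toLeft_add_card_toRight (u := X)
    have h4 := Finset.card_sdiff_add_card_inter Y A
    rw [hYR] at h4
    norm_cast
    omega
  have h3 : ∑ F, α F * (ecard (amalgam 𝓔 𝓔' f A B) F X : ℝ) +
      ∑ F, α F * (ecard 𝓔 F (Y ∩ A) : ℝ) = ∑ F, α F * (ecard 𝓔' F X.toLeft : ℝ) +
      ∑ F, α F * (ecard 𝓔 F Y : ℝ) := by
    rw [← Finset.sum_add_distrib, ← Finset.sum_add_distrib]
    refine Finset.sum_congr rfl fun F _ => ?_
    rw [← mul_add, ← mul_add]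
    congr 1
    exact_mod_cast h1 F
  unfold hrank
  linarith

end Amalgam

/-! ### Closed embeddings over closed sets -/

section ClosedEmbedding

variable {ι : Type*} [Fintype ι] {α : ι → ℝ} {ar : ι → ℕ} {E : ι}

/-- The conclusion of `exists_attached_path` also holds for `ρ = 0`, with an empty path. -/
lemma exists_attached_path_of_nonneg (h2 : ∀ F, 2 ≤ ar F) (hα : ∀ F, 0 < α F ∧ α F ≤ 1)
    (hE : IsPathSymbol α ar E) {ρ : ℝ} (hρ0 : 0 ≤ ρ) (hρ1 : ρ ≤ 1) {p : ℕ} {c : ι → ℕ}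
    (hρ : ρ = p - ∑ F, α F * (c F : ℝ)) {ε : ℝ} (hε : 0 < ε) (n : ℕ) :
    ∃ N K : ℕ, ∀ {T : Type*} (𝓔 : ι → Set (Finset T)) (A D : Finset T) (b : T), A ⊆ D → b ∈ D →
      b ∉ A → K ≤ A.card → ∃ 𝓔' : ι → Set (Finset (T ⊕ ℕ)),
        ((∀ F, ∀ S ∈ 𝓔 F, S.card = ar F) → ∀ F, ∀ S ∈ 𝓔' F, S.card = ar F) ∧
        (∀ F S, S ∈ 𝓔 F ↔ S.map Function.Embedding.inl ∈ 𝓔' F) ∧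
        (∀ X ⊆ D.disjSum (Finset.range N), hrank α 𝓔 X.toLeft - ρ ≤ hrank α 𝓔' X ∧
          (Sum.inl b ∉ X ∨ X.toRight.card ≤ n → hrank α 𝓔 X.toLeft ≤ hrank α 𝓔' X)) ∧
        hrank α 𝓔' (D.disjSum (Finset.range N)) < hrank α 𝓔 D - ρ + ε := by
  classical
  rcases hρ0.eq_or_lt with rfl | hρ0
  swap
  · exact exists_attached_path h2 hα hE hρ0 hρ1 hρ hε n
  refine ⟨0, 0, fun {T} 𝓔 A D b _ _ _ _ => ⟨attach 𝓔 ∅, ?_, ?_, fun X hX => ?_, ?_⟩⟩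
  · rintro hcard F S (⟨R, hR, rfl⟩ | hS)
    · rw [Finset.card_map]
      exact hcard F R hR
    · simp at hS
  · refine fun F S => ⟨fun hS => Or.inl ⟨S, hS, rfl⟩, ?_⟩
    rintro (⟨R, hR, h⟩ | hS)
    · rwa [Finset.map_injective _ h]
    · simp at hS
  · rw [hrank_attach α 𝓔 (by simp)]
    simp
  · rw [hrank_attach α 𝓔 (by simp), Finset.toLeft_disjSum, Finset.toRight_disjSum]
    simpa using hε

variable {L : FirstOrder.Language} [L.IsRelational] [Fintype (Symb L)] {α : Symb L → ℝ}
  {M N : Type*} [L.Structure M] [L.Structure N]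

/-- Models of `S_α` are infinite, because they contain all finite structures without edges. -/
lemma exists_card_le_of_model [Nonempty N] (h2 : ∀ F : Symb L, 2 ≤ F.1) (hN : N ⊨ theoryS α)
    (K : ℕ) :
    ∃ Z : Finset N, K ≤ Z.card := by
  classical
  let 𝓔 : Symb L → Set (Finset ℕ) := fun _ => ∅
  let _ : L.Structure ℕ := hypergraphStructure 𝓔
  have hed : edges L ℕ = 𝓔 := edges_hypergraphStructure fun _ _ h => absurd h (Set.notMem_empty _)
  have hrank : ∀ X : Finset ℕ, rank (L := L) α X = X.card := by
    intro X
    rw [rank_eq_hrank, hed, hrank]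
    simp [ecard, 𝓔]
  obtain ⟨g, hg, -⟩ := exists_extension_of_model hN (isHypergraph_hypergraphStructure 𝓔)
    (A := ∅) (D := Finset.range K) (f := fun _ => Classical.arbitrary N)
    ⟨Finset.empty_subset _, fun C _ _ => by simp [hrank]⟩ (fun X _ => by simp [hrank])
    ⟨by simp, fun F S hS S' hS' => by
      obtain rfl : S = ∅ := Finset.subset_empty.1 hS
      obtain rfl : S' = ∅ := by simpa using hS'
      rw [hed]
      refine iff_of_false (Set.notMem_empty _) fun h => ?_
      have h3 := (isHypergraph_of_model hN).card_of_mem_edges h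
      have h4 := h2 F
      rw [Finset.card_empty] at h3
      omega⟩
  exact ⟨(Finset.range K).image g, by rw [hg.card_image subset_rfl, Finset.card_range]⟩

/-- If `A` embeds onto a closed subset of a model of `S_α` and `B` is an extension of `A` such that
no intermediate set other than `A` has smaller rank, then `B` embeds onto a closed subset.

A large closed set `A'` that contains the image of `A` is amalgamated with `B`, and a path is
attached to a point of `B \ A` and to points of `A'`, so that the rank of the whole extension `D`
of `A'` is only slightly larger than that of `A'`. Still `A' ≤ D`, so `D` is realised over `A'`. A
small superset of the copy of `B` which has smaller rank would meet the path in few points only,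
and its part outside `D` would have negative rank over `D`; this contradicts the closedness of
`A'`. -/
lemma exists_closed_extension_of_primitive [Nonempty N] (h2 : ∀ F : Symb L, 2 ≤ F.1)
    (hα : ∀ F, 0 < α F ∧ α F ≤ 1) {E : Symb L} (hE : IsPathSymbol α Sigma.fst E)
    (hN : N ⊨ theoryS α) (hM : IsHypergraph L M) {A B : Finset M} (hAB : A ⊂ B)
    (hAB0 : rank α A ≤ rank α B) (hAB1 : rank α B ≤ rank α A + 1)
    (hprim : ∀ C, A ⊂ C → C ⊆ B → rank α B ≤ rank α C) {f : M → N}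
    (hf : IsEmb (edges L M) (edges L N) f A) [DecidableEq N] {n : ℕ}
    (hcl : Closed α n (A.image f)) :
    ∃ g : M → N, IsEmb (edges L M) (edges L N) g B ∧ (∀ x ∈ A, g x = f x) ∧
      Closed α n (B.image g) := by
  classical
  have hα0 : ∀ F, 0 < α F := fun F => (hα F).1
  obtain ⟨η, hη, hgap⟩ := exists_rank_gap (L := L) hα0 n
  obtain ⟨ρ, hρ⟩ : ∃ ρ, ρ = rank α B - rank α A := ⟨_, rfl⟩
  obtain ⟨c, hc⟩ := exists_hrank_sub_eq α (edges L M) hAB.1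
  rw [← rank_eq_hrank, ← rank_eq_hrank, ← hρ] at hc
  obtain ⟨P, K, hPK⟩ := exists_attached_path_of_nonneg h2 hα hE (by linarith) (by linarith) hc hη n
  obtain ⟨b, hbB, hbA⟩ := Finset.exists_of_ssubset hAB
  -- the hubs and the image of `A` are contained in a set that is closed under extensions of the
  -- size of the path
  obtain ⟨Z, hZ⟩ := exists_card_le_of_model h2 hN K
  obtain ⟨s, hs⟩ := exists_closure_bound (L := L) hα0 (n + (B \ A).card + P)
    (A.image f ∪ Z).card
  obtain ⟨A', hA'chain, hA', -⟩ := hs (rank_nonneg_of_model hN) (A.image f ∪ Z) le_rfl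
  have hA'sub := hA'chain.minimalChain.subset
  have hfA : A.image f ⊆ A' := Finset.subset_union_left.trans hA'sub
  have hZA : Z ⊆ A' := Finset.subset_union_right.trans hA'sub
  set 𝓔₁ := amalgam (edges L M) (edges L N) f A B
  set D₁ : Finset (N ⊕ M) := A'.disjSum (B \ A)
  have hNh := isHypergraph_of_model hN
  obtain ⟨𝓔₂, hcard, hinl, hX, hD⟩ := hPK 𝓔₁ (A'.map Function.Embedding.inl) D₁ (Sum.inr b)
    (fun x hx => by
      obtain ⟨y, hy, rfl⟩ := Finset.mem_map.1 hx
      exact Finset.inl_mem_disjSum.2 hy)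
    (Finset.inr_mem_disjSum.2 (Finset.mem_sdiff.2 ⟨hbB, hbA⟩)) (by simp)
    (by rw [Finset.card_map]; exact hZ.trans (Finset.card_le_card hZA))
  have hcard₁ : ∀ F, ∀ S ∈ 𝓔₁ F, S.card = F.1 := card_of_mem_amalgam
    (fun F S hS => hM.card_of_mem_edges hS) (fun F S hS => hNh.card_of_mem_edges hS) hf.1
  let _ : L.Structure ((N ⊕ M) ⊕ ℕ) := hypergraphStructure 𝓔₂
  have hed : edges L ((N ⊕ M) ⊕ ℕ) = 𝓔₂ := edges_hypergraphStructure (hcard hcard₁)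
  set D : Finset ((N ⊕ M) ⊕ ℕ) := D₁.disjSum (Finset.range P)
  have hinl' : ∀ X, IsEmb 𝓔₁ (edges L ((N ⊕ M) ⊕ ℕ)) Sum.inl X := by
    refine fun X => ⟨Sum.inl_injective.injOn, fun F S _ S' hS' => ?_⟩
    obtain rfl : S' = S.map Function.Embedding.inl := Finset.coe_injective (by rw [hS']; simp)
    rw [hed]
    exact hinl F S
  have hNemb : ∀ X, IsEmb (edges L N) (edges L ((N ⊕ M) ⊕ ℕ)) (Sum.inl ∘ Sum.inl) X :=
    fun X => (isEmb_inl_amalgam X).comp (hinl' _)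
  let θ : M → (N ⊕ M) ⊕ ℕ := Sum.inl ∘ amalgamMap f A
  have hθ : IsEmb (edges L M) (edges L ((N ⊕ M) ⊕ ℕ)) θ B := (isEmb_amalgamMap hf).comp (hinl' _)
  have hθA : ∀ x ∈ A, θ x = Sum.inl (Sum.inl (f x)) := fun x hx =>
    congrArg Sum.inl (amalgamMap_of_mem hx)
  have hθB : ∀ x ∈ B, θ x ∈ D := by
    intro x hx
    by_cases hxA : x ∈ A
    · rw [hθA x hxA]
      exact Finset.inl_mem_disjSum.2 (Finset.inl_mem_disjSum.2
        (hfA (Finset.mem_image_of_mem f hxA)))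
    · exact Finset.inl_mem_disjSum.2 (by
        rw [amalgamMap_of_notMem hxA]
        exact Finset.inr_mem_disjSum.2 (Finset.mem_sdiff.2 ⟨hx, hxA⟩))
  -- the ranks of subsets of the amalgam
  have hrank₁ : ∀ X ⊆ D, hrank α 𝓔₁ X.toLeft +
      rank α ((B.filter fun x => θ x ∈ X) ∩ A) =
        rank α X.toLeft.toLeft + rank α (B.filter fun x => θ x ∈ X) := by
    intro X hXD
    have h1 : X.toLeft.toRight ⊆ B \ A := fun x hx =>
      Finset.inr_mem_disjSum.1 (Finset.inl_mem_disjSum.1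
        (hXD (Finset.mem_toLeft.1 (Finset.mem_toRight.1 hx))))
    have h3 := hrank_amalgam (𝓔 := edges L M) (𝓔' := edges L N) α hf.1 h1
    simp only [Finset.mem_toLeft] at h3
    simp only [rank_eq_hrank]
    exact h3
  set A₂ : Finset ((N ⊕ M) ⊕ ℕ) := A'.image (Sum.inl ∘ Sum.inl)
  have hA₂ : rank α A₂ = rank α A' := (hNemb A').rank_image subset_rfl
  have hmemA₂ : ∀ {x}, Sum.inl (Sum.inl x) ∈ A₂ ↔ x ∈ A' := fun {x} => by simp [A₂]
  have hA₂D : A₂ ⊆ D := by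
    intro x hx
    obtain ⟨y, hy, rfl⟩ := Finset.mem_image.1 hx
    exact Finset.inl_mem_disjSum.2 (Finset.inl_mem_disjSum.2 hy)
  have htoLeft : ∀ X ⊆ D, A₂ ⊆ X → X.toLeft.toLeft = A' := by
    intro X hXD hAX
    ext x
    rw [Finset.mem_toLeft, Finset.mem_toLeft]
    exact ⟨fun h => Finset.inl_mem_disjSum.1 (Finset.inl_mem_disjSum.1 (hXD h)),
      fun h => hAX (hmemA₂.2 h)⟩
  have hAfilter : ∀ X, A₂ ⊆ X → A ⊆ B.filter fun x => θ x ∈ X := by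
    intro X hAX x hx
    refine Finset.mem_filter.2 ⟨hAB.1 hx, hAX ?_⟩
    rw [hθA x hx]
    exact hmemA₂.2 (hfA (Finset.mem_image_of_mem f hx))
  -- the path costs at most `ρ`, and only for sets that contain `b`, which have rank at least `ρ`
  -- over `A'` without the path
  have hstrong : Strong α A₂ D := by
    refine ⟨hA₂D, fun X hAX hXD => ?_⟩
    have h1 := hrank₁ X hXD
    have h3 := hX X hXD
    rw [htoLeft X hXD hAX, Finset.inter_eq_right.2 (hAfilter X hAX)] at h1
    rw [hA₂, rank_eq_hrank α X, hed]
    have h4 : ∀ h : A ≠ B.filter fun x => θ x ∈ X,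
        rank α B ≤ rank α (B.filter fun x => θ x ∈ X) := fun h =>
      hprim _ ((hAfilter X hAX).ssubset_of_ne h) (Finset.filter_subset _ _)
    by_cases hb : Sum.inl (Sum.inr b) ∈ X
    · have h5 : A ≠ B.filter fun x => θ x ∈ X := by
        intro h
        refine hbA (h ▸ Finset.mem_filter.2 ⟨hbB, ?_⟩)
        show Sum.inl (amalgamMap f A b) ∈ X
        rwa [amalgamMap_of_notMem hbA]
      linarith [h4 h5, h3.1]
    · have h5 := h3.2 (Or.inl hb)
      by_cases h6 : A = B.filter fun x => θ x ∈ X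
      · rw [← h6] at h1
        linarith
      · linarith [h4 h6]
  have hnonneg : ∀ X ⊆ D, 0 ≤ rank (L := L) α X := by
    intro X hXD
    have h1 := rank_submodular (α := α) hα0 X A₂
    have h3 := hstrong.2 (X ∪ A₂) Finset.subset_union_right (Finset.union_subset hXD hA₂D)
    obtain ⟨Y, hY, hYX⟩ := Finset.subset_image_iff.1
      (show X ∩ A₂ ⊆ A'.image (Sum.inl ∘ Sum.inl) from Finset.inter_subset_right)
    have h4 : rank α (X ∩ A₂) = rank α Y := by
      rw [← hYX]
      exact (hNemb Y).rank_image subset_rfl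
    have h5 := rank_nonneg_of_model hN Y
    linarith
  let n₀ : N := Classical.arbitrary N
  obtain ⟨g, hg, hgA⟩ := exists_extension_of_model hN (isHypergraph_hypergraphStructure 𝓔₂)
    hstrong hnonneg (f := Sum.elim (Sum.elim id fun _ => n₀) fun _ => n₀)
    ((hNemb A').inv fun x _ => rfl)
  have hθimg : B.image θ ⊆ D := fun x hx => by
    obtain ⟨y, hy, rfl⟩ := Finset.mem_image.1 hx
    exact hθB y hy
  have hgθ : IsEmb (edges L M) (edges L N) (g ∘ θ) B := hθ.comp (hg.mono hθimg)
  have hgθA : ∀ x ∈ A, (g ∘ θ) x = f x := by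
    intro x hx
    show g (θ x) = f x
    rw [hθA x hx, hgA _ (hmemA₂.2 (hfA (Finset.mem_image_of_mem f hx)))]
    rfl
  refine ⟨g ∘ θ, hgθ, hgθA, fun C hBC hC => ?_⟩
  have hBimg : B.image (g ∘ θ) = (B.image θ).image g := Finset.image_image.symm
  have hcardB : (B.image (g ∘ θ)).card = B.card := hgθ.card_image subset_rfl
  have hrankB : rank α (B.image (g ∘ θ)) = rank α B := hgθ.rank_image subset_rfl
  rw [hrankB]
  rw [hcardB] at hC
  -- `X` is the part of `C` in the image of `D`
  set X : Finset ((N ⊕ M) ⊕ ℕ) := D.filter fun x => g x ∈ C with hXdef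
  have hXD : X ⊆ D := Finset.filter_subset _ _
  have hBX : B.image θ ⊆ X := fun x hx => Finset.mem_filter.2
    ⟨hθimg hx, hBC (hBimg ▸ Finset.mem_image_of_mem g hx)⟩
  have hXC : X.image g = C ∩ D.image g := by
    ext y
    simp only [hXdef, Finset.mem_image, Finset.mem_filter, Finset.mem_inter]
    constructor
    · rintro ⟨x, ⟨hx, hxC⟩, rfl⟩
      exact ⟨hxC, x, hx, rfl⟩
    · rintro ⟨hyC, x, hx, rfl⟩
      exact ⟨x, ⟨hx, hyC⟩, rfl⟩
  have hcardX : X.card ≤ B.card + n := by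
    rw [← hg.card_image hXD, hXC]
    exact (Finset.card_le_card Finset.inter_subset_left).trans hC
  -- `X` contains few points of the path, so that its rank is not diminished by them
  have hclaim₁ : rank α B ≤ rank α (X.image g) := by
    rw [hg.rank_image hXD]
    have h1 := hrank₁ X hXD
    have hBf : B.filter (fun x => θ x ∈ X) = B :=
      Finset.filter_true_of_mem fun x hx => hBX (Finset.mem_image_of_mem θ hx)
    rw [hBf, Finset.inter_eq_right.2 hAB.1] at h1
    have h3 := Finset.card_toLeft_add_card_toRight (u := X)
    have h4 := Finset.card_toLeft_add_card_toRight (u := X.toLeft)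
    have h5 : B \ A ⊆ X.toLeft.toRight := by
      intro x hx
      have hx := Finset.mem_sdiff.1 hx
      have : θ x ∈ X := hBX (Finset.mem_image_of_mem θ hx.1)
      rw [Finset.mem_toRight, Finset.mem_toLeft]
      have h6 : θ x = Sum.inl (Sum.inr x) := congrArg Sum.inl (amalgamMap_of_notMem hx.2)
      rwa [← h6]
    have h6 : A.image f ⊆ X.toLeft.toLeft := by
      intro y hy
      obtain ⟨x, hx, rfl⟩ := Finset.mem_image.1 hy
      rw [Finset.mem_toLeft, Finset.mem_toLeft, ← hθA x hx]
      exact hBX (Finset.mem_image_of_mem θ (hAB.1 hx))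
    have h7 := Finset.card_le_card h5
    have h8 := Finset.card_le_card h6
    have h9 := Finset.card_sdiff_add_card_eq_card hAB.1
    rw [hf.card_image subset_rfl] at h8
    have h10 := (hX X hXD).2 (Or.inr (by omega))
    have h11 := hcl _ h6 (by rw [hf.card_image subset_rfl]; omega)
    rw [hf.rank_image subset_rfl] at h11
    rw [rank_eq_hrank α X, hed]
    linarith
  -- `D` has almost the same rank as `A'`, so that adding `C` to `D` can hardly diminish the rank
  have hclaim₂ : rank α (X.image g) < rank α C + η := by
    have h1 := rank_submodular (α := α) hα0 C (D.image g)
    rw [← hXC, hg.rank_image subset_rfl] at h1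
    have h3 : A' ⊆ D.image g := by
      intro x hx
      have h4 : g (Sum.inl (Sum.inl x)) = x := hgA _ (hmemA₂.2 hx)
      rw [← h4]
      exact Finset.mem_image_of_mem g (hA₂D (hmemA₂.2 hx))
    have h4 : D.card = A'.card + (B \ A).card + P := by simp [D, D₁]
    have h5 := card_union_le_of_inter hBC
      (hBimg ▸ Finset.image_subset_image hθimg : B.image (g ∘ θ) ⊆ D.image g)
      (hC.trans_eq (by rw [hcardB]))
    rw [hg.card_image subset_rfl, h4] at h5
    have h6 := hA' (C ∪ D.image g) (h3.trans Finset.subset_union_right) (by omega)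
    have h7 := hrank₁ D subset_rfl
    rw [htoLeft D subset_rfl hA₂D, Finset.filter_true_of_mem hθB,
      Finset.inter_eq_right.2 hAB.1, Finset.toLeft_disjSum] at h7
    rw [rank_eq_hrank α D, hed] at h1
    linarith
  by_contra! hlt
  have h1 := hgap (A := X.image g) (B := C) (hXC ▸ Finset.inter_subset_left) ?_ (by linarith)
  · linarith
  · refine hC.trans (Nat.add_le_add_right ?_ n)
    rw [← hcardB, hBimg]
    exact Finset.card_le_card (Finset.image_subset_image hBX)

/-- If `A` embeds onto a closed subset of a model of `S_α`, then so does every `B` with `A ≤ B`. The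
extension is decomposed into steps from `A` to a proper superset of minimal rank. -/
lemma exists_closed_extension [Nonempty N] (h2 : ∀ F : Symb L, 2 ≤ F.1)
    (hα : ∀ F, 0 < α F ∧ α F ≤ 1) {E : Symb L} (hE : IsPathSymbol α Sigma.fst E)
    (hN : N ⊨ theoryS α) (hM : IsHypergraph L M) {A B : Finset M} (hAB : Strong α A B)
    {f : M → N} (hf : IsEmb (edges L M) (edges L N) f A) [DecidableEq N] {n : ℕ}
    (hcl : Closed α n (A.image f)) :
    ∃ g : M → N, IsEmb (edges L M) (edges L N) g B ∧ (∀ x ∈ A, g x = f x) ∧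
      Closed α n (B.image g) := by
  classical
  induction hk : (B \ A).card using Nat.strong_induction_on generalizing A f with
  | _ k ih =>
  rcases hAB.1.eq_or_ssubset with rfl | hss
  · exact ⟨f, hf, fun _ _ => rfl, hcl⟩
  obtain ⟨C, hC, hmin⟩ := Finset.exists_min_image (B.powerset.filter fun C => A ⊂ C) (rank α)
    ⟨B, by simpa using hss⟩
  simp only [Finset.mem_filter, Finset.mem_powerset, and_imp] at hC hmin
  obtain ⟨b, hbB, hbA⟩ := Finset.exists_of_ssubset hss
  have h1 : rank α C ≤ rank α A + 1 := by
    refine (hmin (insert b A) (Finset.insert_subset hbB hAB.1) (Finset.ssubset_insert hbA)).trans ?_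
    obtain ⟨y, hy⟩ := exists_hrank_sub_eq α (edges L M) (Finset.subset_insert b A)
    have h3 : 0 ≤ ∑ F, α F * (y F : ℝ) :=
      Finset.sum_nonneg fun F _ => mul_nonneg (hα F).1.le (Nat.cast_nonneg _)
    have h4 : (insert b A \ A).card = 1 := by
      rw [Finset.card_sdiff_of_subset (Finset.subset_insert b A), Finset.card_insert_of_notMem hbA]
      omega
    rw [h4, Nat.cast_one] at hy
    rw [rank_eq_hrank, rank_eq_hrank]
    linarith
  obtain ⟨g, hg, hgA, hgcl⟩ := exists_closed_extension_of_primitive h2 hα hE hN hM hC.2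
    (hAB.2 C hC.2.1 hC.1) h1 (fun C' h3 h4 => hmin C' (h4.trans hC.1) h3) hf hcl
  have hCB : Strong α C B :=
    ⟨hC.1, fun D hCD hDB => hmin D hDB (hC.2.trans_subset hCD)⟩
  have hlt : (B \ C).card < k := by
    rw [← hk]
    have h3 := Finset.card_lt_card hC.2
    have h4 := Finset.card_sdiff_add_card_eq_card hC.1
    have h5 := Finset.card_sdiff_add_card_eq_card hAB.1
    omega
  obtain ⟨g', hg', hgC, hgcl'⟩ := ih _ hlt hCB hg hgcl rfl
  exact ⟨g', hg', fun x hx => (hgC x (hC.2.1 hx)).trans (hgA x hx), hgcl'⟩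

end ClosedEmbedding

/-! ### Back-and-forth -/

section BackAndForth

universe u

variable {L : FirstOrder.Language} [Fintype (Symb L)] {α : Symb L → ℝ}
  {M N : Type u} [L.Structure M] [L.Structure N] {ι κ : Type*}

/-- The tuples `a` in `M` and `b` in `N` satisfy the same chain-minimal extension formulas of
extensions by at most `n` points. -/
def Sim (α : Symb L → ℝ) (n : ℕ) (a : ι → M) (b : ι → N) : Prop :=
  ∀ (m k : ℕ) (_ : L.Structure (Fin m ⊕ Fin k)) (x : Fin m ↪ ι), k ≤ n →
    InK L (Fin m ⊕ Fin k) α → MinimalChain (L := L) α (base m k) Finset.univ →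
      ((extensionFormula (L := L) m k).Realize (a ∘ x) ↔
        (extensionFormula (L := L) m k).Realize (b ∘ x))

lemma Sim.symm {n : ℕ} {a : ι → M} {b : ι → N} (h : Sim α n a b) : Sim α n b a :=
  fun m k _ x hk hK hc => (h m k _ x hk hK hc).symm

lemma Sim.mono {n m : ℕ} {a : ι → M} {b : ι → N} (h : Sim α n a b) (hm : m ≤ n) : Sim α m a b :=
  fun m k _ x hk hK hc => h m k _ x (hk.trans hm) hK hc

lemma Sim.comp {n : ℕ} {a : ι → M} {b : ι → N} (h : Sim α n a b) (c : κ ↪ ι) :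
    Sim α n (a ∘ c) (b ∘ c) :=
  fun m k _ x hk hK hc => h m k _ (x.trans c) hk hK hc

/-- The special case of `Sim.exists_isEmb` in which the base is enumerated without repetition. -/
lemma Sim.exists_isEmb_of_injective [L.IsRelational] [Nonempty N] (hM : M ⊨ theoryS α)
    {n m : ℕ} {a : ι → M} {b : ι → N} (h : Sim α n a b) (x : Fin m ↪ ι)
    (hx : Function.Injective (a ∘ x))
    {A C : Finset M} (hA : (A : Set M) = Set.range (a ∘ x)) (hAC : MinimalChain α A C)
    (hn : C.card ≤ A.card + n) :
    ∃ f : M → N, IsEmb (edges L M) (edges L N) f C ∧ ∀ i, f (a (x i)) = b (x i) := by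
  classical
  have hMh := isHypergraph_of_model hM
  obtain ⟨y, he, heA, heC⟩ := exists_enumeration hAC.subset hx
    (Finset.coe_injective (by rw [hA, Finset.coe_image, Finset.coe_univ, Set.image_univ]))
  set e := Sum.elim (a ∘ x) y
  let _ := inducedStructure (L := L) e
  have hemb : ∀ X, IsEmb (edges L _) (edges L M) e X :=
    fun X => isEmb_of_relMap_iff he (fun E x => Iff.rfl) X
  have hK : InK L (Fin m ⊕ Fin (C \ A).card) α := by
    refine ⟨isHypergraph_of_relMap_iff (e := e) (fun E x => Iff.rfl) hMh, fun X => ?_⟩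
    rw [← (hemb X).rank_image subset_rfl]
    exact rank_nonneg_of_model hM _
  -- the inverse of `e` maps the chain in `M` to one in the substructure
  have hchain : MinimalChain (L := L) α (base m (C \ A).card) Finset.univ := by
    rcases isEmpty_or_nonempty (Fin m ⊕ Fin (C \ A).card) with hemp | hne
    · rw [Finset.eq_empty_of_isEmpty (base m (C \ A).card), Finset.eq_empty_of_isEmpty Finset.univ]
      exact Relation.ReflTransGen.refl
    · have h1 : ∀ i, Function.invFun e (e i) = i := Function.leftInverse_invFun he
      have h3 := (hemb Finset.univ).inv (g := Function.invFun e) fun i _ => h1 i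
      rw [heC] at h3
      have h4 := h3.minimalChain_image hAC
      have h5 : ∀ X : Finset _, (X.image e).image (Function.invFun e) = X := fun X => by
        rw [Finset.image_image, show Function.invFun e ∘ e = id from funext h1, Finset.image_id]
      have h6 := h5 (base m (C \ A).card)
      have h7 := h5 Finset.univ
      rw [heA] at h6
      rw [heC] at h7
      rwa [h6, h7] at h4
  have hk' : (C \ A).card ≤ n := by
    have := Finset.card_sdiff_add_card_eq_card hAC.subset
    omega
  obtain ⟨z, hz, hzE⟩ := (realize_extensionFormula _).1 ((h m _ inferInstance x hk' hK hchain).1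
    ((realize_extensionFormula _).2 ⟨y, he, fun E x => Iff.rfl⟩))
  have hv : IsEmb (edges L _) (edges L N) (Sum.elim (b ∘ x) z) Finset.univ :=
    isEmb_of_relMap_iff hz hzE _
  have hext := (hemb Finset.univ).extend hv
  rw [heC] at hext
  exact ⟨Function.extend e (Sum.elim (b ∘ x) z) fun _ => Classical.arbitrary N,
    hext _, fun i => he.extend_apply _ _ (Sum.inl i)⟩

/-- If two tuples satisfy the same chain-minimal formulas, then minimal chains over one of them can
be embedded over the other. -/
lemma Sim.exists_isEmb [L.IsRelational] [Nonempty M] [Nonempty N] (hM : M ⊨ theoryS α)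
    (hN : N ⊨ theoryS α) {n : ℕ} {a : ι → M} {b : ι → N} (h : Sim α n a b)
    {A C : Finset M} (hA : (A : Set M) = Set.range a) (hAC : MinimalChain α A C)
    (hn : C.card ≤ A.card + n) :
    ∃ f : M → N, IsEmb (edges L M) (edges L N) f C ∧ ∀ i, f (a i) = b i := by
  classical
  have h1 : ∀ t : Fin A.card, ∃ i, a i = A.equivFin.symm t := fun t => by
    have h2 : (A.equivFin.symm t : M) ∈ (A : Set M) := (A.equivFin.symm t).2
    rw [hA] at h2
    exact h2
  choose x hx using h1
  have hxi : Function.Injective (a ∘ x) := fun t t' htt => by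
    have h2 : a (x t) = a (x t') := htt
    rw [hx, hx] at h2
    exact A.equivFin.symm.injective (Subtype.ext h2)
  have hmem : ∀ i, a i ∈ A := fun i => by
    rw [← Finset.mem_coe, hA]
    exact Set.mem_range_self i
  have htrans : ∀ i, ∃ t, a (x t) = a i := fun i => ⟨A.equivFin ⟨a i, hmem i⟩, by rw [hx]; simp⟩
  obtain ⟨f, hf, hfx⟩ := h.exists_isEmb_of_injective hM ⟨x, hxi.of_comp⟩ hxi
    (by
      rw [hA]
      ext z
      constructor
      · rintro ⟨i, rfl⟩
        exact htrans i
      · rintro ⟨t, rfl⟩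
        exact ⟨x t, rfl⟩) hAC hn
  refine ⟨f, hf, fun i => ?_⟩
  obtain ⟨t, ht⟩ := htrans i
  rw [← ht]
  refine (hfx t).trans ?_
  -- equality of variables is expressed by the formulas with two variables
  by_contra hne
  have hxt : x t ≠ i := fun hxt => hne (congrArg b hxt)
  let y : Fin 2 ↪ ι := ⟨![x t, i], injective_pair_iff_ne.2 hxt⟩
  have hy : Function.Injective (b ∘ y) := by
    have h2 : b ∘ y = ![b (x t), b i] := by
      funext p
      fin_cases p <;> rfl
    rw [h2]
    exact injective_pair_iff_ne.2 hne
  obtain ⟨f', hf', hfy⟩ := h.symm.exists_isEmb_of_injective hN y hy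
    (A := Finset.univ.image (b ∘ y))
    (by rw [Finset.coe_image, Finset.coe_univ, Set.image_univ])
    Relation.ReflTransGen.refl (Nat.le_add_right _ _)
  have h3 : f' (b (x t)) = a (x t) := hfy 0
  have h4 : f' (b i) = a i := hfy 1
  refine hne (hf'.1 ?_ ?_ (h3.trans (ht.trans h4.symm)))
  · exact Finset.mem_coe.2 (Finset.mem_image_of_mem (b ∘ y) (Finset.mem_univ 0))
  · exact Finset.mem_coe.2 (Finset.mem_image_of_mem (b ∘ y) (Finset.mem_univ 1))

/-- Embeddings of closed sets preserve chain-minimal formulas. -/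
lemma realize_extensionFormula_of_closed (hα : ∀ F, 0 < α F) (hM : IsHypergraph L M)
    (hN : IsHypergraph L N) {n m k : ℕ} {B : Finset M} (hB : Closed α n B) {g : M → N}
    (hg : IsEmb (edges L M) (edges L N) g B) [L.Structure (Fin m ⊕ Fin k)] (hk : k ≤ n)
    (hc : MinimalChain (L := L) α (base m k) Finset.univ) {v : Fin m → M} (hv : ∀ i, v i ∈ B)
    (h : (extensionFormula (L := L) m k).Realize v) :
    (extensionFormula (L := L) m k).Realize (g ∘ v) := by
  classical
  obtain ⟨y, hy, hyE⟩ := (realize_extensionFormula _).1 h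
  have he : IsEmb (edges L _) (edges L M) (Sum.elim v y) Finset.univ :=
    isEmb_of_relMap_iff hy hyE _
  have h1 : ShortChain (L := L) α n (base m k) Finset.univ :=
    hc.shortChain (by simpa [base] using hk)
  have h3 := hB.subset_of_shortChain hα (fun z hz => ?_) (he.shortChain_image h1)
  · have h4 : ∀ i, Sum.elim v y i ∈ B := fun i => h3 (Finset.mem_image_of_mem _ (Finset.mem_univ i))
    rw [realize_extensionFormula]
    refine ⟨g ∘ y, ?_⟩
    rw [← Sum.comp_elim]
    refine ⟨fun i j hij => hy (hg.1 (h4 i) (h4 j) hij), fun E x => ?_⟩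
    rw [hyE, hg.relMap_iff hM hN E (x := Sum.elim v y ∘ x) fun i => h4 (x i)]
    rfl
  · obtain ⟨i, hi, rfl⟩ := Finset.mem_image.1 hz
    obtain ⟨j, -, rfl⟩ := Finset.mem_map.1 hi
    exact hv j

/-- One step of the back-and-forth: tuples that agree on sufficiently many chain-minimal formulas
can be extended so that they still agree on a given number of them. -/
lemma exists_sim_step [L.IsRelational] (h2 : ∀ F : Symb L, 2 ≤ F.1)
    (hα : ∀ F, 0 < α F ∧ α F ≤ 1) {E : Symb L} (hE : IsPathSymbol α Sigma.fst E) (n p : ℕ) :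
    ∃ n' : ℕ, ∀ {M N : Type u} [L.Structure M] [L.Structure N] [Nonempty M] [Nonempty N],
      M ⊨ theoryS α → N ⊨ theoryS α → ∀ {ι : Type*} [Finite ι], Nat.card ι ≤ p →
        ∀ (a : ι → M) (b : ι → N), Sim α n' a b → ∀ c : M, ∃ d : N,
          Sim α n (fun o : Option ι => o.elim c a) fun o => o.elim d b := by
  classical
  have hα0 : ∀ F, 0 < α F := fun F => (hα F).1
  obtain ⟨s₁, hs₁⟩ := exists_closure_bound (L := L) hα0 n (p + 1)
  obtain ⟨s₂, hs₂⟩ := exists_closure_bound (L := L) hα0 (max n (s₁ + 1)) p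
  refine ⟨s₂, fun {M N} _ _ _ _ hM hN {ι} _ hp a b h c => ?_⟩
  have hMh := isHypergraph_of_model hM
  have hNh := isHypergraph_of_model hN
  obtain ⟨A, hA⟩ := (Set.finite_range a).exists_finset_coe
  have hmemA : ∀ i, a i ∈ A := fun i => by
    rw [← Finset.mem_coe, hA]
    exact Set.mem_range_self i
  have hAp : A.card ≤ p := by
    rw [← Set.ncard_coe_finset, hA, ← Nat.card_coe_set_eq]
    exact (Finite.card_range_le a).trans hp
  -- `B₀` is the closure of the extended tuple, and `A₀` that of `a` inside `B₀`
  obtain ⟨B₀, hB₀chain, hB₀, hB₀card⟩ := hs₁ (rank_nonneg_of_model hM) (insert c A)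
    ((Finset.card_insert_le _ _).trans (by omega))
  have hB₀sub := hB₀chain.minimalChain.subset
  have hAB₀ : A ⊆ B₀ := (Finset.subset_insert c A).trans hB₀sub
  obtain ⟨A₀, hA₀chain, hA₀⟩ := exists_minimalChain_strong (α := α) hAB₀
  have hA₀card : A₀.card ≤ A.card + (s₁ + 1) := by
    have := Finset.card_le_card hA₀.1
    have := Finset.card_insert_le c A
    omega
  -- the closures of the two tuples under larger extensions are isomorphic
  obtain ⟨A₁, hA₁chain, hA₁, hA₁card⟩ := hs₂ (rank_nonneg_of_model hM) A hAp
  obtain ⟨f, hf, hfa⟩ := h.exists_isEmb hM hN hA hA₁chain.minimalChain hA₁card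
  have hAA₁ := hA₁chain.minimalChain.subset
  have himg : ((A.image f : Finset N) : Set N) = Set.range b := by
    rw [Finset.coe_image, hA, ← Set.range_comp]
    exact congrArg Set.range (funext hfa)
  have hcardimg : (A.image f).card = A.card := hf.card_image hAA₁
  obtain ⟨B₁, hB₁chain, hB₁, hB₁card⟩ := hs₂ (rank_nonneg_of_model hN) (A.image f)
    (hcardimg.trans_le hAp)
  obtain ⟨f', hf', hfb⟩ := h.symm.exists_isEmb hN hM himg hB₁chain.minimalChain hB₁card
  have h1 : A₁.image f ⊆ B₁ := hB₁.subset_of_shortChain hα0 hB₁chain.minimalChain.subset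
    (hf.shortChain_image hA₁chain)
  have h3 : B₁.image f' ⊆ A₁ := by
    refine hA₁.subset_of_shortChain hα0 ?_ (hf'.shortChain_image hB₁chain)
    rintro z hz
    rw [Finset.image_image] at hz
    obtain ⟨w, hw, rfl⟩ := Finset.mem_image.1 hz
    have hw' : w ∈ Set.range a := hA ▸ Finset.mem_coe.2 hw
    obtain ⟨i, rfl⟩ := hw'
    show f' (f (a i)) ∈ A₁
    rw [hfa, hfb]
    exact hAA₁ hw
  have h4 : A₁.image f = B₁ := by
    refine Finset.eq_of_subset_of_card_le h1 ?_
    rw [hf.card_image subset_rfl, ← hf'.card_image subset_rfl]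
    exact Finset.card_le_card h3
  have hA₀A₁ : A₀ ⊆ A₁ := hA₁.subset_of_shortChain hα0 hAA₁
    (hA₀chain.shortChain (hA₀card.trans (Nat.add_le_add_left (le_max_right _ _) _)))
  have hA₀cl : Closed α n A₀ := hB₀.of_strong hα0 hA₀
  have hcl : Closed α n (A₀.image f) := by
    by_contra hcon
    obtain ⟨C', hC', hC'card⟩ := exists_minimalPair_of_not_closed hcon
    have h5 : C' ⊆ B₁ := hB₁.subset_of_shortChain hα0
      ((Finset.image_subset_image hA₀A₁).trans h1) (Relation.ReflTransGen.single
        ⟨hC', hC'card.trans (Nat.add_le_add_left (le_max_left _ _) _)⟩)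
    rw [← h4] at h5
    obtain ⟨C, hC, rfl⟩ := Finset.subset_image_iff.1 h5
    have hC : C ⊆ A₁ := hC
    have h6 := hC'.rank_lt
    rw [hf.rank_image hC, hf.rank_image hA₀A₁] at h6
    rw [hf.card_image hC, hf.card_image hA₀A₁] at hC'card
    refine absurd (hA₀cl C (fun x hx => ?_) hC'card) (not_le.2 h6)
    obtain ⟨y, hy, hxy⟩ := Finset.mem_image.1 (hC'.1 (Finset.mem_image_of_mem f hx))
    rwa [← hf.1 (hC hy) (hA₀A₁ hx) hxy]
  obtain ⟨g, hg, hgA, hgcl⟩ :=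
    exists_closed_extension h2 hα hE hN hMh hA₀ (hf.mono hA₀A₁) hcl
  refine ⟨g c, ?_⟩
  have hmem : ∀ o : Option ι, o.elim c a ∈ B₀ := by
    rintro (_ | i)
    · exact hB₀sub (Finset.mem_insert_self c A)
    · exact hAB₀ (hmemA i)
  have hgo : ∀ o : Option ι, g (o.elim c a) = o.elim (g c) b := by
    rintro (_ | i)
    · rfl
    · exact (hgA _ (hA₀chain.subset (hmemA i))).trans (hfa i)
  have hginv : ∀ x ∈ B₀, Function.invFunOn g B₀ (g x) = x :=
    fun x hx => hg.1.leftInvOn_invFunOn hx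
  intro m k _ x hk _ hc
  have h5 : (fun o : Option ι => o.elim (g c) b) ∘ x = g ∘ (fun o => o.elim c a) ∘ x :=
    funext fun i => (hgo (x i)).symm
  rw [h5]
  refine ⟨realize_extensionFormula_of_closed hα0 hMh hNh hB₀ hg hk hc fun i => hmem _,
    fun h6 => ?_⟩
  have h7 := realize_extensionFormula_of_closed hα0 hNh hMh hgcl (hg.inv hginv) hk hc
    (fun i => Finset.mem_image_of_mem g (hmem (x i))) h6
  have h8 : Function.invFunOn g B₀ ∘ g ∘ (fun o => o.elim c a) ∘ x = (fun o => o.elim c a) ∘ x :=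
    funext fun i => hginv _ (hmem (x i))
  exact h8 ▸ h7

end BackAndForth

/-! ### Syntactic form of the axioms -/

section ForallExists

universe u v

variable {L : FirstOrder.Language}

lemma isQF_iInf {β ι : Type*} [Finite β] {f : β → L.Formula ι} (hf : ∀ i, (f i).IsQF) :
    (Formula.iInf f).IsQF := by
  let _ := Fintype.ofFinite β
  have h : ∀ l : List β,
      BoundedFormula.IsQF ((l.map f).foldr (fun φ ψ : L.BoundedFormula ι 0 => φ ⊓ ψ) ⊤) := by
    intro l
    induction l with
    | nil => exact BoundedFormula.IsQF.top
    | cons i l ih => exact (hf i).inf ih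
  exact h _

lemma isQF_atomicDiagram [Fintype (Symb L)] {X ι : Type} [L.Structure X] [Finite ι] (e : ι → X) :
    (atomicDiagram (L := L) e).IsQF := by
  classical
  refine BoundedFormula.IsQF.inf (isQF_iInf fun p => ?_) (isQF_iInf fun p => ?_)
  · split_ifs
    · exact (BoundedFormula.IsAtomic.equal _ _).isQF
    · exact (BoundedFormula.IsAtomic.equal _ _).isQF.not
  · split_ifs
    · exact (BoundedFormula.IsAtomic.rel _ _).isQF
    · exact (BoundedFormula.IsAtomic.rel _ _).isQF.not

lemma isForallExists_of_realize {L : FirstOrder.Language.{u, v}} {m k : ℕ} {σ : L.Sentence}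
    {φ : L.Formula (Fin m ⊕ Fin k)} (hφ : φ.IsQF)
    (h : ∀ (M : Theory.ModelType.{u, v, max u v} (∅ : L.Theory)),
      M ⊨ σ ↔ ∀ v : Fin m → M, ∃ y : Fin k → M, φ.Realize (Sum.elim v y)) :
    IsForallExists σ := by
  refine ⟨m, k, φ, hφ, fun M v xs => ?_⟩
  rw [BoundedFormula.realize_iff, Unique.eq_default v, Unique.eq_default xs]
  refine (h M).trans ((realize_forallClosure _).trans (forall_congr' fun v => ?_)).symm
  exact Formula.realize_iExs

lemma isForallExists_of_mem_theoryS [Fintype (Symb L)] {α : Symb L → ℝ} {σ : L.Sentence}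
    (hσ : σ ∈ theoryS α) : IsForallExists σ := by
  rcases hσ with ⟨m, _, -, rfl⟩ | ⟨m, k, _, -, -, rfl⟩
  · refine isForallExists_of_realize (k := 0)
      (φ := (atomicDiagram (id : Fin m → Fin m)).not.relabel Sum.inl)
      ((isQF_atomicDiagram _).not.relabel _) fun M => ?_
    rw [realize_forallClosure]
    refine forall_congr' fun v => ?_
    simp only [Formula.realize_relabel, Sum.elim_comp_inl, exists_const]
  · refine isForallExists_of_realize
      (φ := ((atomicDiagram (Sum.inl : Fin m → Fin m ⊕ Fin k)).relabel Sum.inl).imp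
        (atomicDiagram (id : Fin m ⊕ Fin k → Fin m ⊕ Fin k)))
      (((isQF_atomicDiagram _).relabel _).imp (isQF_atomicDiagram _)) fun M => ?_
    rw [realize_forallClosure]
    refine forall_congr' fun v => ?_
    simp only [Formula.realize_imp, Formula.realize_relabel, Sum.elim_comp_inl, existsExt,
      Formula.realize_iExs]
    -- models are nonempty, so that the quantifier over `y` can be pulled out of the implication
    exact ⟨fun h => by
      by_cases h1 : (atomicDiagram (L := L) (Sum.inl : Fin m → Fin m ⊕ Fin k)).Realize v
      · exact (h h1).imp fun y hy _ => hy
      · exact ⟨fun _ => Classical.arbitrary M, fun h2 => absurd h2 h1⟩,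
      fun ⟨y, hy⟩ h1 => ⟨y, hy h1⟩⟩

end ForallExists

/-! ### Formulas as boolean combinations -/

section BooleanCombinations

universe u v w

variable {L : FirstOrder.Language.{u, v}} {V : Type w}

/-- A formula whose truth value in models of `T` depends only on the truth values of finitely many
formulas is equivalent to a boolean combination of these. -/
lemma exists_isBoolComb {T : L.Theory} {S S₀ : Set (L.Formula V)} (hS : S.Nonempty)
    (hS₀ : S₀.Finite) (hS₀S : S₀ ⊆ S) {φ : L.Formula V}
    (hφ : ∀ (M N : Theory.ModelType.{u, v, max u v w} T) (v : V → M) (v' : V → N),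
      (∀ χ ∈ S₀, χ.Realize v ↔ χ.Realize v') → φ.Realize v → φ.Realize v') :
    ∃ ψ, IsBoolComb S ψ ∧ φ ⇔[T] ψ := by
  classical
  suffices h : ∀ P : ∀ M : Theory.ModelType.{u, v, max u v w} T, (V → M) → Prop,
      (∀ (M N : Theory.ModelType.{u, v, max u v w} T) (v : V → M) (v' : V → N),
        (∀ χ ∈ S₀, χ.Realize v ↔ χ.Realize v') → P M v → P N v') →
      ∃ ψ, IsBoolComb S ψ ∧ ∀ (M : Theory.ModelType.{u, v, max u v w} T) (v : V → M),
        P M v ↔ ψ.Realize v by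
    obtain ⟨ψ, hψ, h⟩ := h (fun M v => φ.Realize v) hφ
    refine ⟨ψ, hψ, fun M v xs => ?_⟩
    rw [BoundedFormula.realize_iff, Unique.eq_default xs]
    exact h M v
  clear hφ
  induction S₀, hS₀ using Set.Finite.induction_on with
  | empty =>
    intro P hP
    obtain ⟨χ, hχ⟩ := hS
    have hχ := IsBoolComb.of χ hχ
    by_cases h : ∃ (M : Theory.ModelType.{u, v, max u v w} T) (v : V → M), P M v
    · obtain ⟨M, v, hv⟩ := h
      refine ⟨χ ⊔ χ.not, hχ.or _ _ (hχ.not _), fun N v' => ?_⟩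
      rw [Formula.realize_sup, Formula.realize_not]
      exact iff_of_true (hP M N v v' (by simp) hv) (em _)
    · push Not at h
      refine ⟨χ ⊓ χ.not, hχ.and _ _ (hχ.not _), fun N v' => ?_⟩
      rw [Formula.realize_inf, Formula.realize_not]
      exact iff_of_false (h N v') (and_not_self)
  | @insert χ S₀ _ _ ih =>
    intro P hP
    have hχ := IsBoolComb.of χ (hS₀S (Set.mem_insert χ S₀))
    -- `P` under the assumption that `χ` has the truth value `b`
    have hb : ∀ b : Prop, ∃ ψ, IsBoolComb S ψ ∧
        ∀ (M : Theory.ModelType.{u, v, max u v w} T) (v : V → M),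
          (χ.Realize v ↔ b) → (P M v ↔ ψ.Realize v) := by
      intro b
      obtain ⟨ψ, hψ, h⟩ := ih ((Set.subset_insert χ S₀).trans hS₀S)
        (fun M v => ∃ (N : Theory.ModelType.{u, v, max u v w} T) (v' : V → N),
          (∀ χ ∈ S₀, χ.Realize v ↔ χ.Realize v') ∧ (χ.Realize v' ↔ b) ∧ P N v')
        (fun M N v v' hvv' ⟨N', w, h1, h2⟩ =>
          ⟨N', w, fun χ hχ => (hvv' χ hχ).symm.trans (h1 χ hχ), h2⟩)
      refine ⟨ψ, hψ, fun M v hv => ?_⟩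
      rw [← h]
      refine ⟨fun hP => ⟨M, v, fun _ _ => Iff.rfl, hv, hP⟩, ?_⟩
      rintro ⟨N, v', h1, h2, h3⟩
      refine hP N M v' v ?_ h3
      rintro χ' (rfl | hχ')
      · exact h2.trans hv.symm
      · exact (h1 χ' hχ').symm
    obtain ⟨ψ₁, hψ₁, h1⟩ := hb True
    obtain ⟨ψ₀, hψ₀, h0⟩ := hb False
    refine ⟨(χ ⊓ ψ₁) ⊔ (χ.not ⊓ ψ₀), (hχ.and _ _ hψ₁).or _ _ ((hχ.not _).and _ _ hψ₀),
      fun M v => ?_⟩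
    simp only [Formula.realize_sup, Formula.realize_inf, Formula.realize_not]
    by_cases h : χ.Realize v
    · rw [h1 M v (iff_true_intro h)]
      tauto
    · rw [h0 M v (iff_false_intro h)]
      tauto

variable [L.IsRelational] [Fintype (Symb L)] {α : Symb L → ℝ}

lemma chainMinimalFormulas_nonempty : (chainMinimalFormulas (L := L) α V).Nonempty := by
  classical
  let str : L.Structure (Fin 0 ⊕ Fin 0) := ⟨fun f => isEmptyElim f, fun _ _ => False⟩
  have hE : ∀ (E : Symb L) (x : Fin E.1 → Fin 0 ⊕ Fin 0), ¬ Structure.RelMap E.2 x :=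
    fun E x h => h
  refine ⟨_, 0, 0, str, ⟨isEmptyElim, fun i => isEmptyElim i⟩,
    ⟨fun E x hx => (hE E x hx).elim, fun X => ?_⟩, ?_, rfl⟩
  · have h0 : ∀ E : Symb L, edgeCount E X = 0 := fun E => by simp [edgeCount, hE]
    simp [rank, h0]
  · rw [Finset.eq_empty_of_isEmpty (base 0 0), Finset.eq_empty_of_isEmpty Finset.univ]
    exact Relation.ReflTransGen.refl

instance finite_structure {X : Type*} [Finite X] : Finite (L.Structure X) := by
  refine Finite.of_injective
    (fun (s : L.Structure X) (E : Symb L) => {x : Fin E.1 → X | s.RelMap E.2 x}) fun s t h => ?_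
  refine Structure.ext (funext fun n => funext fun f => isEmptyElim f)
    (funext fun n => funext fun R => ?_)
  exact congrFun h ⟨n, R⟩

/-- A formula that is preserved between similar tuples is equivalent to a boolean combination of
chain-minimal extension formulas, because `Sim` refers to finitely many of them only. -/
lemma exists_isBoolComb_of_sim {φ : L.Formula V} {W : Finset V} {n : ℕ}
    (hφ : ∀ (M N : Theory.ModelType.{u, v, max u v w} (theoryS (L := L) α)) (v : V → M)
      (v' : V → N), Sim α n (fun i : W => v i) (fun i : W => v' i) → φ.Realize v → φ.Realize v') :
    ∃ ψ, IsBoolComb (chainMinimalFormulas α V) ψ ∧ φ ⇔[theoryS α] ψ := by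
  classical
  refine exists_isBoolComb chainMinimalFormulas_nonempty
    (S₀ := {ψ | ∃ (m k : ℕ) (_ : L.Structure (Fin m ⊕ Fin k)) (x : Fin m ↪ W), k ≤ n ∧
      InK L (Fin m ⊕ Fin k) α ∧ MinimalChain (L := L) α (base m k) Finset.univ ∧
      ψ = (extensionFormula m k).relabel fun i => (x i : V)}) ?_ ?_ fun M N v v' h => ?_
  · refine ((Set.finite_Iic W.card).biUnion fun m _ => (Set.finite_Iic n).biUnion fun k _ =>
      Set.finite_range fun p : L.Structure (Fin m ⊕ Fin k) × (Fin m → W) =>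
        (@extensionFormula L _ m k p.1).relabel fun i => (p.2 i : V)).subset ?_
    rintro ψ ⟨m, k, s, x, hk, -, -, rfl⟩
    have hm : m ≤ W.card := by simpa using Fintype.card_le_of_embedding x
    simp only [Set.mem_iUnion, Set.mem_Iic]
    exact ⟨m, hm, k, hk, (s, x), rfl⟩
  · rintro ψ ⟨m, k, s, x, -, hK, hc, rfl⟩
    exact ⟨m, k, s, x.trans (Function.Embedding.subtype _), hK, hc, rfl⟩
  · refine hφ M N v v' fun m k s x hk hK hc => ?_
    have := h _ ⟨m, k, s, x, hk, hK, hc, rfl⟩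
    rwa [Formula.realize_relabel, Formula.realize_relabel] at this

end BooleanCombinations

/-! ### Quantifier elimination -/

section QuantifierElimination

universe u

variable {L : FirstOrder.Language} {V : Type*} {q : ℕ}

lemma exists_eq_var [L.IsRelational] {β : Type*} (t : L.Term β) : ∃ x, t = Term.var x := by
  cases t with
  | var x => exact ⟨x, rfl⟩
  | func f _ => exact isEmptyElim f

lemma exists_sumElim_eq (T : Finset (V ⊕ Fin q)) {z : V ⊕ Fin q} (hz : z ∈ T) :
    ∃ y : T.toLeft ⊕ Fin q, ∀ {M : Type u} (v : V → M) (xs : Fin q → M),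
      Sum.elim v xs z = Sum.elim (fun i : T.toLeft => v i) xs y := by
  rcases z with i | j
  · exact ⟨Sum.inl ⟨i, Finset.mem_toLeft.2 hz⟩, fun v xs => rfl⟩
  · exact ⟨Sum.inr j, fun v xs => rfl⟩

variable [Fintype (Symb L)] {α : Symb L → ℝ} {M N : Type u} [L.Structure M] [L.Structure N]

lemma Sim.of_subset {W W' : Finset V} (hW : W' ⊆ W) {n n' : ℕ} (hn : n' ≤ n) {v : V → M}
    {xs : Fin q → M} {v' : V → N} {xs' : Fin q → N}
    (h : Sim α n (Sum.elim (fun i : W => v i) xs) (Sum.elim (fun i : W => v' i) xs')) :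
    Sim α n' (Sum.elim (fun i : W' => v i) xs) (Sum.elim (fun i : W' => v' i) xs') := by
  convert (h.mono hn).comp
    ((Function.Embedding.sumMap (Subtype.impEmbedding _ _ hW) (Function.Embedding.refl (Fin q))))
    using 1 <;> (funext i; rcases i with i | i <;> rfl)

variable [L.IsRelational]

lemma Sim.exists_isEmb_finite [Nonempty M] [Nonempty N] (hM : M ⊨ theoryS α) (hN : N ⊨ theoryS α)
    {ι : Type*} [Finite ι] {n : ℕ} {a : ι → M} {b : ι → N} (h : Sim α n a b) :
    ∃ (A : Finset M) (f : M → N), IsEmb (edges L M) (edges L N) f A ∧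
      ∀ i, a i ∈ A ∧ f (a i) = b i := by
  obtain ⟨A, hA⟩ := (Set.finite_range a).exists_finset_coe
  obtain ⟨f, hf, hfa⟩ := h.exists_isEmb hM hN hA Relation.ReflTransGen.refl (Nat.le_add_right _ _)
  refine ⟨A, f, hf, fun i => ⟨?_, hfa i⟩⟩
  rw [← Finset.mem_coe, hA]
  exact Set.mem_range_self i

/-- Every formula is preserved between tuples that satisfy sufficiently many of the same
chain-minimal extension formulas. -/
lemma exists_sim_realize (h2 : ∀ F : Symb L, 2 ≤ F.1) (hα : ∀ F, 0 < α F ∧ α F ≤ 1) {E : Symb L}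
    (hE : IsPathSymbol α Sigma.fst E) (φ : L.BoundedFormula V q) :
    ∃ (W : Finset V) (n : ℕ), ∀ {M N : Type u} [L.Structure M] [L.Structure N] [Nonempty M]
      [Nonempty N], M ⊨ theoryS α → N ⊨ theoryS α → ∀ (v : V → M) (xs : Fin q → M) (v' : V → N)
      (xs' : Fin q → N),
        Sim α n (Sum.elim (fun i : W => v i) xs) (Sum.elim (fun i : W => v' i) xs') →
          φ.Realize v xs → φ.Realize v' xs' := by
  classical
  induction φ with
  | falsum => exact ⟨∅, 0, fun _ _ _ _ _ _ _ => id⟩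
  | @equal q t₁ t₂ =>
    obtain ⟨x₁, rfl⟩ := exists_eq_var t₁
    obtain ⟨x₂, rfl⟩ := exists_eq_var t₂
    let T : Finset (V ⊕ Fin q) := {x₁, x₂}
    obtain ⟨y₁, hy₁⟩ := exists_sumElim_eq.{u} T (z := x₁) (by simp [T])
    obtain ⟨y₂, hy₂⟩ := exists_sumElim_eq.{u} T (z := x₂) (by simp [T])
    refine ⟨T.toLeft, 0, fun {M N} _ _ _ _ hM hN v xs v' xs' h h1 => ?_⟩
    obtain ⟨A, f, -, hf⟩ := h.exists_isEmb_finite hM hN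
    have h1 : Sum.elim v xs x₁ = Sum.elim v xs x₂ := h1
    show Sum.elim v' xs' x₁ = Sum.elim v' xs' x₂
    rw [hy₁, hy₂] at h1 ⊢
    rw [← (hf y₁).2, ← (hf y₂).2, h1]
  | @rel q l R ts =>
    choose x hx using fun i => exists_eq_var (ts i)
    obtain rfl : (fun i => Term.var (x i)) = ts := funext fun i => (hx i).symm
    let T : Finset (V ⊕ Fin q) := Finset.univ.image x
    choose y hy using fun i =>
      exists_sumElim_eq.{u} T (Finset.mem_image_of_mem x (Finset.mem_univ i))
    refine ⟨T.toLeft, 0, fun {M N} _ _ _ _ hM hN v xs v' xs' h h1 => ?_⟩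
    obtain ⟨A, f, hfA, hf⟩ := h.exists_isEmb_finite hM hN
    have h1 : Structure.RelMap R fun i => Sum.elim v xs (x i) := h1
    show Structure.RelMap R fun i => Sum.elim v' xs' (x i)
    simp only [hy] at h1 ⊢
    rw [hfA.relMap_iff (isHypergraph_of_model hM) (isHypergraph_of_model hN) ⟨l, R⟩
      fun i => (hf (y i)).1] at h1
    convert h1 using 2 with i
    exact (hf (y i)).2.symm
  | imp φ₁ φ₂ ih₁ ih₂ =>
    obtain ⟨W₁, n₁, h₁⟩ := ih₁
    obtain ⟨W₂, n₂, h₂⟩ := ih₂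
    refine ⟨W₁ ∪ W₂, max n₁ n₂, fun hM hN v xs v' xs' h h' h'₁ => ?_⟩
    exact h₂ hM hN v xs v' xs' (h.of_subset Finset.subset_union_right (le_max_right _ _))
      (h' (h₁ hN hM v' xs' v xs
        (h.of_subset Finset.subset_union_left (le_max_left _ _)).symm h'₁))
  | @all q φ ih =>
    -- by the back-and-forth step, a counterexample `d` on one side yields one on the other side
    obtain ⟨W, n, ih⟩ := ih
    obtain ⟨n', hn'⟩ := exists_sim_step.{u} h2 hα hE n (W.card + q)
    refine ⟨W, n', fun {M N} _ _ _ _ hM hN v xs v' xs' h h' d => ?_⟩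
    obtain ⟨c, hc⟩ := hn' hN hM (by simp) _ _ h.symm d
    refine ih hM hN v _ v' _ ?_ (h' c)
    let e : W ⊕ Fin (q + 1) → Option (W ⊕ Fin q) :=
      Sum.elim (fun i => some (Sum.inl i))
        (Fin.snoc (α := fun _ => Option (W ⊕ Fin q)) (fun i => some (Sum.inr i)) none)
    have he : Function.Injective e := by
      rintro (i | i) (j | j)
      · simp [e]
      · induction j using Fin.lastCases <;> simp [e]
      · induction i using Fin.lastCases <;> simp [e]
      · induction i using Fin.lastCases <;> induction j using Fin.lastCases <;> simp [e]
    convert hc.symm.comp ⟨e, he⟩ using 1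
    all_goals
      funext i
      rcases i with i | i
      · rfl
      · induction i using Fin.lastCases <;> simp [e]

end QuantifierElimination

end BaldwinShi

open BaldwinShi
theorem mainTheorem3 (L : FirstOrder.Language) [L.IsRelational] [Fintype (Symb L)]
    (hL : ∀ E : Symb L, 2 ≤ E.1) (α : Symb L → ℝ) (hα : ∀ E, 0 < α E ∧ α E ≤ 1)
    (hα' : (∀ E : Symb L, E.1 = 2) → ¬ ∀ E, α E = 1) :
    (∀ σ ∈ theoryS α, IsForallExists σ) ∧
    ∀ (V : Type*) (φ : L.Formula V), ∃ ψ : L.Formula V,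
      IsBoolComb (chainMinimalFormulas α V) ψ ∧ φ ⇔[theoryS α] ψ := by
  refine ⟨fun σ => isForallExists_of_mem_theoryS, fun V φ => ?_⟩
  obtain ⟨E, hE⟩ := exists_isPathSymbol (ar := Sigma.fst) hL hα hα'
  obtain ⟨W, n, h⟩ := exists_sim_realize hL hα hE φ
  refine exists_isBoolComb_of_sim (W := W) (n := n) fun M N v v' hs => ?_
  refine h M.is_model N.is_model v default v' default ?_
  convert hs.comp (Equiv.sumEmpty W (Fin 0)).toEmbedding using 1
  all_goals
    funext i
    rcases i with i | i
    · rfl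
    · exact isEmptyElim i
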